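/- **Setting.** Let $(\Lambda,P)$ be a probability space with $L^2(\Lambda)$ separable, and let $\tau$ be a three-dimensional dynamical system on it: $\tau(y):\Lambda\to\Lambda$ ($y\in\mathbb R^3$) are measurable, invertible, measure preserving maps with $\tau(0)=\mathrm{Id}$, $\tau(x+y)=\tau(x)\circ\tau(y)$, and $(y,\omega)\mapsto\tau(y)\omega$ is measurable for the product of the Lebesgue $\sigma$-algebra and that of $\Lambda$. Let $T>0$, let $\Omega\subset\mathbb R^3$ be open, bounded and connected, and let $Z=(0,1)^3$. Let $\eta=(\eta_{ij})$ and $\mu=(\mu_{ij})$ be symmetric $3\times3$ matrices with entries in $\mathcal C(\overline\Omega;L^\infty(\Lambda\times\mathbb R^3_z))$, $Z$-periodic in $z$, each represented by a function that is continuous in $x\in\overline\Omega$ for almost all $(\omega,z)$. Suppose there are $c_1,c_2>0$ with $|\eta\lambda|,|\mu\lambda|\le c_1|\lambda|$ and $\eta\lambda\cdot\lambda,\ \mu\lambda\cdot\lambda\ge c_2|\lambda|^2$ for all $x\in\overline\Omega$, almost all $(\omega,z)$ and all $\lambda\in\mathbb R^3$. Let $\sigma:\overline\Omega\times\Lambda\times\mathbb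 R^3_z\times\mathbb R^3_\xi\to\mathbb R^3$ be such that: - $\sigma(x,\cdot,\cdot,\xi)$ is measurable in $(\omega,z)$ and $Z$-periodic in $z$; - $\sigma(x,\omega,z,0)=0$; - $\sigma(\cdot,\omega,z,\cdot)$ is continuous on $\overline\Omega\times\mathbb R^3$ for almost all $(\omega,z)$; - for some $c_1>0$ and $\delta\ge1$, $|\sigma(x,\omega,z,\xi)-\sigma(x,\omega,z,\xi')|\le c_1|\xi-\xi'|$ and $(\sigma(x,\omega,z,\xi)-\sigma(x,\omega,z,\xi'))\cdot(\xi-\xi')\ge\delta|\xi-\xi'|^2$; - $(D_\xi\sigma(x,\omega,z,\xi)\zeta)\cdot\zeta\ge0$ wherever $D_\xi\sigma$ exists. These hold for all $x\in\overline\Omega$ and $\xi,\xi',\zeta\in\mathbb R^3$, for almost all $(\omega,z)$. Fix $\varepsilon>0$ and write $a^\varepsilon(x,\omega)=a(x,\tau(\tfrac x\varepsilon)\omega,\tfrac x{\varepsilon^2})$ and $\sigma^\varepsilon(E)(x,\omega)=\sigma(x,\tau(\tfrac x\varepsilon)\omega,\tfrac x{\varepsilon^2},E(x,\omega))$. The operators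 curl and div are taken in $x$ in the sense of $L^2(\Lambda)$-valued distributions on $\Omega$, and $H_{\mathrm{curl}}(\Omega;L^2(\Lambda))$, $H_{\mathrm{div}}(\Omega;L^2(\Lambda))$ are the spaces of $v\in L^2(\Omega\times\Lambda)^3$ with $\mathrm{curl}\,v\in L^2(\Omega\times\Lambda)^3$, respectively $\mathrm{div}\,v\in L^2(\Omega\times\Lambda)$. For $v\in H_{\mathrm{curl}}(\Omega;L^2(\Lambda))$, the condition $\gamma\wedge v=0$ on $\partial\Omega\times\Lambda$ ($\gamma$ the unit outer normal) is understood weakly: $\int_{\Omega\times\Lambda}(\mathrm{curl}\,v\cdot w-v\cdot\mathrm{curl}\,w)\,dx\,dP=0$ for all $w\in H_{\mathrm{curl}}(\Omega;L^2(\Lambda))$. Let $F_\varepsilon\in L^2(0,T;H_{\mathrm{div}}(\Omega;L^2(\Lambda)))$ with $\partial_tF_\varepsilon\in L^\infty(0,T;L^2(\Omega\times\Lambda)^3)$ and $\partial_t^2F_\varepsilon\in L^2(0,T;L^2(\Omega\times\Lambda)^3)$. Let $E^0_\varepsilon,H^0_\varepsilon\in H_{\mathrm{curl}}(\Omega;L^2(\Lambda))$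 be compatible with the problem: $\gamma\wedge E^0_\varepsilon=0$ on $\partial\Omega\times\Lambda$ and $\mathrm{div}(\mu^\varepsilon H^0_\varepsilon)=0$ in $\Omega\times\Lambda$. **Theorem 3.1.** There is exactly one couple $(E_\varepsilon,H_\varepsilon)$ (up to equality almost everywhere) with $$E_\varepsilon,H_\varepsilon\in L^2(0,T;H_{\mathrm{curl}}(\Omega;L^2(\Lambda))),\qquad \partial_tE_\varepsilon,\partial_tH_\varepsilon\in L^2(0,T;L^2(\Omega\times\Lambda)^3),$$ such that, with $D_\varepsilon=\eta^\varepsilon E_\varepsilon$, $B_\varepsilon=\mu^\varepsilon H_\varepsilon$ and $J_\varepsilon=\sigma^\varepsilon(E_\varepsilon)$, $$\partial_tD_\varepsilon+J_\varepsilon=\mathrm{curl}\,H_\varepsilon+F_\varepsilon,\quad \partial_tB_\varepsilon=-\mathrm{curl}\,E_\varepsilon,\quad \mathrm{div}\,B_\varepsilon=0,\quad \mathrm{div}\,D_\varepsilon=Q_\varepsilon\quad\text{in }\Omega\times\Lambda\times\,]0,T[,$$ $$E_\varepsilon(0)=E^0_\varepsilon,\quad H_\varepsilon(0)=H^0_\varepsilon,\qquad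 \gamma\wedge E_\varepsilon=0\ \text{ on }\partial\Omega\times\Lambda\times\,]0,T[.$$ Here the initial values are those of the representatives in $\mathcal C([0,T];L^2(\Omega\times\Lambda)^3)$, and the charge density $Q_\varepsilon$ is not prescribed: for almost every $t$, $Q_\varepsilon(t)$ is the $L^2(\Lambda)$-valued distribution $\mathrm{div}\,D_\varepsilon(t)$ on $\Omega$. -/

import Mathlib

open MeasureTheory Set Filter Topology TopologicalSpace
open scoped Distributions RealInnerProductSpace

noncomputable section

namespace StochMaxwell

/-- Three-dimensional Euclidean space. -/
abbrev E3 : Type := EuclideanSpace ℝ (Fin 3)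

/-- The partial derivative `∂_i φ_j` of a vector field at `x`. -/
def partialDeriv (φ : E3 → E3) (i j : Fin 3) (x : E3) : ℝ :=
  (fderiv ℝ φ x (EuclideanSpace.single i (1 : ℝ))) j

/-- The classical curl of a differentiable vector field. -/
def curl (φ : E3 → E3) (x : E3) : E3 :=
  !₂[partialDeriv φ 1 2 x - partialDeriv φ 2 1 x,
     partialDeriv φ 2 0 x - partialDeriv φ 0 2 x,
     partialDeriv φ 0 1 x - partialDeriv φ 1 0 x]

section Spaces

variable {Λ : Type*} [MeasurableSpace Λ]

/-- The product of Lebesgue measure on `Ω` and the probability `P` on `Λ`. -/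
abbrev domMeasure (Ω : Opens E3) (P : Measure Λ) : Measure (E3 × Λ) :=
  ((volume : Measure E3).restrict (Ω : Set E3)).prod P

/-- The space `L²(Ω × Λ)³`, that is, `L²(Ω; L²(Λ))³`. -/
abbrev FieldL2 (Ω : Opens E3) (P : Measure Λ) : Type _ := Lp E3 2 (domMeasure Ω P)

/-- The time interval `]0, T[` as an open subset of `ℝ`. -/
def timeInterval (T : ℝ) : Opens ℝ := ⟨Ioo 0 T, isOpen_Ioo⟩

/-- Lebesgue measure on `]0, T[`. -/
abbrev timeMeasure (T : ℝ) : Measure ℝ := (volume : Measure ℝ).restrict (Ioo 0 T)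

/-- The Bochner space `L²(0, T; V)`. -/
abbrev TimeL2 (T : ℝ) (V : Type*) [NormedAddCommGroup V] : Type _ := Lp V 2 (timeMeasure T)

/-! ### Weak differential operators in the space variable

The distributions in `x ∈ Ω` have values in `L²(Λ)`; an identity in `L²(Λ)` is tested
against all `g ∈ L²(Λ)`. -/

/-- `c = curl u` in the sense of `L²(Λ)`-valued distributions on `Ω`. In particular
`u ∈ H_curl(Ω; L²(Λ))` if and only if such a `c ∈ L²(Ω × Λ)³` exists. -/
def HasWeakCurl {Ω : Opens E3} {P : Measure Λ} (u c : FieldL2 Ω P) : Prop :=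
  ∀ (φ : 𝓓(Ω, E3)) (g : Lp ℝ 2 P),
    ∫ p, g p.2 * ⟪u p, curl φ p.1⟫ ∂(domMeasure Ω P) =
      ∫ p, g p.2 * ⟪c p, φ p.1⟫ ∂(domMeasure Ω P)

/-- Membership in `H_curl(Ω; L²(Λ))`. -/
def MemHcurl {Ω : Opens E3} {P : Measure Λ} (u : FieldL2 Ω P) : Prop :=
  ∃ c : FieldL2 Ω P, HasWeakCurl u c

/-- The number `⟨div u, φ ⊗ g⟩ = - ∫∫ g(ω) u(x, ω) · ∇φ(x) dx dP`. -/
def divPairing {Ω : Opens E3} {P : Measure Λ} (u : FieldL2 Ω P)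
    (φ : 𝓓(Ω, ℝ)) (g : Lp ℝ 2 P) : ℝ :=
  -∫ p, g p.2 * fderiv ℝ φ p.1 (u p) ∂(domMeasure Ω P)

/-- `div u = q` as `L²(Λ)`-valued distributions on `Ω`. -/
def HasDistribDiv {Ω : Opens E3} {P : Measure Λ} (u : FieldL2 Ω P)
    (q : 𝓓'(Ω, Lp ℝ 2 P)) : Prop :=
  ∀ (φ : 𝓓(Ω, ℝ)) (g : Lp ℝ 2 P), ⟪q φ, g⟫ = divPairing u φ g

/-- `div u = d` in the weak sense with `d ∈ L²(Ω × Λ)`. -/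
def HasWeakDiv {Ω : Opens E3} {P : Measure Λ} (u : FieldL2 Ω P)
    (d : Lp ℝ 2 (domMeasure Ω P)) : Prop :=
  ∀ (φ : 𝓓(Ω, ℝ)) (g : Lp ℝ 2 P),
    ∫ p, g p.2 * (d p * φ p.1) ∂(domMeasure Ω P) = divPairing u φ g

/-- The boundary condition `γ ∧ u = 0` on `∂Ω × Λ` for `u ∈ H_curl(Ω; L²(Λ))`. The tangential
trace of `u` acts, by Green's formula, on the fields of `H_curl(Ω; L²(Λ))` as
`w ↦ ∫∫ (curl u · w - u · curl w) dx dP`, which for fields that are smooth up to a regular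
boundary is the surface integral of `(γ ∧ u) · w`; the condition is that this functional is zero. -/
def HasZeroTangentialTrace {Ω : Opens E3} {P : Measure Λ} (u : FieldL2 Ω P) : Prop :=
  ∃ c : FieldL2 Ω P, HasWeakCurl u c ∧
    ∀ w cw : FieldL2 Ω P, HasWeakCurl w cw → ⟪c, w⟫ - ⟪u, cw⟫ = 0

/-! ### The time variable -/

/-- `u'` is the weak derivative on `]0, T[` of `u`. -/
def HasWeakTimeDeriv {T : ℝ} {V : Type*} [NormedAddCommGroup V] [NormedSpace ℝ V]
    (u u' : TimeL2 T V) : Prop :=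
  ∀ ψ : 𝓓(timeInterval T, ℝ),
    ∫ t, deriv ψ t • u t ∂(timeMeasure T) = -∫ t, ψ t • u' t ∂(timeMeasure T)

/-- `u(0) = u₀`: `u` has a representative that is continuous on `[0, T]` with value `u₀` at `0`. -/
def HasInitialValue {T : ℝ} {V : Type*} [NormedAddCommGroup V]
    (u : TimeL2 T V) (u₀ : V) : Prop :=
  ∃ v : ℝ → V, ContinuousOn v (Icc 0 T) ∧ (∀ᵐ t ∂(timeMeasure T), u t = v t) ∧ v 0 = u₀

end Spaces

section Coefficients

variable {Λ : Type*} [MeasurableSpace Λ]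

/-- A three-dimensional dynamical system on the probability space `(Λ, P)`. Joint measurability
is with respect to the product of the Lebesgue `σ`-algebra of `ℝ³` and that of `Λ`. -/
structure IsDynamicalSystem (P : Measure Λ) (τ : E3 → Λ → Λ) : Prop where
  bijective : ∀ y, Function.Bijective (τ y)
  zero : τ 0 = id
  add : ∀ x y, τ (x + y) = τ x ∘ τ y
  measurePreserving : ∀ y, MeasurePreserving (τ y) P P
  measurable : Measurable
    (fun p : NullMeasurableSpace E3 (volume : Measure E3) × Λ => τ p.1 p.2)

/-- The point of `ℝ³` with integer coordinates `k`. -/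
def latticePoint (k : Fin 3 → ℤ) : E3 := WithLp.toLp 2 (fun i => (k i : ℝ))

/-- The trace `a(x, τ(x/ε)ω, x/ε²)`, at the point `p = (x, ω)`. -/
def osc {β : Type*} (τ : E3 → Λ → Λ) (ε : ℝ) (a : E3 → Λ → E3 → β) (p : E3 × Λ) : β :=
  a p.1 (τ (ε⁻¹ • p.1) p.2) ((ε ^ 2)⁻¹ • p.1)

/-- A permittivity or permeability tensor: a symmetric matrix with entries in
`C(closure Ω; L^∞(Λ; L^∞_per(Z)))` that is bounded and uniformly positive.
An element of this space is represented by a function of `(x, ω, z)` that is continuous in `x` for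
almost all `(ω, z)`; every element has such a representative, as `closure Ω` is compact and
separable, and it determines the trace `osc` almost everywhere. By periodicity, almost all
`(ω, z) ∈ Λ × Z` is the same as almost all `(ω, z) ∈ Λ × ℝ³`. -/
structure IsMaterialTensor (Ω : Opens E3) (P : Measure Λ)
    (a : E3 → Λ → E3 → Matrix (Fin 3) (Fin 3) ℝ) : Prop where
  aemeasurable : ∀ x ∈ closure (Ω : Set E3), ∀ i j,
    AEMeasurable (fun p : Λ × E3 => a x p.1 p.2 i j) (P.prod volume)
  periodic : ∀ x ∈ closure (Ω : Set E3), ∀ᵐ p ∂(P.prod (volume : Measure E3)),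
    ∀ k : Fin 3 → ℤ, a x p.1 (p.2 + latticePoint k) = a x p.1 p.2
  continuous_Linfty : ∀ x₀ ∈ closure (Ω : Set E3), ∀ r > 0, ∃ ρ > 0,
    ∀ x ∈ closure (Ω : Set E3), dist x x₀ < ρ → ∀ i j,
      ∀ᵐ p ∂(P.prod (volume : Measure E3)), |a x p.1 p.2 i j - a x₀ p.1 p.2 i j| ≤ r
  continuous_repr : ∀ᵐ p ∂(P.prod (volume : Measure E3)), ∀ i j,
    ContinuousOn (fun x => a x p.1 p.2 i j) (closure (Ω : Set E3))
  symm : ∀ x ∈ closure (Ω : Set E3), ∀ᵐ p ∂(P.prod (volume : Measure E3)),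
    ∀ i j, a x p.1 p.2 i j = a x p.1 p.2 j i
  bounded : ∃ c₁ > 0, ∀ x ∈ closure (Ω : Set E3), ∀ᵐ p ∂(P.prod (volume : Measure E3)),
    ∀ l : E3, ‖Matrix.toEuclideanLin (a x p.1 p.2) l‖ ≤ c₁ * ‖l‖
  coercive : ∃ c₂ > 0, ∀ x ∈ closure (Ω : Set E3), ∀ᵐ p ∂(P.prod (volume : Measure E3)),
    ∀ l : E3, c₂ * ‖l‖ ^ 2 ≤ ⟪Matrix.toEuclideanLin (a x p.1 p.2) l, l⟫

/-- The hypotheses on the nonlinear conductivity `σ(x, ω, z, ξ)`. Joint measurability in `(ω, z)`,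
for fixed `x` and `ξ`, contains measurability in `ω` and in `z` separately, up to null sets. -/
structure IsConductivity (Ω : Opens E3) (P : Measure Λ)
    (σ : E3 → Λ → E3 → E3 → E3) : Prop where
  aemeasurable : ∀ x ∈ closure (Ω : Set E3), ∀ ξ,
    AEMeasurable (fun p : Λ × E3 => σ x p.1 p.2 ξ) (P.prod volume)
  periodic : ∀ x ∈ closure (Ω : Set E3), ∀ ξ, ∀ᵐ p ∂(P.prod (volume : Measure E3)),
    ∀ k : Fin 3 → ℤ, σ x p.1 (p.2 + latticePoint k) ξ = σ x p.1 p.2 ξ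
  zero : ∀ x ∈ closure (Ω : Set E3), ∀ᵐ p ∂(P.prod (volume : Measure E3)),
    σ x p.1 p.2 0 = 0
  continuous : ∀ᵐ p ∂(P.prod (volume : Measure E3)),
    ContinuousOn (fun y : E3 × E3 => σ y.1 p.1 p.2 y.2) (closure (Ω : Set E3) ×ˢ univ)
  lipschitz : ∃ c₁ > 0, ∀ x ∈ closure (Ω : Set E3), ∀ ξ ξ' : E3,
    ∀ᵐ p ∂(P.prod (volume : Measure E3)),
      ‖σ x p.1 p.2 ξ - σ x p.1 p.2 ξ'‖ ≤ c₁ * ‖ξ - ξ'‖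
  monotone : ∃ δ ≥ (1 : ℝ), ∀ x ∈ closure (Ω : Set E3), ∀ ξ₁ ξ₂ : E3,
    ∀ᵐ p ∂(P.prod (volume : Measure E3)),
      δ * ‖ξ₁ - ξ₂‖ ^ 2 ≤ ⟪σ x p.1 p.2 ξ₁ - σ x p.1 p.2 ξ₂, ξ₁ - ξ₂⟫
  /-- The differential in `ξ` is nonnegative wherever it exists. -/
  deriv_nonneg : ∀ x ∈ closure (Ω : Set E3), ∀ ξ₁ ξ₂ : E3,
    ∀ᵐ p ∂(P.prod (volume : Measure E3)), ∀ L : E3 →L[ℝ] E3,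
      HasFDerivAt (fun ξ => σ x p.1 p.2 ξ) L ξ₁ → 0 ≤ ⟪L ξ₂, ξ₂⟫

end Coefficients

section Problem

variable {Λ : Type*} [MeasurableSpace Λ]

/-- The source: `F ∈ L²(0, T; H_div(Ω; L²(Λ)))`, `∂_t F ∈ L^∞(0, T; L²(Ω × Λ)³)` and
`∂_t² F ∈ L²(0, T; L²(Ω × Λ)³)`. -/
def IsSource {Ω : Opens E3} {P : Measure Λ} {T : ℝ} (F : TimeL2 T (FieldL2 Ω P)) : Prop :=
  (∃ d : TimeL2 T (Lp ℝ 2 (domMeasure Ω P)), ∀ᵐ t ∂(timeMeasure T), HasWeakDiv (F t) (d t)) ∧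
  ∃ F' F'' : TimeL2 T (FieldL2 Ω P),
    HasWeakTimeDeriv F F' ∧ MemLp F' ⊤ (timeMeasure T) ∧ HasWeakTimeDeriv F' F''

/-- `div (μ^ε H⁰) = 0` in `Ω × Λ`. -/
def InitialInductionSolenoidal {Ω : Opens E3} {P : Measure Λ} (τ : E3 → Λ → Λ) (ε : ℝ)
    (μ : E3 → Λ → E3 → Matrix (Fin 3) (Fin 3) ℝ) (H₀ : FieldL2 Ω P) : Prop :=
  ∃ B₀ : FieldL2 Ω P,
    (∀ᵐ p ∂(domMeasure Ω P), B₀ p = Matrix.toEuclideanLin (osc τ ε μ p) (H₀ p)) ∧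
    HasDistribDiv B₀ 0

/-- `(E, H)` is a solution of the Maxwell problem at scale `ε` with permittivity `η`,
permeability `μ`, conductivity `σ`, source `F` and initial fields `E₀`, `H₀`:
`(E, H) ∈ L²(0, T; H_curl(Ω; L²(Λ)))²`, `(∂_t E, ∂_t H) ∈ L²(0, T; L²(Ω × Λ)³)²`, and with
`D = η^ε E`, `B = μ^ε H`, `J = σ^ε(E)`, all equations of the problem hold. The charge density `Q`
is not a datum: it is the `L²(Λ)`-valued distribution on `Ω` with `div D = Q`. -/
def IsSolution {Ω : Opens E3} {P : Measure Λ} {T : ℝ} (τ : E3 → Λ → Λ) (ε : ℝ)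
    (η μ : E3 → Λ → E3 → Matrix (Fin 3) (Fin 3) ℝ) (σ : E3 → Λ → E3 → E3 → E3)
    (F : TimeL2 T (FieldL2 Ω P)) (E₀ H₀ : FieldL2 Ω P)
    (E H : TimeL2 T (FieldL2 Ω P)) : Prop :=
  ∃ curlE curlH E' H' D B J D' B' : TimeL2 T (FieldL2 Ω P),
    -- regularity in space and in time
    (∀ᵐ t ∂(timeMeasure T), HasWeakCurl (E t) (curlE t)) ∧
    (∀ᵐ t ∂(timeMeasure T), HasWeakCurl (H t) (curlH t)) ∧
    HasWeakTimeDeriv E E' ∧ HasWeakTimeDeriv H H' ∧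
    -- constitutive laws
    (∀ᵐ t ∂(timeMeasure T), ∀ᵐ p ∂(domMeasure Ω P),
      D t p = Matrix.toEuclideanLin (osc τ ε η p) (E t p)) ∧
    (∀ᵐ t ∂(timeMeasure T), ∀ᵐ p ∂(domMeasure Ω P),
      B t p = Matrix.toEuclideanLin (osc τ ε μ p) (H t p)) ∧
    (∀ᵐ t ∂(timeMeasure T), ∀ᵐ p ∂(domMeasure Ω P),
      J t p = osc τ ε σ p (E t p)) ∧
    -- evolution equations
    HasWeakTimeDeriv D D' ∧ HasWeakTimeDeriv B B' ∧
    D' + J = curlH + F ∧ B' = -curlE ∧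
    -- divergence equations
    (∀ᵐ t ∂(timeMeasure T), HasDistribDiv (B t) 0) ∧
    (∃ Q : ℝ → 𝓓'(Ω, Lp ℝ 2 P), ∀ᵐ t ∂(timeMeasure T), HasDistribDiv (D t) (Q t)) ∧
    -- initial and boundary conditions
    HasInitialValue E E₀ ∧ HasInitialValue H H₀ ∧
    (∀ᵐ t ∂(timeMeasure T), HasZeroTangentialTrace (E t))

end Problem

end StochMaxwell

end

open StochMaxwell

/-!
Write `u = (E, H)`, `M = diag(η^ε, μ^ε)`, `S(E, H) = (-σ^ε(E), 0)`, `f = (F, 0)` and let `A` be the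
Maxwell relation `(E, H) ↦ (curl H, -curl E)` with `γ ∧ E = 0`. The evolution equations are
`M u' = A u + S u + f` in the Hilbert space of pairs of fields. With the weak form of the boundary
condition, `curl` on fields of zero tangential trace is the adjoint of the maximal weak curl, so
that `A` is skew-adjoint (`isSkewAdjointRel_maxwellRel`). It is treated as a closed linear relation,
which spares a proof that its domain is dense. The operator `M` is bounded, symmetric and coercive,
`S` is Lipschitz and dissipative because `σ` is Lipschitz and monotone, and `f` is Lipschitz in time
because `∂_t F` is bounded. That `η^ε`, `μ^ε` and `σ^ε` define such operators on `L²(Ω × Λ)³`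
(`IsMaterialTensor.exists_mulOperator`, `IsConductivity.exists_superposition`) rests on the
invariance of `P` under `τ`: the map `(x, ω) ↦ (τ(x/ε)ω, x/ε²)` pulls null sets back to null sets,
and Carathéodory functions composed with it are almost everywhere measurable.

Existence (`IsEvolutionData.exists_solution`) is by Yosida approximation: `A` is replaced by a
bounded dissipative operator, which gives an ordinary differential equation with Lipschitz right
side. Energy estimates bound the solutions and their time derivatives, the latter because the
initial value lies in the domain of `A`, and show that the solutions form a Cauchy sequence
uniformly in time. The time derivatives and the values of the regularized `A` converge weakly in
`L²(0, T)`, and the graph of `A` is weakly closed.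

Uniqueness (`IsEvolutionData.ae_eq_of_primitive`) holds because the energy `⟪M u, u⟫` of the
difference of two solutions does not increase: `A` does no work and `S` only dissipates.

The divergence equations are no further constraints. The divergence of a curl vanishes, so `div B`
keeps its initial value zero (`HasInitialValue.ae_hasDistribDiv_zero`), and every square integrable
field has a distributional divergence, which serves as the charge density
(`exists_hasDistribDiv`).
-/


/-! ### Ordinary differential equations with a globally Lipschitz field -/

namespace StochMaxwell

/-- Global existence for an ordinary differential equation with a uniformly Lipschitz field. -/
theorem exists_hasDerivAt_of_lipschitz {X : Type*} [NormedAddCommGroup X] [NormedSpace ℝ X]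
    [CompleteSpace X] {g : ℝ → X → X} {K : NNReal} (hL : ∀ t, LipschitzWith K (g t))
    (hc : ∀ x, Continuous fun t => g t x) {T : ℝ} (hT : 0 ≤ T) (x₀ : X) :
    ∃ u : ℝ → X, Continuous u ∧ u 0 = x₀ ∧ ∀ t ∈ Icc 0 T, HasDerivAt u (g t (u t)) t := by
  have hg : Continuous (Function.uncurry g) :=
    continuous_prod_of_continuous_lipschitzWith' _ K hL hc
  set k : ℝ := 2 * K + 1 with hk
  have hk0 : 0 < k := by positivity
  -- the unknown is multiplied by `exp (-k t)`, which makes the Picard map a contraction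
  let ext : C(Icc (0 : ℝ) T, X) → ℝ → X := fun α s => α (projIcc 0 T hT s)
  have hext : ∀ α, Continuous (ext α) := fun α => α.continuous.comp continuous_projIcc
  let I : C(Icc (0 : ℝ) T, X) → ℝ → X := fun α s => g s (Real.exp (k * s) • ext α s)
  have hI : ∀ α, Continuous (I α) := fun α =>
    hg.comp (continuous_id.prodMk ((by fun_prop : Continuous fun s => Real.exp (k * s)).smul
      (hext α)))
  have hprim : ∀ α, Continuous fun t => x₀ + ∫ s in (0 : ℝ)..t, I α s := fun α =>
    continuous_const.add (intervalIntegral.continuous_primitive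
      (fun a b => (hI α).intervalIntegrable a b) 0)
  let Φ : C(Icc (0 : ℝ) T, X) → C(Icc (0 : ℝ) T, X) := fun α =>
    ⟨fun t => Real.exp (-(k * t)) • (x₀ + ∫ s in (0 : ℝ)..t, I α s),
      (by fun_prop : Continuous fun t : Icc (0 : ℝ) T => Real.exp (-(k * t))).smul
        ((hprim α).comp continuous_subtype_val)⟩
  have hΦ : ContractingWith (1 / 2) Φ := by
    refine ⟨by rw [← NNReal.coe_lt_coe]; norm_num, LipschitzWith.of_dist_le_mul fun α β => ?_⟩
    rw [ContinuousMap.dist_le (by positivity)]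
    intro t
    have h1 : ‖∫ s in (0 : ℝ)..t, (I α s - I β s)‖ ≤
        ∫ s in (0 : ℝ)..t, (K * dist α β) * Real.exp (k * s) := by
      refine intervalIntegral.norm_integral_le_of_norm_le t.2.1
        (Eventually.of_forall fun s _ => ?_)
        ((by fun_prop : Continuous fun s : ℝ =>
          (K * dist α β) * Real.exp (k * s)).intervalIntegrable _ _)
      rw [← dist_eq_norm]
      refine ((hL s).dist_le_mul _ _).trans ?_
      rw [dist_smul₀, Real.norm_eq_abs, abs_of_pos (Real.exp_pos _), mul_assoc,
        mul_comm (Real.exp _)]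
      gcongr
      exact ContinuousMap.dist_apply_le_dist _
    have h2 : ∫ s in (0 : ℝ)..t, (K * dist α β) * Real.exp (k * s) =
        (K * dist α β) * ((Real.exp (k * t) - 1) / k) := by
      rw [intervalIntegral.integral_const_mul]
      congr 1
      rw [intervalIntegral.integral_comp_mul_left (fun s => Real.exp s) hk0.ne', integral_exp]
      simp [div_eq_inv_mul]
    have h3 : dist (Φ α t) (Φ β t) =
        Real.exp (-(k * t)) * ‖∫ s in (0 : ℝ)..t, (I α s - I β s)‖ := by
      change dist (Real.exp (-(k * t)) • (x₀ + ∫ s in (0 : ℝ)..t, I α s))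
        (Real.exp (-(k * t)) • (x₀ + ∫ s in (0 : ℝ)..t, I β s)) = _
      rw [dist_smul₀, Real.norm_eq_abs, abs_of_pos (Real.exp_pos _), dist_add_left,
        dist_eq_norm, intervalIntegral.integral_sub ((hI α).intervalIntegrable _ _)
          ((hI β).intervalIntegrable _ _)]
    rw [h3]
    have h4 : Real.exp (-(k * t)) * (Real.exp (k * t) - 1) ≤ 1 := by
      rw [mul_sub, ← Real.exp_add]
      simp [Real.exp_nonneg]
    have h5 : (K : ℝ) / k ≤ 1 / 2 := by
      rw [div_le_div_iff₀ hk0 two_pos]; rw [hk]; linarith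
    calc Real.exp (-(k * t)) * ‖∫ s in (0 : ℝ)..t, (I α s - I β s)‖
        ≤ Real.exp (-(k * t)) * ((K * dist α β) * ((Real.exp (k * t) - 1) / k)) := by
          gcongr; exact h1.trans h2.le
      _ = (Real.exp (-(k * t)) * (Real.exp (k * t) - 1)) * ((K / k) * dist α β) := by ring
      _ ≤ 1 * ((1 / 2) * dist α β) := by gcongr
      _ = _ := by simp
  obtain ⟨α, hα, -⟩ := hΦ.exists_fixedPoint (ContinuousMap.const _ 0) (edist_ne_top _ _)
  refine ⟨fun t => x₀ + ∫ s in (0 : ℝ)..t, I α s, hprim α, by simp, fun t ht => ?_⟩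
  have h1 : HasDerivAt (fun t => x₀ + ∫ s in (0 : ℝ)..t, I α s) (I α t) t :=
    ((hI α).integral_hasStrictDerivAt 0 t).hasDerivAt.const_add x₀
  convert h1 using 1
  have h2 : α ⟨t, ht⟩ = Real.exp (-(k * t)) • (x₀ + ∫ s in (0 : ℝ)..t, I α s) :=
    (DFunLike.congr_fun hα ⟨t, ht⟩).symm
  have h3 : ext α t = α ⟨t, ht⟩ := by simp only [ext, projIcc_of_mem hT ht]
  simp only [I] at h2 ⊢
  rw [h3, h2, smul_smul, ← Real.exp_add]
  simp

/-- The differential inequality `e' ≤ e + b` bounds `e`. -/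
theorem le_mul_exp_of_deriv_le {e e' : ℝ → ℝ} {b T : ℝ}
    (he : ∀ t ∈ Icc 0 T, HasDerivAt e (e' t) t) (hb : ∀ t ∈ Icc 0 T, e' t ≤ e t + b)
    {t : ℝ} (ht : t ∈ Icc 0 T) : e t + b ≤ (e 0 + b) * Real.exp t := by
  have hd : ∀ s ∈ Icc 0 T, HasDerivAt (fun s => (e s + b) * Real.exp (-s))
      (e' s * Real.exp (-s) + (e s + b) * (Real.exp (-s) * -1)) s := fun s hs =>
    ((he s hs).add_const b).mul ((hasDerivAt_neg s).exp)
  have hanti : AntitoneOn (fun s => (e s + b) * Real.exp (-s)) (Icc 0 T) := by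
    refine antitoneOn_of_deriv_nonpos (convex_Icc 0 T)
      (fun s hs => (hd s hs).continuousAt.continuousWithinAt)
      (fun s hs => (hd s (interior_subset hs)).differentiableAt.differentiableWithinAt)
      fun s hs => ?_
    rw [(hd s (interior_subset hs)).deriv]
    have := hb s (interior_subset hs)
    nlinarith [Real.exp_pos (-s)]
  have h := hanti ⟨le_rfl, ht.1.trans ht.2⟩ ht ht.1
  simp only [neg_zero, Real.exp_zero, mul_one] at h
  calc e t + b = (e t + b) * Real.exp (-t) * Real.exp t := by
        rw [mul_assoc, ← Real.exp_add]; simp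
    _ ≤ _ := by gcongr

end StochMaxwell

/-! ### Skew-adjoint linear relations and their resolvents -/

namespace StochMaxwell

section SkewAdjoint

variable {X : Type*} [NormedAddCommGroup X] [InnerProductSpace ℝ X]

/-- A skew-adjoint linear relation `A` on a Hilbert space, given by its graph: `(x, y) ∈ A`
stands for `x ∈ D(A)`, `y = A x`. Single-valuedness, that is, density of the domain, is not
required. -/
def IsSkewAdjointRel (A : Set (X × X)) : Prop :=
  ∀ x y : X, (x, y) ∈ A ↔ ∀ p ∈ A, ⟪y, p.1⟫ + ⟪x, p.2⟫ = 0

namespace IsSkewAdjointRel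

variable {A : Set (X × X)} (hA : IsSkewAdjointRel A)
include hA

theorem add_mem {x y x' y' : X} (h : (x, y) ∈ A) (h' : (x', y') ∈ A) :
    (x + x', y + y') ∈ A := by
  rw [hA] at *
  intro p hp
  have h1 := h p hp
  have h2 := h' p hp
  simp only [inner_add_left]
  linarith

theorem smul_mem (c : ℝ) {x y : X} (h : (x, y) ∈ A) : (c • x, c • y) ∈ A := by
  rw [hA] at *
  intro p hp
  simp only [real_inner_smul_left, ← mul_add, h p hp, mul_zero]

theorem zero_mem : ((0 : X), (0 : X)) ∈ A := by
  rw [hA]; simp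

theorem sub_mem {x y x' y' : X} (h : (x, y) ∈ A) (h' : (x', y') ∈ A) :
    (x - x', y - y') ∈ A := by
  simpa [sub_eq_add_neg] using hA.add_mem h (hA.smul_mem (-1) h')

theorem inner_eq_zero {x y : X} (h : (x, y) ∈ A) : ⟪y, x⟫ = 0 := by
  have := (hA x y).1 h _ h
  simp only [real_inner_comm y x] at this
  linarith

theorem isClosed : IsClosed A := by
  have : A = ⋂ p ∈ A, {q : X × X | ⟪q.2, p.1⟫ + ⟪q.1, p.2⟫ = 0} := by
    ext ⟨x, y⟩
    rw [hA]
    simp only [mem_iInter, mem_ofPred_eq]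
  rw [this]
  exact isClosed_biInter fun p _ => isClosed_eq (by fun_prop) continuous_const

/-- The range of `1 - l A` is the whole space. With `G` the graph of `l A`, the decomposition of
`(f, 0)` along `G ⊕ Gᗮ` solves `x - (l A)² x = f`, and `x + l A x` is then a solution of the
equation of first order. -/
theorem exists_sub_smul_eq [CompleteSpace X] {l : ℝ} (hl : 0 < l) (f : X) :
    ∃ x y, (x, y) ∈ A ∧ x - l • y = f := by
  let G : Submodule ℝ (WithLp 2 (X × X)) :=
    { carrier := {w | (w.fst, l⁻¹ • w.snd) ∈ A}
      add_mem' := fun {a b} ha hb => by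
        simpa [smul_add] using hA.add_mem ha hb
      zero_mem' := by simpa using hA.zero_mem
      smul_mem' := fun c w hw => by
        simpa [smul_comm l⁻¹ c] using hA.smul_mem c hw }
  have hG : IsClosed (G : Set (WithLp 2 (X × X))) := by
    have hc : Continuous fun w : WithLp 2 (X × X) => (w.fst, l⁻¹ • w.snd) := by fun_prop
    exact hA.isClosed.preimage hc
  have : CompleteSpace G := hG.completeSpace_coe
  obtain ⟨g, hg, h, hh, hfgh⟩ := G.exists_add_mem_mem_orthogonal (WithLp.toLp 2 (f, 0))
  have hf1 : f = g.fst + h.fst := congrArg WithLp.fst hfgh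
  have hf2 : (0 : X) = g.snd + h.snd := congrArg WithLp.snd hfgh
  have hgA : (g.fst, l⁻¹ • g.snd) ∈ A := hg
  have hhA : (h.snd, l⁻¹ • h.fst) ∈ A := by
    rw [hA]
    intro p hp
    have h1 : WithLp.toLp 2 (p.1, l • p.2) ∈ G := by
      change (p.1, l⁻¹ • l • p.2) ∈ A
      rwa [inv_smul_smul₀ hl.ne']
    have h2 := (Submodule.mem_orthogonal' _ _).1 hh _ h1
    simp only [WithLp.prod_inner_apply, real_inner_smul_right] at h2
    change ⟪h.fst, p.1⟫ + l * ⟪h.snd, p.2⟫ = 0 at h2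
    rw [real_inner_smul_left, inv_mul_eq_div, div_add' _ _ _ hl.ne', mul_comm, h2, zero_div]
  refine ⟨g.fst - h.snd, l⁻¹ • g.snd - l⁻¹ • h.fst, hA.sub_mem hgA hhA, ?_⟩
  rw [smul_sub, smul_inv_smul₀ hl.ne', smul_inv_smul₀ hl.ne', hf1]
  have : h.snd = -g.snd := (neg_eq_of_add_eq_zero_right hf2.symm).symm
  rw [this]
  abel

theorem norm_sq_sub_smul {l : ℝ} {x y : X} (h : (x, y) ∈ A) :
    ‖x - l • y‖ ^ 2 = ‖x‖ ^ 2 + ‖l • y‖ ^ 2 := by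
  rw [@norm_sub_sq_real, real_inner_smul_right, real_inner_comm, hA.inner_eq_zero h]
  ring

theorem sub_smul_injective {l : ℝ} (hl : 0 < l) {x y x' y' : X} (h : (x, y) ∈ A)
    (h' : (x', y') ∈ A) (he : x - l • y = x' - l • y') : x = x' ∧ y = y' := by
  have h1 := hA.norm_sq_sub_smul (l := l) (hA.sub_mem h h')
  have h2 : x - x' - l • (y - y') = 0 := by
    rw [smul_sub]; rw [← sub_eq_zero] at he; rw [← he]; abel
  rw [h2, norm_zero] at h1
  have h3 : ‖x - x'‖ ^ 2 = 0 := by nlinarith [sq_nonneg ‖x - x'‖, sq_nonneg ‖l • (y - y')‖]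
  have h4 : ‖l • (y - y')‖ ^ 2 = 0 := by
    nlinarith [sq_nonneg ‖x - x'‖, sq_nonneg ‖l • (y - y')‖]
  simp only [ne_eq, OfNat.ofNat_ne_zero, not_false_eq_true, pow_eq_zero_iff, norm_eq_zero,
    smul_eq_zero, sub_eq_zero, hl.ne', false_or] at h3 h4
  exact ⟨h3, h4⟩

variable [CompleteSpace X]

/-- The resolvent `(1 - l A)⁻¹`. -/
noncomputable def resolvent {l : ℝ} (hl : 0 < l) : X →L[ℝ] X :=
  LinearMap.mkContinuous
    { toFun := fun f => (hA.exists_sub_smul_eq hl f).choose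
      map_add' := fun f g => by
        obtain ⟨y, hy, hy'⟩ := (hA.exists_sub_smul_eq hl f).choose_spec
        obtain ⟨z, hz, hz'⟩ := (hA.exists_sub_smul_eq hl g).choose_spec
        obtain ⟨w, hw, hw'⟩ := (hA.exists_sub_smul_eq hl (f + g)).choose_spec
        refine (hA.sub_smul_injective hl hw (hA.add_mem hy hz) ?_).1
        rw [hw']
        nth_rewrite 1 [← hy', ← hz']
        rw [smul_add]; abel
      map_smul' := fun c f => by
        obtain ⟨y, hy, hy'⟩ := (hA.exists_sub_smul_eq hl f).choose_spec
        obtain ⟨w, hw, hw'⟩ := (hA.exists_sub_smul_eq hl (c • f)).choose_spec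
        refine (hA.sub_smul_injective hl hw (hA.smul_mem c hy) ?_).1
        rw [hw']
        nth_rewrite 1 [← hy']
        rw [smul_sub, smul_comm] }
    1 fun f => by
      obtain ⟨y, hy, hy'⟩ := (hA.exists_sub_smul_eq hl f).choose_spec
      have h := hA.norm_sq_sub_smul (l := l) hy
      rw [hy'] at h
      rw [one_mul]
      change ‖(hA.exists_sub_smul_eq hl f).choose‖ ≤ ‖f‖
      exact le_of_sq_le_sq (by nlinarith [sq_nonneg ‖l • y‖]) (norm_nonneg _)

/-- The Yosida approximation `A (1 - l A)⁻¹ = l⁻¹ ((1 - l A)⁻¹ - 1)`. -/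
noncomputable def yosida {l : ℝ} (hl : 0 < l) : X →L[ℝ] X :=
  l⁻¹ • (hA.resolvent hl - ContinuousLinearMap.id ℝ X)

theorem resolvent_sub_smul_yosida {l : ℝ} (hl : 0 < l) (f : X) :
    hA.resolvent hl f - l • hA.yosida hl f = f := by
  simp [yosida, smul_inv_smul₀ hl.ne']

theorem resolvent_yosida_mem {l : ℝ} (hl : 0 < l) (f : X) :
    (hA.resolvent hl f, hA.yosida hl f) ∈ A := by
  obtain ⟨y, hy, hy'⟩ := (hA.exists_sub_smul_eq hl f).choose_spec
  have h : hA.yosida hl f = y := by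
    have h1 := hA.resolvent_sub_smul_yosida hl f
    have h2 : hA.resolvent hl f - l • y = f := hy'
    have h3 : l • hA.yosida hl f = l • y := by
      rw [← sub_right_inj (a := hA.resolvent hl f), h1, h2]
    exact smul_right_injective X hl.ne' h3
  rw [h]
  exact hy

theorem mem_iff_resolvent {l : ℝ} (hl : 0 < l) {x y : X} :
    (x, y) ∈ A ↔ hA.resolvent hl (x - l • y) = x := by
  constructor
  · intro h
    exact (hA.sub_smul_injective hl (hA.resolvent_yosida_mem hl (x - l • y)) h
      (hA.resolvent_sub_smul_yosida hl _)).1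
  · intro h
    have h1 := hA.resolvent_yosida_mem hl (x - l • y)
    have h2 := hA.resolvent_sub_smul_yosida hl (x - l • y)
    rw [h] at h1 h2
    have h3 : l • hA.yosida hl (x - l • y) = l • y := by
      rwa [sub_right_inj] at h2
    rwa [smul_right_injective X hl.ne' h3] at h1

/-- `‖A_l x‖ ≤ ‖A x‖` for `x` in the domain. -/
theorem norm_yosida_le {l : ℝ} (hl : 0 < l) {x y : X} (h : (x, y) ∈ A) :
    ‖hA.yosida hl x‖ ≤ ‖y‖ := by
  set z := hA.yosida hl x
  have h1 := hA.inner_eq_zero (hA.sub_mem (hA.resolvent_yosida_mem hl x) h)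
  have h2 : hA.resolvent hl x - x = l • z := by
    nth_rewrite 2 [← hA.resolvent_sub_smul_yosida hl x]
    simp [z]
  rw [h2, real_inner_smul_right] at h1
  have h3 : ⟪z - y, z⟫ = 0 := by
    rcases mul_eq_zero.1 h1 with h | h
    · exact absurd h hl.ne'
    · exact h
  rw [inner_sub_left, real_inner_self_eq_norm_sq] at h3
  have h4 := real_inner_le_norm y z
  rcases (norm_nonneg z).eq_or_lt with h5 | h5
  · rw [← h5]; exact norm_nonneg _
  · nlinarith

theorem inner_yosida_le {l : ℝ} (hl : 0 < l) (x : X) : ⟪hA.yosida hl x, x⟫ ≤ 0 := by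
  nth_rewrite 2 [← hA.resolvent_sub_smul_yosida hl x]
  rw [inner_sub_right, hA.inner_eq_zero (hA.resolvent_yosida_mem hl x), real_inner_smul_right,
    real_inner_self_eq_norm_sq]
  nlinarith [sq_nonneg ‖hA.yosida hl x‖]

/-- Yosida approximations of a skew-adjoint relation with different parameters are dissipative
relative to each other up to an error that is linear in the parameters. -/
theorem inner_yosida_sub_yosida_le {l m : ℝ} (hl : 0 < l) (hm : 0 < m) {x x' : X} {C : ℝ}
    (hx : ‖hA.yosida hl x‖ ≤ C) (hx' : ‖hA.yosida hm x'‖ ≤ C) :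
    ⟪hA.yosida hl x - hA.yosida hm x', x - x'⟫ ≤ 2 * C ^ 2 * (l + m) := by
  set y := hA.yosida hl x
  set y' := hA.yosida hm x'
  have h0 : 0 ≤ C := (norm_nonneg _).trans hx
  have h1 := hA.inner_eq_zero
    (hA.sub_mem (hA.resolvent_yosida_mem hl x) (hA.resolvent_yosida_mem hm x'))
  have h2 : x - x' = (hA.resolvent hl x - hA.resolvent hm x') - (l • y - m • y') := by
    nth_rewrite 1 [← hA.resolvent_sub_smul_yosida hl x, ← hA.resolvent_sub_smul_yosida hm x']
    abel
  rw [h2, inner_sub_right, h1, zero_sub, ← inner_neg_right]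
  refine (real_inner_le_norm _ _).trans ?_
  rw [norm_neg]
  have h3 : ‖y - y'‖ ≤ C + C := (norm_sub_le _ _).trans (add_le_add hx hx')
  have h4 : ‖l • y - m • y'‖ ≤ l * C + m * C := by
    refine (norm_sub_le _ _).trans ?_
    rw [norm_smul, norm_smul, Real.norm_of_nonneg hl.le, Real.norm_of_nonneg hm.le]
    gcongr
  calc _ ≤ (C + C) * (l * C + m * C) := by gcongr
    _ = _ := by ring

end IsSkewAdjointRel

end SkewAdjoint

/-! ### Weak limits along an ultrafilter in a Hilbert space -/

section WeakLimit

variable {H : Type*} [NormedAddCommGroup H] [InnerProductSpace ℝ H]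

/-- Weak convergence of `a` to `x` along the filter `𝒰`, expressed through the inner product. -/
def WeaklyTendsto {ι : Type*} (a : ι → H) (𝒰 : Filter ι) (x : H) : Prop :=
  ∀ z, Tendsto (fun i => ⟪a i, z⟫) 𝒰 (𝓝 ⟪x, z⟫)

namespace WeaklyTendsto

variable {ι : Type*} {𝒰 : Filter ι} {a b : ι → H} {x y : H}

theorem of_tendsto (h : Tendsto a 𝒰 (𝓝 x)) : WeaklyTendsto a 𝒰 x := fun _ =>
  h.inner tendsto_const_nhds

theorem sub (ha : WeaklyTendsto a 𝒰 x) (hb : WeaklyTendsto b 𝒰 y) :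
    WeaklyTendsto (fun i => a i - b i) 𝒰 (x - y) := fun z => by
  simpa only [inner_sub_left] using (ha z).sub (hb z)

theorem map [CompleteSpace H] {H' : Type*} [NormedAddCommGroup H'] [InnerProductSpace ℝ H']
    [CompleteSpace H'] (L : H →L[ℝ] H') (ha : WeaklyTendsto a 𝒰 x) :
    WeaklyTendsto (fun i => L (a i)) 𝒰 (L x) := fun z => by
  simpa only [ContinuousLinearMap.adjoint_inner_right] using ha (L.adjoint z)

theorem unique [𝒰.NeBot] (ha : WeaklyTendsto a 𝒰 x) (hb : WeaklyTendsto a 𝒰 y) : x = y :=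
  ext_inner_right ℝ fun z => tendsto_nhds_unique (ha z) (hb z)

end WeaklyTendsto

/-- Weak compactness of bounded sets: a bounded family has a weak limit along any ultrafilter. -/
theorem exists_weaklyTendsto [CompleteSpace H] {ι : Type*} (𝒰 : Ultrafilter ι) {a : ι → H} {C : ℝ}
    (ha : ∀ i, ‖a i‖ ≤ C) : ∃ x, WeaklyTendsto a 𝒰 x := by
  have hlim : ∀ z, ∃ r : ℝ, Tendsto (fun i => ⟪a i, z⟫) 𝒰 (𝓝 r) := fun z => by
    have hb : ∀ i, ⟪a i, z⟫ ∈ Icc (-(C * ‖z‖)) (C * ‖z‖) := fun i =>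
      mem_Icc.2 (abs_le.1 ((abs_real_inner_le_norm _ _).trans (by gcongr; exact ha i)))
    obtain ⟨r, -, hr⟩ := isCompact_Icc.ultrafilter_le_nhds (𝒰.map fun i => ⟪a i, z⟫)
      (le_principal_iff.2 (Filter.mem_map.2 (Eventually.of_forall hb)))
    exact ⟨r, hr⟩
  choose ℓ hℓ using hlim
  let φ : H →L[ℝ] ℝ := LinearMap.mkContinuous
    { toFun := ℓ
      map_add' := fun z w => tendsto_nhds_unique (hℓ (z + w))
        (by simpa only [inner_add_right] using (hℓ z).add (hℓ w))
      map_smul' := fun c z => tendsto_nhds_unique (hℓ (c • z))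
        (by simpa only [real_inner_smul_right, smul_eq_mul, RingHom.id_apply] using (hℓ z).const_mul c) }
    C fun z => le_of_tendsto (hℓ z).norm (Eventually.of_forall fun i =>
      (norm_inner_le_norm _ _).trans (by gcongr; exact ha i))
  refine ⟨(InnerProductSpace.toDual ℝ H).symm φ, fun z => ?_⟩
  rw [InnerProductSpace.toDual_symm_apply]
  exact hℓ z

end WeakLimit

end StochMaxwell

/-! ### The abstract evolution equation -/

namespace StochMaxwell

section Evolution

variable {X : Type*} [NormedAddCommGroup X] [InnerProductSpace ℝ X]

/-- The data of the evolution equation `M u' = A u + S(u) + f`: a skew-adjoint relation `A`, a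
bounded symmetric operator `M ≥ c`, a Lipschitz dissipative map `S` and a Lipschitz source `f`. -/
structure IsEvolutionData (A : Set (X × X)) (M : X →L[ℝ] X) (S : X → X) (f : ℝ → X) (c : ℝ)
    (K L : NNReal) : Prop where
  skew : IsSkewAdjointRel A
  symm : ∀ x y, ⟪M x, y⟫ = ⟪x, M y⟫
  pos : 0 < c
  coercive : ∀ x, c * ‖x‖ ^ 2 ≤ ⟪M x, x⟫
  lipschitz : LipschitzWith K S
  map_zero : S 0 = 0
  dissipative : ∀ x y, ⟪S x - S y, x - y⟫ ≤ 0
  source : LipschitzWith L f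

/-- A bounded coercive operator has a bounded right inverse (Lax–Milgram). -/
theorem exists_rightInverse_of_coercive [CompleteSpace X] {M : X →L[ℝ] X} {c : ℝ} (hc : 0 < c)
    (h : ∀ x, c * ‖x‖ ^ 2 ≤ ⟪M x, x⟫) : ∃ N : X →L[ℝ] X, ∀ x, M (N x) = x := by
  let B : X →L[ℝ] X →L[ℝ] ℝ := (innerSL ℝ).comp M
  have hB : IsCoercive B := ⟨c, hc, fun x => by
    have := h x
    simp only [B, ContinuousLinearMap.comp_apply, innerSL_apply_apply]
    nlinarith⟩
  refine ⟨hB.continuousLinearEquivOfBilin.symm, fun x => ?_⟩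
  have h1 : ∀ v, hB.continuousLinearEquivOfBilin v = M v := fun v =>
    ext_inner_right ℝ fun w => by
      rw [hB.continuousLinearEquivOfBilin_apply]; rfl
  rw [← h1]
  simp

theorem hasDerivAt_inner_symm {M : X →L[ℝ] X} (hM : ∀ x y, ⟪M x, y⟫ = ⟪x, M y⟫) {w : ℝ → X}
    {w' : X} {t : ℝ} (hw : HasDerivAt w w' t) :
    HasDerivAt (fun s => ⟪M (w s), w s⟫) (2 * ⟪M w', w t⟫) t := by
  have h := (M.hasFDerivAt.comp_hasDerivAt t hw).inner ℝ hw
  refine h.congr_deriv ?_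
  rw [two_mul]
  congr 1
  exact (real_inner_comm _ _).trans (hM w' (w t)).symm

namespace IsEvolutionData

variable {A : Set (X × X)} {M : X →L[ℝ] X} {S : X → X} {f : ℝ → X} {c : ℝ} {K L : NNReal}
  (h : IsEvolutionData A M S f c K L)
include h

/-- An energy inequality for the energy `⟪M w, w⟫`. -/
theorem norm_sq_le_of_energy {w w' : ℝ → X} {b T : ℝ}
    (hw : ∀ t ∈ Icc 0 T, HasDerivAt w (w' t) t) (hb0 : 0 ≤ b)
    (hb : ∀ t ∈ Icc 0 T, 2 * ⟪M (w' t), w t⟫ ≤ c * ‖w t‖ ^ 2 + b) {t : ℝ} (ht : t ∈ Icc 0 T) :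
    c * ‖w t‖ ^ 2 ≤ (‖M‖ * ‖w 0‖ ^ 2 + b) * Real.exp T := by
  have h1 := le_mul_exp_of_deriv_le (b := b) (fun t ht => hasDerivAt_inner_symm h.symm (hw t ht))
    (fun t ht => (hb t ht).trans (by gcongr; exact h.coercive _)) ht
  have h2 : ⟪M (w 0), w 0⟫ ≤ ‖M‖ * ‖w 0‖ ^ 2 := by
    refine (real_inner_le_norm _ _).trans ?_
    rw [sq, ← mul_assoc]
    gcongr
    exact M.le_opNorm _
  calc c * ‖w t‖ ^ 2 ≤ ⟪M (w t), w t⟫ + b := by linarith [h.coercive (w t)]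
    _ ≤ (⟪M (w 0), w 0⟫ + b) * Real.exp t := h1
    _ ≤ (‖M‖ * ‖w 0‖ ^ 2 + b) * Real.exp t := by gcongr
    _ ≤ _ := by
      have : 0 ≤ ‖M‖ * ‖w 0‖ ^ 2 + b := by positivity
      gcongr
      exact ht.2

variable [CompleteSpace X]

/-- The equation with `A` replaced by its Yosida approximation has a classical solution. -/
theorem exists_yosida_solution {l : ℝ} (hl : 0 < l) {T : ℝ} (hT : 0 ≤ T) (u₀ : X) :
    ∃ u v : ℝ → X, Continuous u ∧ u 0 = u₀ ∧ Continuous v ∧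
      (∀ t ∈ Icc 0 T, HasDerivAt u (v t) t) ∧
      ∀ t, M (v t) = h.skew.yosida hl (u t) + S (u t) + f t := by
  obtain ⟨N, hN⟩ := exists_rightInverse_of_coercive h.pos h.coercive
  obtain ⟨u, hu, hu0, hud⟩ := exists_hasDerivAt_of_lipschitz
    (g := fun t x => N (h.skew.yosida hl x + S x + f t))
    (fun t => N.lipschitz.comp
      (((h.skew.yosida hl).lipschitz.add h.lipschitz).add (LipschitzWith.const (f t))))
    (fun x => N.continuous.comp (continuous_const.add h.source.continuous)) hT u₀
  exact ⟨u, fun t => N (h.skew.yosida hl (u t) + S (u t) + f t), hu, hu0,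
    N.continuous.comp ((((h.skew.yosida hl).continuous.comp hu).add
      (h.lipschitz.continuous.comp hu)).add h.source.continuous), hud, fun t => hN _⟩

/-- The time derivatives of the approximate solutions are bounded independently of the Yosida
parameter, since the increments `u(t + s) - u(t)` solve a dissipative equation with source
`f(t + s) - f(t)`. -/
theorem norm_deriv_sq_le {l : ℝ} (hl : 0 < l) {T : ℝ} (hT : 0 ≤ T) {u v : ℝ → X}
    (hd : ∀ t ∈ Icc 0 (T + 1), HasDerivAt u (v t) t)
    (hv : ∀ t, M (v t) = h.skew.yosida hl (u t) + S (u t) + f t) {t : ℝ} (ht : t ∈ Icc 0 T) :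
    c * ‖v t‖ ^ 2 ≤ (‖M‖ * ‖v 0‖ ^ 2 + L ^ 2 / c) * Real.exp T := by
  have hc := h.pos
  have hslope : ∀ t ∈ Icc 0 T,
      Tendsto (fun s => s⁻¹ • (u (t + s) - u t)) (𝓝[>] 0) (𝓝 (v t)) := fun t ht =>
    (hasDerivAt_iff_tendsto_slope_zero.1 (hd t ⟨ht.1, by linarith [ht.2]⟩)).mono_left
      (nhdsWithin_mono _ fun s hs => ne_of_gt hs)
  have hev : ∀ᶠ s : ℝ in 𝓝[>] 0, s ∈ Ioc (0 : ℝ) 1 := Ioc_mem_nhdsGT zero_lt_one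
  refine le_of_tendsto_of_tendsto (((hslope t ht).norm.pow 2).const_mul c)
    (((((hslope 0 ⟨le_rfl, hT⟩).norm.pow 2).const_mul ‖M‖).add_const _).mul_const _) ?_
  filter_upwards [hev] with s hs
  have key := h.norm_sq_le_of_energy (T := T) (w := fun t => s⁻¹ • (u (t + s) - u t))
    (w' := fun t => s⁻¹ • (v (t + s) - v t)) (b := L ^ 2 / c) ?_ (by positivity) ?_ ht
  · simpa using key
  · intro r hr
    have h1 := (hd (r + s) ⟨by linarith [hr.1, hs.1], by linarith [hr.2, hs.2]⟩).comp_add_const r s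
    exact (h1.sub (hd r ⟨hr.1, by linarith [hr.2]⟩)).const_smul s⁻¹
  · intro r hr
    set x := u (r + s)
    set y := u r
    have h1 : M (s⁻¹ • (v (r + s) - v r)) =
        s⁻¹ • (h.skew.yosida hl (x - y) + (S x - S y) + (f (r + s) - f r)) := by
      rw [map_smul, map_sub, hv, hv, map_sub]
      congr 1
      abel
    have h2 : ‖f (r + s) - f r‖ ≤ L * s := by
      have := h.source.dist_le_mul (r + s) r
      rwa [dist_eq_norm, dist_eq_norm, add_sub_cancel_left, Real.norm_of_nonneg hs.1.le] at this
    have h3 : ‖s⁻¹ • (f (r + s) - f r)‖ ≤ L := by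
      rw [norm_smul, Real.norm_of_nonneg (inv_nonneg.2 hs.1.le), inv_mul_le_iff₀ hs.1]
      linarith
    have h4 : ⟪M (s⁻¹ • (v (r + s) - v r)), s⁻¹ • (x - y)⟫ ≤ L * ‖s⁻¹ • (x - y)‖ := by
      rw [h1, smul_add, inner_add_left]
      have h5 : ⟪s⁻¹ • (h.skew.yosida hl (x - y) + (S x - S y)), s⁻¹ • (x - y)⟫ ≤ 0 := by
        rw [real_inner_smul_left, real_inner_smul_right, inner_add_left]
        have h6 := h.skew.inner_yosida_le hl (x - y)
        have h7 := h.dissipative x y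
        have h8 : 0 < s⁻¹ := inv_pos.2 hs.1
        exact mul_nonpos_of_nonneg_of_nonpos h8.le
          (mul_nonpos_of_nonneg_of_nonpos h8.le (by linarith))
      have h9 := (real_inner_le_norm (s⁻¹ • (f (r + s) - f r)) (s⁻¹ • (x - y))).trans
        (mul_le_mul_of_nonneg_right h3 (norm_nonneg _))
      linarith
    -- Young's inequality
    have h10 : 2 * (L * ‖s⁻¹ • (x - y)‖) ≤ c * ‖s⁻¹ • (x - y)‖ ^ 2 + L ^ 2 / c := by
      have h11 : c * ‖s⁻¹ • (x - y)‖ ^ 2 + L ^ 2 / c - 2 * (L * ‖s⁻¹ • (x - y)‖) =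
        (c * ‖s⁻¹ • (x - y)‖ - L) ^ 2 / c := by field_simp; ring
      have : 0 ≤ (c * ‖s⁻¹ • (x - y)‖ - L) ^ 2 / c := by positivity
      linarith
    linarith

/-- Approximate solutions with bounded Yosida terms differ by the square root of the sum of the
Yosida parameters. -/
theorem norm_sub_sq_le {l m : ℝ} (hl : 0 < l) (hm : 0 < m) {T : ℝ} {u v u' v' : ℝ → X} {C : ℝ}
    (hu0 : u 0 = u' 0)
    (hd : ∀ t ∈ Icc 0 T, HasDerivAt u (v t) t) (hd' : ∀ t ∈ Icc 0 T, HasDerivAt u' (v' t) t)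
    (hv : ∀ t, M (v t) = h.skew.yosida hl (u t) + S (u t) + f t)
    (hv' : ∀ t, M (v' t) = h.skew.yosida hm (u' t) + S (u' t) + f t)
    (hC : ∀ t ∈ Icc 0 T, ‖h.skew.yosida hl (u t)‖ ≤ C)
    (hC' : ∀ t ∈ Icc 0 T, ‖h.skew.yosida hm (u' t)‖ ≤ C) {t : ℝ} (ht : t ∈ Icc 0 T) :
    c * ‖u t - u' t‖ ^ 2 ≤ 4 * C ^ 2 * (l + m) * Real.exp T := by
  have key := h.norm_sq_le_of_energy (T := T) (w := fun t => u t - u' t)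
    (w' := fun t => v t - v' t) (b := 4 * C ^ 2 * (l + m))
    (fun r hr => (hd r hr).sub (hd' r hr)) (by positivity) ?_ ht
  · simpa [hu0] using key
  · intro r hr
    have h1 : M (v r - v' r) = (h.skew.yosida hl (u r) - h.skew.yosida hm (u' r)) +
        (S (u r) - S (u' r)) := by
      rw [map_sub, hv, hv']; abel
    have h2 := h.skew.inner_yosida_sub_yosida_le hl hm (hC r hr) (hC' r hr)
    have h3 := h.dissipative (u r) (u' r)
    have h4 : 0 ≤ c * ‖u r - u' r‖ ^ 2 := by have := h.pos; positivity
    rw [h1, inner_add_left]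
    linarith

end IsEvolutionData

end Evolution

end StochMaxwell

/-! ### Weak time derivatives -/

namespace StochMaxwell

theorem absolutelyContinuousOnInterval_of_dist_le {Y Z : Type*} [PseudoMetricSpace Y]
    [PseudoMetricSpace Z] {e : ℝ → Y} {φ : ℝ → Z} {a b C : ℝ}
    (hφ : AbsolutelyContinuousOnInterval φ a b)
    (h : ∀ s ∈ uIcc a b, ∀ t ∈ uIcc a b, dist (e s) (e t) ≤ C * dist (φ s) (φ t)) :
    AbsolutelyContinuousOnInterval e a b := by
  rw [absolutelyContinuousOnInterval_iff] at hφ ⊢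
  intro ε hε
  have hC : 0 < |C| + 1 := by positivity
  obtain ⟨δ, hδ, hδ'⟩ := hφ (ε / (|C| + 1)) (by positivity)
  refine ⟨δ, hδ, fun E hE hEδ => ?_⟩
  have h1 := hδ' E hE hEδ
  rw [lt_div_iff₀ hC] at h1
  refine lt_of_le_of_lt ?_ h1
  rw [Finset.sum_mul]
  refine Finset.sum_le_sum fun i hi => ?_
  have h2 := hE.1 i hi
  refine (h _ h2.1 _ h2.2).trans ?_
  rw [mul_comm]
  gcongr
  linarith [le_abs_self C]

section Time

variable {T : ℝ}

theorem integral_timeMeasure {V : Type*} [NormedAddCommGroup V] [NormedSpace ℝ V] (hT : 0 ≤ T)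
    (w : ℝ → V) : ∫ t, w t ∂(timeMeasure T) = ∫ t in (0 : ℝ)..T, w t := by
  rw [intervalIntegral.integral_of_le hT, integral_Ioc_eq_integral_Ioo]

theorem ae_timeMeasure_of_Icc {p : ℝ → Prop} (h : ∀ t ∈ Icc 0 T, p t) :
    ∀ᵐ t ∂(timeMeasure T), p t := by
  filter_upwards [ae_restrict_mem measurableSet_Ioo] with t ht
  exact h t (Ioo_subset_Icc_self ht)

variable {V : Type*} [NormedAddCommGroup V]

theorem memLp_timeMeasure_of_continuous {w : ℝ → V} (hw : Continuous w) (p : ENNReal) :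
    MemLp w p (timeMeasure T) := by
  obtain ⟨C, hC⟩ := isCompact_Icc.exists_bound_of_continuousOn (hw.continuousOn (s := Icc 0 T))
  exact MemLp.of_bound hw.aestronglyMeasurable C (ae_timeMeasure_of_Icc hC)

/-- The restriction to `]0, T[` of a continuous function, as an element of `L²(0, T; V)`. -/
noncomputable def timeL2OfContinuous (T : ℝ) {w : ℝ → V} (hw : Continuous w) : TimeL2 T V :=
  (memLp_timeMeasure_of_continuous hw 2).toLp w

theorem coeFn_timeL2OfContinuous {w : ℝ → V} (hw : Continuous w) :
    timeL2OfContinuous T hw =ᵐ[timeMeasure T] w :=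
  MemLp.coeFn_toLp _

theorem intervalIntegrable_timeL2 (hT : 0 ≤ T) (v : TimeL2 T V) :
    IntervalIntegrable v volume 0 T := by
  rw [intervalIntegrable_iff_integrableOn_Ioo_of_le hT]
  exact (Lp.memLp v).integrable (by norm_num)

theorem timeL2_intervalIntegrable_of_mem (v : TimeL2 T V) {a b : ℝ} (ha : a ∈ Icc 0 T)
    (hb : b ∈ Icc 0 T) : IntervalIntegrable v volume a b :=
  (intervalIntegrable_timeL2 (ha.1.trans ha.2) v).mono_set (by
    rw [uIcc_of_le (ha.1.trans ha.2)]; exact uIcc_subset_Icc ha hb)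

theorem testFunction_zero_of_notMem {F : Type*} [NormedAddCommGroup F] [NormedSpace ℝ F]
    {E : Type*} [NormedAddCommGroup E] [NormedSpace ℝ E] {Ω : Opens E}
    (φ : 𝓓(Ω, F)) {x : E} (hx : x ∉ Ω) : φ x = 0 :=
  image_eq_zero_of_notMem_tsupport fun h => hx (φ.tsupport_subset h)

theorem timeTest_zero (ψ : 𝓓(timeInterval T, ℝ)) : ψ 0 = 0 ∧ ψ T = 0 :=
  ⟨testFunction_zero_of_notMem ψ fun h => lt_irrefl _ (h : (0 : ℝ) ∈ Ioo 0 T).1,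
    testFunction_zero_of_notMem ψ fun h => lt_irrefl _ (h : T ∈ Ioo 0 T).2⟩

theorem timeTest_hasDerivAt (ψ : 𝓓(timeInterval T, ℝ)) (t : ℝ) :
    HasDerivAt ψ (deriv ψ t) t :=
  (ψ.contDiff.differentiable (by simp) t).hasDerivAt

theorem timeTest_continuous_deriv (ψ : 𝓓(timeInterval T, ℝ)) : Continuous (deriv ψ) :=
  ψ.contDiff.continuous_deriv (by simp)

section Primitive

variable [NormedSpace ℝ V]

theorem continuousOn_primitive (hT : 0 ≤ T) (v : TimeL2 T V) (u₀ : V) :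
    ContinuousOn (fun t => u₀ + ∫ s in (0 : ℝ)..t, v s) (Icc 0 T) := by
  have h := intervalIntegral.continuousOn_primitive_interval (a := 0) (b := T) (f := v)
    (μ := volume) (by
      rw [uIcc_of_le hT, integrableOn_Icc_iff_integrableOn_Ioo]
      exact (Lp.memLp v).integrable (by norm_num))
  rw [uIcc_of_le hT] at h
  exact continuousOn_const.add h

theorem dist_primitive_le (v : TimeL2 T V) {s t : ℝ} (hs : s ∈ Icc 0 T)
    (ht : t ∈ Icc 0 T) : dist (∫ r in (0 : ℝ)..s, v r) (∫ r in (0 : ℝ)..t, v r) ≤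
      dist (∫ r in (0 : ℝ)..s, ‖v r‖) (∫ r in (0 : ℝ)..t, ‖v r‖) := by
  have h0 : (0 : ℝ) ∈ Icc 0 T := ⟨le_rfl, hs.1.trans hs.2⟩
  rw [dist_eq_norm, dist_eq_norm, intervalIntegral.integral_interval_sub_left
    (timeL2_intervalIntegrable_of_mem v h0 hs) (timeL2_intervalIntegrable_of_mem v h0 ht),
    intervalIntegral.integral_interval_sub_left
    (timeL2_intervalIntegrable_of_mem v h0 hs).norm (timeL2_intervalIntegrable_of_mem v h0 ht).norm]
  exact intervalIntegral.norm_integral_le_abs_integral_norm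

omit [NormedSpace ℝ V] in
theorem absolutelyContinuous_primitive_norm (hT : 0 ≤ T) (v : TimeL2 T V) :
    AbsolutelyContinuousOnInterval (fun t => ∫ r in (0 : ℝ)..t, ‖v r‖) 0 T :=
  (intervalIntegrable_timeL2 hT v).norm.absolutelyContinuousOnInterval_intervalIntegral
    (left_mem_uIcc)

theorem ae_hasDerivAt_primitive [CompleteSpace V] (hT : 0 ≤ T) (v : TimeL2 T V) (u₀ : V) :
    ∀ᵐ t, t ∈ Icc 0 T → HasDerivAt (fun t => u₀ + ∫ r in (0 : ℝ)..t, v r) (v t) t := by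
  filter_upwards [(intervalIntegrable_timeL2 hT v).ae_hasDerivAt_integral] with t ht h
  rw [uIcc_of_le hT] at ht
  exact (ht h 0 ⟨le_rfl, hT⟩).const_add u₀

end Primitive

end Time

section Weak

variable {T : ℝ} {X : Type*} [NormedAddCommGroup X] [InnerProductSpace ℝ X]

/-- The function `t ↦ p(t) x` in `L²(0, T; X)`. -/
noncomputable def timeTensor (T : ℝ) {p : ℝ → ℝ} (hp : Continuous p) (x : X) : TimeL2 T X :=
  timeL2OfContinuous T (w := fun t => p t • x) (hp.smul continuous_const)

theorem integral_smul_eq_iff_inner [CompleteSpace X] {p q : ℝ → ℝ} (hp : Continuous p)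
    (hq : Continuous q) (u v : TimeL2 T X) :
    (∫ t, p t • u t ∂(timeMeasure T) = -∫ t, q t • v t ∂(timeMeasure T)) ↔
      ∀ x : X, ⟪u, timeTensor T hp x⟫ =
        -⟪v, timeTensor T hq x⟫ := by
  have key : ∀ (p : ℝ → ℝ) (hp : Continuous p) (u : TimeL2 T X) (x : X),
      ⟪u, timeTensor T hp x⟫ =
        ⟪x, ∫ t, p t • u t ∂(timeMeasure T)⟫ := fun p hp u x => by
    have hint : Integrable (fun t => p t • u t) (timeMeasure T) :=
      memLp_one_iff_integrable.1 ((Lp.memLp u).smul (p := 2) (q := 2)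
        (memLp_timeMeasure_of_continuous hp 2))
    rw [L2.inner_def, ← integral_inner hint]
    refine integral_congr_ae ?_
    filter_upwards [coeFn_timeL2OfContinuous (T := T) (w := fun t => p t • x)
      (hp.smul continuous_const)] with t ht
    rw [timeTensor, ht, real_inner_smul_right, real_inner_smul_right, real_inner_comm]
  simp only [key]
  constructor
  · intro h x
    rw [h, inner_neg_right]
  · intro h
    refine ext_inner_left ℝ fun x => ?_
    rw [inner_neg_right, h]

theorem HasWeakTimeDeriv.of_weaklyTendsto [CompleteSpace X] {ι : Type*} {𝒰 : Filter ι} [𝒰.NeBot]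
    {a b : ι → TimeL2 T X} {u v : TimeL2 T X} (h : ∀ i, HasWeakTimeDeriv (a i) (b i))
    (ha : WeaklyTendsto a 𝒰 u) (hb : WeaklyTendsto b 𝒰 v) : HasWeakTimeDeriv u v := fun ψ => by
  refine (integral_smul_eq_iff_inner (timeTest_continuous_deriv ψ) ψ.continuous u v).2 fun x => ?_
  refine tendsto_nhds_unique (ha _) ?_
  refine (hb _).neg.congr fun i => ?_
  exact ((integral_smul_eq_iff_inner (timeTest_continuous_deriv ψ) ψ.continuous _ _).1
    (h i ψ) x).symm

theorem HasWeakTimeDeriv.of_hasDerivAt [CompleteSpace X] (hT : 0 ≤ T) {u v : ℝ → X}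
    (hu : Continuous u) (hv : Continuous v) (h : ∀ t ∈ Icc 0 T, HasDerivAt u (v t) t) :
    HasWeakTimeDeriv (timeL2OfContinuous T hu) (timeL2OfContinuous T hv) := fun ψ => by
  have h1 : ∀ (p : ℝ → ℝ) (w : ℝ → X) (hw : Continuous w),
      ∫ t, p t • timeL2OfContinuous T hw t ∂(timeMeasure T) = ∫ t in (0 : ℝ)..T, p t • w t :=
    fun p w hw => by
      rw [← integral_timeMeasure hT]
      refine integral_congr_ae ?_
      filter_upwards [coeFn_timeL2OfContinuous (T := T) hw] with t ht
      rw [ht]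
  rw [h1, h1]
  have h2 := intervalIntegral.integral_smul_deriv_eq_deriv_smul (a := 0) (b := T)
    (u := ψ) (v := u) (u' := deriv ψ) (v' := v)
    (fun t _ => timeTest_hasDerivAt ψ t) (fun t ht => h t (by rwa [uIcc_of_le hT] at ht))
    ((timeTest_continuous_deriv ψ).intervalIntegrable _ _) (hv.intervalIntegrable _ _)
  rw [(timeTest_zero ψ).1, (timeTest_zero ψ).2] at h2
  rw [h2]
  simp

theorem HasWeakTimeDeriv.map {Y : Type*} [NormedAddCommGroup Y] [InnerProductSpace ℝ Y]
    [CompleteSpace X] [CompleteSpace Y] (L : X →L[ℝ] Y) {u v : TimeL2 T X}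
    (h : HasWeakTimeDeriv u v) :
    HasWeakTimeDeriv (L.compLp u) (L.compLp v) := fun ψ => by
  have h1 : ∀ (p : ℝ → ℝ) (hp : Continuous p) (w : TimeL2 T X),
      ∫ t, p t • L.compLp w t ∂(timeMeasure T) = L (∫ t, p t • w t ∂(timeMeasure T)) :=
    fun p hp w => by
      have hint : Integrable (fun t => p t • w t) (timeMeasure T) :=
        memLp_one_iff_integrable.1 ((Lp.memLp w).smul (p := 2) (q := 2)
          (memLp_timeMeasure_of_continuous hp 2))
      rw [← L.integral_comp_comm hint]
      refine integral_congr_ae ?_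
      filter_upwards [L.coeFn_compLp w] with t ht
      rw [ht, map_smul]
  rw [h1 _ (timeTest_continuous_deriv ψ), h1 _ ψ.continuous, h ψ, map_neg]

theorem HasWeakTimeDeriv.sub [CompleteSpace X] {u v u' v' : TimeL2 T X}
    (h : HasWeakTimeDeriv u v) (h' : HasWeakTimeDeriv u' v') :
    HasWeakTimeDeriv (u - u') (v - v') := fun ψ => by
  have h1 := (integral_smul_eq_iff_inner (timeTest_continuous_deriv ψ) ψ.continuous u v).1 (h ψ)
  have h2 := (integral_smul_eq_iff_inner (timeTest_continuous_deriv ψ) ψ.continuous u' v').1 (h' ψ)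
  refine (integral_smul_eq_iff_inner (timeTest_continuous_deriv ψ) ψ.continuous _ _).2 fun x => ?_
  rw [inner_sub_left, inner_sub_left, h1, h2]
  ring

/-- Weak derivatives are unique. -/
theorem HasWeakTimeDeriv.unique [CompleteSpace X] {u v v' : TimeL2 T X}
    (h : HasWeakTimeDeriv u v) (h' : HasWeakTimeDeriv u v') : v = v' := by
  have h0 : HasWeakTimeDeriv 0 (v - v') := by simpa using h.sub h'
  rw [← sub_eq_zero]
  refine Lp.ext ?_
  have h1 : ∀ᵐ t, t ∈ Ioo 0 T → (v - v') t = 0 := by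
    refine isOpen_Ioo.ae_eq_zero_of_integral_contDiff_smul_eq_zero ?_ fun g hg hgc hgs => ?_
    · exact IntegrableOn.locallyIntegrableOn ((Lp.memLp (v - v')).integrable (by norm_num))
    · have h2 := h0 ⟨g, hg, hgc, hgs⟩
      have h3 : ∫ t, deriv g t • (0 : TimeL2 T X) t ∂(timeMeasure T) = 0 := by
        refine integral_eq_zero_of_ae ?_
        filter_upwards [Lp.coeFn_zero X 2 (timeMeasure T)] with t ht
        rw [ht]
        exact smul_zero _
      have h4 : ∫ t, g t • (v - v') t ∂(timeMeasure T) = 0 := by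
        have : (0 : X) = -∫ t, g t • (v - v') t ∂(timeMeasure T) := h3.symm.trans h2
        rw [← neg_eq_zero, ← this]
      rw [← h4, eq_comm]
      refine setIntegral_eq_integral_of_forall_compl_eq_zero fun t ht => ?_
      have : g t = 0 := image_eq_zero_of_notMem_tsupport fun h => ht (hgs h)
      rw [this, zero_smul]
  rw [← ae_restrict_iff' measurableSet_Ioo] at h1
  filter_upwards [h1, Lp.coeFn_zero X 2 (timeMeasure T)] with t ht ht0
  rw [ht, ht0]; rfl

end Weak

end StochMaxwell

namespace StochMaxwell

section Representative

variable {T : ℝ} {X : Type*} [NormedAddCommGroup X] [InnerProductSpace ℝ X]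

/-- A smooth function with compact support in `]0, T[` and mean value zero is the derivative of a
test function. -/
theorem exists_timeTest_deriv_eq {θ : ℝ → ℝ} (hθ : ContDiff ℝ (⊤ : ℕ∞) θ)
    (hc : HasCompactSupport θ) (hs : tsupport θ ⊆ Ioo 0 T) (h0 : ∫ t, θ t = 0) :
    ∃ ψ : 𝓓(timeInterval T, ℝ), ∀ t, deriv ψ t = θ t := by
  have hd : ∀ t, HasDerivAt (fun t => ∫ s in (0 : ℝ)..t, θ s) (θ t) t := fun t =>
    (hθ.continuous.integral_hasStrictDerivAt 0 t).hasDerivAt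
  have hderiv : deriv (fun t => ∫ s in (0 : ℝ)..t, θ s) = θ := funext fun t => (hd t).deriv
  have hcd : ContDiff ℝ (⊤ : ℕ∞) fun t => ∫ s in (0 : ℝ)..t, θ s := by
    rw [contDiff_infty_iff_deriv, hderiv]
    exact ⟨fun t => (hd t).differentiableAt, hθ⟩
  have hθ0 : ∀ s, s ∉ Ioo 0 T → θ s = 0 := fun s hs' =>
    image_eq_zero_of_notMem_tsupport fun h => hs' (hs h)
  have hint : Integrable θ := hθ.continuous.integrable_of_hasCompactSupport hc
  have hIic : ∀ t, ∫ s in (0 : ℝ)..t, θ s = ∫ s in Iic t, θ s := fun t => by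
    have h1 := intervalIntegral.integral_Iic_sub_Iic (f := θ) (μ := volume) (a := 0) (b := t)
      hint.integrableOn hint.integrableOn
    have h2 : ∫ s in Iic (0 : ℝ), θ s = 0 :=
      setIntegral_eq_zero_of_forall_eq_zero fun s hs' => hθ0 s fun h => absurd h.1 (not_lt.2 hs')
    rw [← h1, h2, sub_zero]
  obtain ⟨a, b, hsupp, hab⟩ : ∃ a b, tsupport θ ⊆ Icc a b ∧ Icc a b ⊆ Ioo 0 T := by
    rcases (tsupport θ).eq_empty_or_nonempty with he | hne
    · exact ⟨1, 0, by simp [he], by simp⟩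
    · obtain ⟨a, ha⟩ := hc.isCompact.exists_isLeast hne
      obtain ⟨b, hb⟩ := hc.isCompact.exists_isGreatest hne
      exact ⟨a, b, fun s hs => ⟨ha.2 hs, hb.2 hs⟩, Icc_subset_Ioo (hs ha.1).1 (hs hb.1).2⟩
  have hθab : ∀ s, s ∉ Icc a b → θ s = 0 := fun s hs' =>
    image_eq_zero_of_notMem_tsupport fun h => hs' (hsupp h)
  have hzero : ∀ t, t ∉ Icc a b → ∫ s in (0 : ℝ)..t, θ s = 0 := by
    intro t ht
    rw [hIic]
    by_cases hat : a ≤ t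
    · have hbt : b < t := not_le.1 fun h => ht ⟨hat, h⟩
      rw [setIntegral_eq_integral_of_forall_compl_eq_zero, h0]
      exact fun r hr => hθab r fun h => absurd h.2 (not_le.2 (hbt.trans (not_le.1 hr)))
    · exact setIntegral_eq_zero_of_forall_eq_zero fun s hs' =>
        hθab s fun h => hat (h.1.trans hs')
  have hK : IsCompact (Icc a b) := isCompact_Icc
  have hsub : tsupport (fun t => ∫ s in (0 : ℝ)..t, θ s) ⊆ Icc a b :=
    closure_minimal (fun t ht => by_contra fun h => ht (hzero t h)) hK.isClosed
  refine ⟨⟨_, hcd, hK.of_isClosed_subset (isClosed_tsupport _) hsub,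
    hsub.trans hab⟩, fun t => ?_⟩
  exact congrFun hderiv t

/-- A function on `]0, T[` with zero weak derivative is constant. -/
theorem HasWeakTimeDeriv.exists_ae_eq_const [CompleteSpace X] (hT : 0 < T) {w : TimeL2 T X}
    (h : HasWeakTimeDeriv w 0) : ∃ x₀, ∀ᵐ t ∂(timeMeasure T), w t = x₀ := by
  have hw0 : ∀ ψ : 𝓓(timeInterval T, ℝ), ∫ t, deriv ψ t • w t ∂(timeMeasure T) = 0 := fun ψ => by
    rw [h ψ, neg_eq_zero]
    refine integral_eq_zero_of_ae ?_
    filter_upwards [Lp.coeFn_zero X 2 (timeMeasure T)] with t ht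
    rw [ht]
    exact smul_zero _
  have hint : ∀ p : ℝ → ℝ, Continuous p → Integrable (fun t => p t • w t) (timeMeasure T) :=
    fun p hp => memLp_one_iff_integrable.1 ((Lp.memLp w).smul (p := 2) (q := 2)
      (memLp_timeMeasure_of_continuous hp 2))
  -- a normalized bump function in `]0, T[`
  let b : ContDiffBump (T / 2) := ⟨T / 8, T / 4, by positivity, by linarith⟩
  set ρ : ℝ → ℝ := b.normed volume with hρ
  have hρs : tsupport ρ ⊆ Ioo 0 T := by
    rw [hρ, b.tsupport_normed_eq, Real.closedBall_eq_Icc]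
    intro t ht
    simp only [b] at ht
    exact ⟨by linarith [ht.1], by linarith [ht.2]⟩
  have hρc : ContDiff ℝ (⊤ : ℕ∞) ρ := b.contDiff_normed
  have hρcs : HasCompactSupport ρ := b.hasCompactSupport_normed
  set x₀ := ∫ t, ρ t • w t ∂(timeMeasure T) with hx₀
  refine ⟨x₀, ?_⟩
  have h1 : ∀ᵐ t, t ∈ Ioo 0 T → w t - x₀ = 0 := by
    refine isOpen_Ioo.ae_eq_zero_of_integral_contDiff_smul_eq_zero ?_ fun g hg hgc hgs => ?_
    · exact IntegrableOn.locallyIntegrableOn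
        (((Lp.memLp w).integrable (by norm_num)).sub (integrable_const x₀))
    · set m := ∫ t, g t
      obtain ⟨ψ, hψ⟩ := exists_timeTest_deriv_eq (T := T) (θ := fun t => g t - m * ρ t)
        (hg.sub (contDiff_const.mul hρc)) (hgc.sub (hρcs.mul_left))
        ((tsupport_sub _ _).trans (union_subset hgs ((tsupport_mul_subset_right).trans hρs))) (by
          rw [integral_sub (hg.continuous.integrable_of_hasCompactSupport hgc)
            ((hρc.continuous.integrable_of_hasCompactSupport hρcs).const_mul m),
            integral_const_mul, hρ, b.integral_normed, mul_one, sub_self])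
      have h2 := hw0 ψ
      simp only [hψ, sub_smul, mul_smul] at h2
      have hρi : Integrable (fun t => m • ρ t • w t) (timeMeasure T) :=
        (hint ρ hρc.continuous).smul m
      rw [integral_sub (hint g hg.continuous) hρi, integral_smul,
        sub_eq_zero] at h2
      have h3 : ∫ t, g t • (w t - x₀) = ∫ t, g t • (w t - x₀) ∂(timeMeasure T) := by
        rw [eq_comm]
        refine setIntegral_eq_integral_of_forall_compl_eq_zero fun t ht => ?_
        rw [image_eq_zero_of_notMem_tsupport fun h => ht (hgs h), zero_smul]
      have h4 : ∫ t, g t ∂(timeMeasure T) = m :=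
        setIntegral_eq_integral_of_forall_compl_eq_zero fun t ht =>
          image_eq_zero_of_notMem_tsupport fun h => ht (hgs h)
      rw [h3]
      simp only [smul_sub]
      rw [integral_sub (hint g hg.continuous), integral_smul_const, h4, h2, sub_self]
      exact (memLp_one_iff_integrable.1
        (memLp_timeMeasure_of_continuous hg.continuous 1)).smul_const x₀
  rw [← ae_restrict_iff' measurableSet_Ioo] at h1
  filter_upwards [h1] with t ht
  exact sub_eq_zero.1 ht

theorem memLp_primitive (hT : 0 ≤ T) (v : TimeL2 T X) :
    MemLp (fun t => ∫ s in (0 : ℝ)..t, v s) 2 (timeMeasure T) := by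
  have hc : ContinuousOn (fun t => ∫ s in (0 : ℝ)..t, v s) (Icc 0 T) := by
    simpa using continuousOn_primitive hT v 0
  obtain ⟨C, hC⟩ := isCompact_Icc.exists_bound_of_continuousOn hc
  exact MemLp.of_bound ((hc.mono Ioo_subset_Icc_self).aestronglyMeasurable measurableSet_Ioo) C
    (ae_timeMeasure_of_Icc hC)

theorem hasWeakTimeDeriv_primitive [CompleteSpace X] (hT : 0 ≤ T) (v : TimeL2 T X) :
    HasWeakTimeDeriv ((memLp_primitive hT v).toLp _) v := fun ψ => by
  refine (integral_smul_eq_iff_inner (timeTest_continuous_deriv ψ) ψ.continuous _ _).2 fun x => ?_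
  have hψ : AbsolutelyContinuousOnInterval ψ 0 T :=
    (ψ.contDiff.of_le (by simp) : ContDiff ℝ 1 ψ).contDiffOn.absolutelyContinuousOnInterval
  have hp : AbsolutelyContinuousOnInterval (fun t => ⟪∫ s in (0 : ℝ)..t, v s, x⟫) 0 T := by
    refine absolutelyContinuousOnInterval_of_dist_le (C := ‖x‖)
      (absolutelyContinuous_primitive_norm hT v) fun s hs t ht => ?_
    rw [uIcc_of_le hT] at hs ht
    rw [Real.dist_eq, ← inner_sub_left, mul_comm]
    refine (abs_real_inner_le_norm _ _).trans ?_
    gcongr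
    rw [← dist_eq_norm]
    exact dist_primitive_le v hs ht
  have key := hψ.integral_mul_deriv_eq_deriv_mul hp
  rw [(timeTest_zero ψ).1, (timeTest_zero ψ).2] at key
  simp only [zero_mul, sub_zero, zero_sub] at key
  rw [L2.inner_def, L2.inner_def, ← neg_eq_iff_eq_neg]
  have e1 : ∫ t, ⟪(memLp_primitive hT v).toLp _ t,
      timeTensor T (timeTest_continuous_deriv ψ) x t⟫ ∂(timeMeasure T) =
      ∫ t in (0 : ℝ)..T, deriv ψ t * ⟪∫ s in (0 : ℝ)..t, v s, x⟫ := by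
    rw [← integral_timeMeasure hT]
    refine integral_congr_ae ?_
    filter_upwards [(memLp_primitive hT v).coeFn_toLp, coeFn_timeL2OfContinuous (T := T)
      (w := fun t => deriv ψ t • x) ((timeTest_continuous_deriv ψ).smul continuous_const)]
      with t h1 h2
    rw [h1, timeTensor, h2, real_inner_smul_right]
  have e2 : ∫ t, ⟪v t, timeTensor T ψ.continuous x t⟫ ∂(timeMeasure T) =
      ∫ t in (0 : ℝ)..T, ψ t * deriv (fun t => ⟪∫ s in (0 : ℝ)..t, v s, x⟫) t := by
    rw [← integral_timeMeasure hT]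
    refine integral_congr_ae ?_
    filter_upwards [coeFn_timeL2OfContinuous (T := T)
      (w := fun t => ψ t • x) (ψ.continuous.smul continuous_const),
      ae_restrict_of_ae (ae_hasDerivAt_primitive hT v 0), ae_restrict_mem measurableSet_Ioo]
      with t h1 h2 h3
    have h4 := h2 (Ioo_subset_Icc_self h3)
    simp only [zero_add] at h4
    have h5 := h4.inner ℝ (hasDerivAt_const t x)
    rw [timeTensor, h1, real_inner_smul_right, h5.deriv]
    simp
  rw [e1, e2, key]

/-- A function with a weak derivative in `L²` is almost everywhere a primitive of it. -/
theorem HasWeakTimeDeriv.exists_ae_eq_primitive [CompleteSpace X] (hT : 0 < T) {u v : TimeL2 T X}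
    (h : HasWeakTimeDeriv u v) :
    ∃ x₀, ∀ᵐ t ∂(timeMeasure T), u t = x₀ + ∫ s in (0 : ℝ)..t, v s := by
  have h1 := h.sub (hasWeakTimeDeriv_primitive hT.le v)
  rw [sub_self] at h1
  obtain ⟨x₀, hx₀⟩ := h1.exists_ae_eq_const hT
  refine ⟨x₀, ?_⟩
  filter_upwards [hx₀, Lp.coeFn_sub u ((memLp_primitive hT.le v).toLp _),
    (memLp_primitive hT.le v).coeFn_toLp] with t h1 h2 h3
  rw [h2, Pi.sub_apply, h3] at h1
  rw [← h1, sub_add_cancel]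

theorem eq_of_ae_eq_of_continuousOn {Y : Type*} [TopologicalSpace Y] [T2Space Y] (hT : 0 < T)
    {f g : ℝ → Y} (hf : ContinuousOn f (Icc 0 T)) (hg : ContinuousOn g (Icc 0 T))
    (h : ∀ᵐ t ∂(timeMeasure T), f t = g t) : ∀ t ∈ Icc 0 T, f t = g t := by
  have h1 : EqOn f g (Ioo 0 T) :=
    Measure.eqOn_open_of_ae_eq h isOpen_Ioo (hf.mono Ioo_subset_Icc_self)
      (hg.mono Ioo_subset_Icc_self)
  exact h1.of_subset_closure hf hg Ioo_subset_Icc_self (closure_Ioo hT.ne).ge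

/-- A function with a weak derivative in `L²` and an initial value is the primitive of its weak
derivative that starts at the initial value. -/
theorem HasWeakTimeDeriv.ae_eq_primitive_of_initial [CompleteSpace X] (hT : 0 < T)
    {u v : TimeL2 T X} (h : HasWeakTimeDeriv u v) {u₀ : X} (h0 : HasInitialValue u u₀) :
    ∀ᵐ t ∂(timeMeasure T), u t = u₀ + ∫ s in (0 : ℝ)..t, v s := by
  obtain ⟨x₀, hx₀⟩ := h.exists_ae_eq_primitive hT
  obtain ⟨w, hw, hwu, hw0⟩ := h0
  have h1 := eq_of_ae_eq_of_continuousOn hT hw (continuousOn_primitive hT.le v x₀) (by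
    filter_upwards [hx₀, hwu] with t h1 h2
    rw [← h1, h2]) 0 ⟨le_rfl, hT.le⟩
  rw [hw0, intervalIntegral.integral_same, add_zero] at h1
  rwa [h1]

/-- If the power `⟪M v, u⟫` is nonpositive, the energy `⟪M u, u⟫` of `u = ∫ v` does not exceed its
initial value `0`. -/
theorem inner_primitive_nonpos [CompleteSpace X] (hT : 0 ≤ T) {M : X →L[ℝ] X}
    (hM : ∀ x y, ⟪M x, y⟫ = ⟪x, M y⟫) (v : TimeL2 T X)
    (hv : ∀ᵐ t ∂(timeMeasure T), ⟪M (v t), ∫ s in (0 : ℝ)..t, v s⟫ ≤ 0) {t : ℝ}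
    (ht : t ∈ Icc 0 T) : ⟪M (∫ s in (0 : ℝ)..t, v s), ∫ s in (0 : ℝ)..t, v s⟫ ≤ 0 := by
  set u : ℝ → X := fun t => ∫ s in (0 : ℝ)..t, v s with hu
  have hc : ContinuousOn u (Icc 0 T) := by simpa using continuousOn_primitive hT v 0
  obtain ⟨C, hC⟩ := isCompact_Icc.exists_bound_of_continuousOn hc
  have hac : AbsolutelyContinuousOnInterval (fun t => ⟪M (u t), u t⟫) 0 T := by
    refine absolutelyContinuousOnInterval_of_dist_le (C := 2 * ‖M‖ * C)
      (absolutelyContinuous_primitive_norm hT v) fun s hs t ht => ?_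
    rw [uIcc_of_le hT] at hs ht
    have h1 : ⟪M (u s), u s⟫ - ⟪M (u t), u t⟫ = ⟪M (u s - u t), u s + u t⟫ := by
      have h2 := hM (u s) (u t)
      have h3 := real_inner_comm (u s) (M (u t))
      rw [map_sub, inner_sub_left, inner_add_right, inner_add_right]
      linarith
    have h2 : ‖u s + u t‖ ≤ C + C := (norm_add_le _ _).trans (add_le_add (hC s hs) (hC t ht))
    have hC0 : 0 ≤ C := (norm_nonneg _).trans (hC s hs)
    have h3 := dist_primitive_le v hs ht
    rw [dist_eq_norm (∫ r in (0 : ℝ)..s, v r)] at h3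
    rw [Real.dist_eq, h1]
    calc |⟪M (u s - u t), u s + u t⟫| ≤ ‖M (u s - u t)‖ * ‖u s + u t‖ :=
          abs_real_inner_le_norm _ _
      _ ≤ (‖M‖ * dist (∫ r in (0 : ℝ)..s, ‖v r‖) (∫ r in (0 : ℝ)..t, ‖v r‖)) * (C + C) := by
          gcongr
          exact (M.le_opNorm _).trans (by gcongr)
      _ = _ := by ring
  have hderiv : ∀ᵐ r, r ∈ Icc 0 T → HasDerivAt (fun t => ⟪M (u t), u t⟫) (2 * ⟪M (v r), u r⟫) r := by
    filter_upwards [ae_hasDerivAt_primitive hT v 0] with r hr h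
    have h1 := hr h
    simp only [zero_add] at h1
    exact hasDerivAt_inner_symm hM h1
  have hsub : uIcc 0 t ⊆ uIcc 0 T := by
    rw [uIcc_of_le hT, uIcc_of_le ht.1]; exact Icc_subset_Icc_right ht.2
  have h1 := (hac.mono hsub).integral_deriv_eq_sub
  have h2 : ∫ r in (0 : ℝ)..t, deriv (fun t => ⟪M (u t), u t⟫) r ≤ 0 := by
    rw [intervalIntegral.integral_of_le ht.1, integral_Ioc_eq_integral_Ioo]
    refine integral_nonpos_of_ae ?_
    have h3 : ∀ᵐ r ∂(volume.restrict (Ioo 0 t)), ⟪M (v r), u r⟫ ≤ 0 :=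
      ae_mono (Measure.restrict_mono (Ioo_subset_Ioo_right ht.2) le_rfl) hv
    filter_upwards [h3, ae_restrict_of_ae hderiv, ae_restrict_mem measurableSet_Ioo]
      with r h3 h4 h5
    rw [(h4 ⟨h5.1.le, h5.2.le.trans ht.2⟩).deriv]
    change 2 * ⟪M (v r), u r⟫ ≤ 0
    linarith
  have h0 : u 0 = 0 := by simp [hu]
  rw [h1, h0, map_zero, inner_zero_left, sub_zero] at h2
  exact h2

end Representative

end StochMaxwell

namespace StochMaxwell

section Limit

variable {T : ℝ} {X : Type*} [NormedAddCommGroup X]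

theorem tendsto_timeL2OfContinuous {w : ℕ → ℝ → X} (hw : ∀ n, Continuous (w n)) {u : ℝ → X}
    (hu : Continuous u) {b : ℕ → ℝ} (hb : Tendsto b atTop (𝓝 0))
    (h : ∀ n, ∀ t ∈ Icc 0 T, ‖w n t - u t‖ ≤ b n) (hb0 : ∀ n, 0 ≤ b n) :
    Tendsto (fun n => timeL2OfContinuous T (hw n)) atTop (𝓝 (timeL2OfContinuous T hu)) := by
  rw [tendsto_iff_norm_sub_tendsto_zero]
  refine squeeze_zero (fun _ => norm_nonneg _) (fun n => Lp.norm_le_of_ae_bound (hb0 n) ?_)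
    (by simpa using hb.const_mul _)
  filter_upwards [Lp.coeFn_sub (timeL2OfContinuous T (hw n)) (timeL2OfContinuous T hu),
    coeFn_timeL2OfContinuous (T := T) (hw n), coeFn_timeL2OfContinuous (T := T) hu,
    ae_restrict_mem measurableSet_Ioo] with t h1 h2 h3 h4
  rw [h1, Pi.sub_apply, h2, h3]
  exact h n t (Ioo_subset_Icc_self h4)

variable [InnerProductSpace ℝ X]

/-- Strong limits in the first and weak limits in the second component preserve the relation `A`
almost everywhere in time, because `A` is the zero set of a bounded operator built from the
resolvent. -/
theorem IsSkewAdjointRel.ae_mem_of_weaklyTendsto [CompleteSpace X] {A : Set (X × X)}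
    (hA : IsSkewAdjointRel A) {ι : Type*} {𝒰 : Filter ι} [𝒰.NeBot] {x y : ι → TimeL2 T X}
    {U Y : TimeL2 T X} (hxy : ∀ i, ∀ᵐ t ∂(timeMeasure T), (x i t, y i t) ∈ A)
    (hx : WeaklyTendsto x 𝒰 U) (hy : WeaklyTendsto y 𝒰 Y) :
    ∀ᵐ t ∂(timeMeasure T), (U t, Y t) ∈ A := by
  have hmem : ∀ U Y : TimeL2 T X, (∀ᵐ t ∂(timeMeasure T), (U t, Y t) ∈ A) ↔
      (hA.resolvent one_pos).compLpL 2 (timeMeasure T) (U - Y) = U := fun U Y => by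
    rw [Lp.ext_iff]
    constructor
    · intro h
      filter_upwards [h, (hA.resolvent one_pos).coeFn_compLpL (U - Y), Lp.coeFn_sub U Y]
        with t h1 h2 h3
      rw [h2, h3, Pi.sub_apply]
      simpa using (hA.mem_iff_resolvent one_pos).1 h1
    · intro h
      filter_upwards [h, (hA.resolvent one_pos).coeFn_compLpL (U - Y), Lp.coeFn_sub U Y]
        with t h1 h2 h3
      rw [h2, h3, Pi.sub_apply] at h1
      exact (hA.mem_iff_resolvent one_pos).2 (by simpa using h1)
  rw [hmem]
  refine ((hx.sub hy).map _).unique (𝒰 := 𝒰) ?_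
  intro z
  refine (hx z).congr fun i => ?_
  exact (congrArg (fun y => ⟪y, z⟫) ((hmem _ _).1 (hxy i))).symm

end Limit

section Existence

variable {X : Type*} [NormedAddCommGroup X] [InnerProductSpace ℝ X] [CompleteSpace X]
  {A : Set (X × X)} {M : X →L[ℝ] X} {S : X → X} {f : ℝ → X} {c : ℝ} {K L : NNReal}

/-- Bounds for the approximate solutions that do not depend on the Yosida parameter. -/
theorem IsEvolutionData.exists_bounds (h : IsEvolutionData A M S f c K L) {T : ℝ} (hT : 0 ≤ T)
    {u₀ a₀ : X} (h₀ : (u₀, a₀) ∈ A) :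
    ∃ C₁ C₂ : ℝ, 0 ≤ C₁ ∧ 0 ≤ C₂ ∧ ∀ (l : ℝ) (hl : 0 < l) (u v : ℝ → X), u 0 = u₀ →
      (∀ t ∈ Icc 0 (T + 1), HasDerivAt u (v t) t) →
      (∀ t, M (v t) = h.skew.yosida hl (u t) + S (u t) + f t) →
      ∀ t ∈ Icc 0 T, ‖v t‖ ≤ C₁ ∧ ‖h.skew.yosida hl (u t)‖ ≤ C₂ := by
  have hc := h.pos
  set R := (‖a₀‖ + ‖S u₀‖ + ‖f 0‖) / c with hR
  have hR0 : 0 ≤ R := by positivity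
  obtain ⟨Cf, hCf⟩ := isCompact_Icc.exists_bound_of_continuousOn
    (h.source.continuous.continuousOn (s := Icc 0 T))
  have hCf0 : 0 ≤ Cf := (norm_nonneg _).trans (hCf 0 ⟨le_rfl, hT⟩)
  set B := (‖M‖ * R ^ 2 + L ^ 2 / c) * Real.exp T with hB
  set C₁ := Real.sqrt (B / c) with hC₁
  refine ⟨C₁, ‖M‖ * C₁ + K * (‖u₀‖ + C₁ * T) + Cf, by positivity, by positivity, ?_⟩
  intro l hl u v hu0 hd hv
  -- the initial velocity is bounded because the initial value is in the domain of `A`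
  have hv0 : ‖v 0‖ ≤ R := by
    have h1 : ‖M (v 0)‖ ≤ ‖a₀‖ + ‖S u₀‖ + ‖f 0‖ := by
      rw [hv, hu0]
      exact (norm_add₃_le).trans (by gcongr; exact h.skew.norm_yosida_le hl h₀)
    have h2 := (h.coercive (v 0)).trans (real_inner_le_norm _ _)
    rw [hR, le_div_iff₀ hc]
    rcases (norm_nonneg (v 0)).eq_or_lt with h3 | h3
    · rw [← h3, zero_mul]; positivity
    · have h4 : c * ‖v 0‖ * ‖v 0‖ ≤ (‖a₀‖ + ‖S u₀‖ + ‖f 0‖) * ‖v 0‖ := by nlinarith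
      linarith [le_of_mul_le_mul_right h4 h3]
  have hv1 : ∀ t ∈ Icc 0 T, ‖v t‖ ≤ C₁ := fun t ht => by
    have h1 := h.norm_deriv_sq_le hl hT hd hv ht
    have h2 : (‖M‖ * ‖v 0‖ ^ 2 + L ^ 2 / c) * Real.exp T ≤ B := by
      rw [hB]; gcongr
    refine Real.le_sqrt_of_sq_le ?_
    rw [le_div_iff₀ hc]
    linarith
  have hu1 : ∀ t ∈ Icc 0 T, ‖u t‖ ≤ ‖u₀‖ + C₁ * T := fun t ht => by
    have h1 := (convex_Icc 0 T).norm_image_sub_le_of_norm_hasDerivWithin_le (f := u) (f' := v)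
      (fun s hs => (hd s ⟨hs.1, by linarith [hs.2]⟩).hasDerivWithinAt) hv1
      (left_mem_Icc.2 hT) ht
    rw [hu0, sub_zero, Real.norm_of_nonneg ht.1] at h1
    have h2 : C₁ * t ≤ C₁ * T := by have := ht.2; gcongr
    have h3 := norm_le_insert' (u t) u₀
    linarith
  intro t ht
  refine ⟨hv1 t ht, ?_⟩
  have h1 : h.skew.yosida hl (u t) = M (v t) - S (u t) - f t := by rw [hv]; abel
  have h2 : ‖S (u t)‖ ≤ K * (‖u₀‖ + C₁ * T) := by
    have := h.lipschitz.dist_le_mul (u t) 0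
    rw [h.map_zero, dist_zero_right, dist_zero_right] at this
    exact this.trans (by gcongr; exact hu1 t ht)
  rw [h1]
  refine (norm_sub_le _ _).trans (add_le_add ((norm_sub_le _ _).trans (add_le_add ?_ h2))
    (hCf t ht))
  exact (M.le_opNorm _).trans (by gcongr; exact hv1 t ht)

/-- Existence for `M u' = A u + S(u) + f`, `u(0) = u₀`, with initial value in the domain of `A`.
The solution is the uniform limit of the solutions of the equations with the Yosida
approximations of `A`. -/
theorem IsEvolutionData.exists_solution (h : IsEvolutionData A M S f c K L) {T : ℝ} (hT : 0 ≤ T)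
    {u₀ a₀ : X} (h₀ : (u₀, a₀) ∈ A) :
    ∃ (u : ℝ → X) (hu : Continuous u) (V Y : TimeL2 T X), u 0 = u₀ ∧
      HasWeakTimeDeriv (timeL2OfContinuous T hu) V ∧
      (∀ᵐ t ∂(timeMeasure T), (u t, Y t) ∈ A) ∧
      ∀ᵐ t ∂(timeMeasure T), M (V t) = Y t + S (u t) + f t := by
  have hc := h.pos
  obtain ⟨C₁, C₂, hC₁, hC₂, hbd⟩ := h.exists_bounds hT h₀
  let l : ℕ → ℝ := fun n => 1 / ((n : ℝ) + 1)
  have hl : ∀ n, 0 < l n := fun n => by positivity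
  have hl0 : Tendsto l atTop (𝓝 0) := tendsto_one_div_add_atTop_nhds_zero_nat
  have hlanti : Antitone l := fun m n hmn => one_div_le_one_div_of_le (by positivity) (by gcongr)
  choose u v hu hu0 hv hd hM using fun n =>
    h.exists_yosida_solution (hl n) (by linarith : 0 ≤ T + 1) u₀
  have hd' : ∀ n, ∀ t ∈ Icc 0 T, HasDerivAt (u n) (v n t) t := fun n t ht =>
    hd n t ⟨ht.1, by linarith [ht.2]⟩
  have hb := fun n => hbd (l n) (hl n) (u n) (v n) (hu0 n) (hd n) (hM n)
  set D := 4 * C₂ ^ 2 * Real.exp T / c with hD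
  let b : ℕ → ℝ := fun n => Real.sqrt (D * (l n + l n))
  have hb0 : ∀ n, 0 ≤ b n := fun n => Real.sqrt_nonneg _
  have hblim : Tendsto b atTop (𝓝 0) := by
    simpa [b] using ((hl0.add hl0).const_mul D).sqrt
  have hdist : ∀ N m n, N ≤ m → N ≤ n → ∀ t ∈ Icc 0 T, ‖u m t - u n t‖ ≤ b N := by
    intro N m n hm hn t ht
    have h1 := h.norm_sub_sq_le (hl m) (hl n) ((hu0 m).trans (hu0 n).symm) (hd' m) (hd' n)
      (hM m) (hM n) (fun t ht => (hb m t ht).2) (fun t ht => (hb n t ht).2) ht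
    refine Real.le_sqrt_of_sq_le ?_
    have h2 : ‖u m t - u n t‖ ^ 2 ≤ D * (l m + l n) := by
      rw [hD, div_mul_eq_mul_div, le_div_iff₀ hc]; linarith
    refine h2.trans ?_
    have : 0 ≤ D := by positivity
    gcongr
    · exact hlanti hm
    · exact hlanti hn
  -- the uniform limit, extended from `[0, T]` to a continuous function on the line
  have hp : ∀ t : ℝ, (projIcc 0 T hT t : ℝ) ∈ Icc 0 T := fun t => (projIcc 0 T hT t).2
  have hlim : ∀ t : ℝ, ∃ x, Tendsto (fun n => u n (projIcc 0 T hT t)) atTop (𝓝 x) := fun t =>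
    cauchySeq_tendsto_of_complete (cauchySeq_of_le_tendsto_0 b (fun n m N hn hm => by
      rw [dist_eq_norm]; exact hdist N n m hn hm _ (hp t)) hblim)
  choose w hw using hlim
  have hwb : ∀ n t, ‖u n (projIcc 0 T hT t) - w t‖ ≤ b n := fun n t =>
    le_of_tendsto ((tendsto_const_nhds.sub (hw t)).norm)
      (eventually_atTop.2 ⟨n, fun m hm => hdist n n m le_rfl hm _ (hp t)⟩)
  have hwc : Continuous w := by
    refine TendstoUniformly.continuous (F := fun n t => u n (projIcc 0 T hT t)) (p := atTop) ?_
      (Frequently.of_forall fun n => (hu n).comp (continuous_subtype_val.comp continuous_projIcc))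
    rw [Metric.tendstoUniformly_iff]
    intro ε hε
    filter_upwards [hblim.eventually_lt_const hε] with n hn t
    rw [dist_comm, dist_eq_norm]
    exact (hwb n t).trans_lt hn
  have huw : ∀ n, ∀ t ∈ Icc 0 T, ‖u n t - w t‖ ≤ b n := fun n t ht => by
    have := hwb n t
    rwa [projIcc_of_mem hT ht] at this
  have hw0 : w 0 = u₀ := by
    refine tendsto_nhds_unique (hw 0) ?_
    simp [hu0]
  -- strong limits
  have hUlim := tendsto_timeL2OfContinuous (T := T) hu hwc hblim huw hb0
  have hSlim := tendsto_timeL2OfContinuous (T := T)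
    (fun n => h.lipschitz.continuous.comp (hu n)) (h.lipschitz.continuous.comp hwc)
    (by simpa using hblim.const_mul (K : ℝ)) (fun n t ht => by
      have := h.lipschitz.dist_le_mul (u n t) (w t)
      rw [dist_eq_norm, dist_eq_norm] at this
      exact this.trans (mul_le_mul_of_nonneg_left (huw n t ht) K.2)) (fun n => mul_nonneg K.2 (hb0 n))
  -- the pair of resolvent and Yosida term lies on the graph of `A`
  have hJc : ∀ n, Continuous fun t => h.skew.resolvent (hl n) (u n t) := fun n =>
    (h.skew.resolvent (hl n)).continuous.comp (hu n)
  have hJlim := tendsto_timeL2OfContinuous (T := T) hJc hwc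
    (b := fun n => l n * C₂ + b n) (by simpa using (hl0.mul_const C₂).add hblim)
    (fun n t ht => by
      have h1 : h.skew.resolvent (hl n) (u n t) - w t =
          l n • h.skew.yosida (hl n) (u n t) + (u n t - w t) := by
        nth_rewrite 3 [← h.skew.resolvent_sub_smul_yosida (hl n) (u n t)]
        abel
      rw [h1]
      refine (norm_add_le _ _).trans (add_le_add ?_ (huw n t ht))
      rw [norm_smul, Real.norm_of_nonneg (hl n).le]
      have := (hl n).le
      gcongr
      exact (hb n t ht).2)
    (fun n => add_nonneg (mul_nonneg (hl n).le hC₂) (hb0 n))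
  -- the weak limit of the derivatives
  let 𝒰 : Ultrafilter ℕ := Filter.hyperfilter ℕ
  have h𝒰 : (𝒰 : Filter ℕ) ≤ atTop := Nat.hyperfilter_le_atTop
  obtain ⟨V, hV⟩ := exists_weaklyTendsto 𝒰 (a := fun n => timeL2OfContinuous T (hv n))
    (C := measureUnivNNReal (timeMeasure T) ^ (2 : ENNReal).toReal⁻¹ * C₁) fun n => by
      refine Lp.norm_le_of_ae_bound hC₁ ?_
      filter_upwards [coeFn_timeL2OfContinuous (T := T) (hv n),
        ae_restrict_mem measurableSet_Ioo] with t h1 h2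
      rw [h1]
      exact (hb n t (Ioo_subset_Icc_self h2)).1
  set SU := timeL2OfContinuous T (h.lipschitz.continuous.comp hwc)
  set FL := timeL2OfContinuous T h.source.continuous
  set ML := M.compLpL 2 (timeMeasure T)
  refine ⟨w, hwc, V, ML V - SU - FL, hw0, ?_, ?_, ?_⟩
  · exact HasWeakTimeDeriv.of_weaklyTendsto (𝒰 := (𝒰 : Filter ℕ))
      (fun n => HasWeakTimeDeriv.of_hasDerivAt hT (hu n) (hv n) (hd' n))
      (WeaklyTendsto.of_tendsto (hUlim.mono_left h𝒰)) hV
  · have key := h.skew.ae_mem_of_weaklyTendsto (T := T) (𝒰 := (𝒰 : Filter ℕ))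
      (x := fun n => timeL2OfContinuous T (hJc n))
      (y := fun n => ML (timeL2OfContinuous T (hv n)) -
        timeL2OfContinuous T (h.lipschitz.continuous.comp (hu n)) - FL)
      (U := timeL2OfContinuous T hwc) (Y := ML V - SU - FL) (fun n => ?_)
      (WeaklyTendsto.of_tendsto (hJlim.mono_left h𝒰))
      (((hV.map ML).sub (WeaklyTendsto.of_tendsto (hSlim.mono_left h𝒰))).sub
        (WeaklyTendsto.of_tendsto tendsto_const_nhds))
    · filter_upwards [key, coeFn_timeL2OfContinuous (T := T) hwc] with t h1 h2
      rwa [h2] at h1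
    · filter_upwards [coeFn_timeL2OfContinuous (T := T) (hJc n),
        coeFn_timeL2OfContinuous (T := T) (hv n),
        coeFn_timeL2OfContinuous (T := T) (h.lipschitz.continuous.comp (hu n)),
        coeFn_timeL2OfContinuous (T := T) h.source.continuous,
        M.coeFn_compLpL (timeL2OfContinuous T (hv n)),
        Lp.coeFn_sub (ML (timeL2OfContinuous T (hv n)) -
          timeL2OfContinuous T (h.lipschitz.continuous.comp (hu n))) FL,
        Lp.coeFn_sub (ML (timeL2OfContinuous T (hv n)))
          (timeL2OfContinuous T (h.lipschitz.continuous.comp (hu n)))] with t h1 h2 h3 h4 h5 h6 h7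
      rw [h1, h6, Pi.sub_apply, h7, Pi.sub_apply, h5, h2, h3, h4, hM]
      have h8 : h.skew.yosida (hl n) (u n t) + S (u n t) + f t - (S ∘ u n) t - f t =
        h.skew.yosida (hl n) (u n t) := by simp only [Function.comp_apply]; abel
      rw [h8]
      exact h.skew.resolvent_yosida_mem (hl n) (u n t)
  · filter_upwards [coeFn_timeL2OfContinuous (T := T) (h.lipschitz.continuous.comp hwc),
      coeFn_timeL2OfContinuous (T := T) h.source.continuous,
      M.coeFn_compLpL V, Lp.coeFn_sub (ML V - SU) FL, Lp.coeFn_sub (ML V) SU]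
      with t h1 h2 h3 h4 h5
    rw [h4, Pi.sub_apply, h5, Pi.sub_apply, h3, h1, h2]
    simp only [Function.comp_apply]
    abel

end Existence

end StochMaxwell

/-! ### The curl of `L²(Λ)`-valued distributions -/

namespace StochMaxwell

theorem continuous_partialDeriv {φ : E3 → E3} (hφ : ContDiff ℝ 1 φ) (i j : Fin 3) :
    Continuous (partialDeriv φ i j) := by
  have h1 : Continuous fun x => fderiv ℝ φ x (EuclideanSpace.single i (1 : ℝ)) :=
    (hφ.continuous_fderiv one_ne_zero).clm_apply continuous_const
  exact (EuclideanSpace.proj (𝕜 := ℝ) j).continuous.comp h1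

theorem continuous_curl {φ : E3 → E3} (hφ : ContDiff ℝ 1 φ) : Continuous (curl φ) := by
  refine (PiLp.continuous_toLp 2 _).comp (continuous_pi fun j => ?_)
  have h := fun i j => continuous_partialDeriv hφ i j
  fin_cases j
  · exact (h 1 2).sub (h 2 1)
  · exact (h 2 0).sub (h 0 2)
  · exact (h 0 1).sub (h 1 0)

theorem testField_contDiff_one {Ω : Opens E3} (φ : 𝓓(Ω, E3)) : ContDiff ℝ 1 φ :=
  φ.contDiff.of_le (by simp)

/-- Integration by parts for the components of test fields. -/
theorem integral_mul_partialDeriv {Ω : Opens E3} (φ φ' : 𝓓(Ω, E3)) (a i b : Fin 3) :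
    Integrable (fun x => φ x a * partialDeriv φ' i b x) ∧
    Integrable (fun x => partialDeriv φ i a x * φ' x b) ∧
    ∫ x, φ x a * partialDeriv φ' i b x = -∫ x, partialDeriv φ i a x * φ' x b := by
  have hcomp : ∀ (φ : 𝓓(Ω, E3)) (a : Fin 3), ContDiff ℝ 1 fun x => φ x a := fun φ a =>
    (EuclideanSpace.proj (𝕜 := ℝ) a).contDiff.comp (testField_contDiff_one φ)
  have hsupp : ∀ (φ : 𝓓(Ω, E3)) (a : Fin 3), HasCompactSupport fun x => φ x a := fun φ a =>
    φ.hasCompactSupport.comp_left (g := fun v : E3 => v a) rfl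
  have hd : ∀ (φ : 𝓓(Ω, E3)) (i a : Fin 3) (x : E3),
      fderiv ℝ (fun x => φ x a) x (EuclideanSpace.single i 1) = partialDeriv φ i a x := by
    intro φ i a x
    have h1 : HasFDerivAt φ (fderiv ℝ φ x) x :=
      ((testField_contDiff_one φ).differentiable one_ne_zero x).hasFDerivAt
    have h2 := (EuclideanSpace.proj (𝕜 := ℝ) a).hasFDerivAt.comp x h1
    have h3 : fderiv ℝ (fun x => φ x a) x = (EuclideanSpace.proj (𝕜 := ℝ) a).comp (fderiv ℝ φ x) :=
      h2.fderiv
    rw [h3]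
    rfl
  have c1 : ∀ (φ : 𝓓(Ω, E3)) (a : Fin 3), Continuous fun x => φ x a := fun φ a =>
    (hcomp φ a).continuous
  have c2 := fun (φ : 𝓓(Ω, E3)) i a => continuous_partialDeriv (testField_contDiff_one φ) i a
  have i1 : Integrable fun x => φ x a * partialDeriv φ' i b x :=
    ((c1 φ a).mul (c2 φ' i b)).integrable_of_hasCompactSupport (hsupp φ a).mul_right
  have i2 : Integrable fun x => partialDeriv φ i a x * φ' x b :=
    ((c2 φ i a).mul (c1 φ' b)).integrable_of_hasCompactSupport (hsupp φ' b).mul_left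
  refine ⟨i1, i2, ?_⟩
  have key := integral_mul_fderiv_eq_neg_fderiv_mul_of_integrable (μ := (volume : Measure E3))
    (f := fun x => φ x a) (g := fun x => φ' x b) (v := EuclideanSpace.single i (1 : ℝ))
    (by simpa only [hd] using i2) (by simpa only [hd] using i1)
    (((c1 φ a).mul (c1 φ' b)).integrable_of_hasCompactSupport (hsupp φ a).mul_right)
    (fun x _ => (hcomp φ a).differentiable one_ne_zero x)
    (fun x _ => (hcomp φ' b).differentiable one_ne_zero x)
  simpa only [hd] using key

theorem inner_curl (v : E3) (φ : E3 → E3) (x : E3) : ⟪v, curl φ x⟫ =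
    v 0 * (partialDeriv φ 1 2 x - partialDeriv φ 2 1 x) +
    v 1 * (partialDeriv φ 2 0 x - partialDeriv φ 0 2 x) +
    v 2 * (partialDeriv φ 0 1 x - partialDeriv φ 1 0 x) := by
  rw [PiLp.inner_apply, Fin.sum_univ_three]
  simp [curl, mul_comm]

/-- The curl is symmetric on test fields. -/
theorem integral_inner_curl {Ω : Opens E3} (φ φ' : 𝓓(Ω, E3)) :
    ∫ x in (Ω : Set E3), ⟪φ x, curl φ' x⟫ = ∫ x in (Ω : Set E3), ⟪curl φ x, φ' x⟫ := by
  rw [setIntegral_eq_integral_of_forall_compl_eq_zero, setIntegral_eq_integral_of_forall_compl_eq_zero]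
  rotate_left
  · intro x hx; rw [testFunction_zero_of_notMem φ' hx, inner_zero_right]
  · intro x hx; rw [testFunction_zero_of_notMem φ hx, inner_zero_left]
  have h := fun a i b => integral_mul_partialDeriv φ φ' a i b
  have e1 : ∫ x, ⟪φ x, curl φ' x⟫ =
      ((∫ x, φ x 0 * partialDeriv φ' 1 2 x) - ∫ x, φ x 0 * partialDeriv φ' 2 1 x) +
      ((∫ x, φ x 1 * partialDeriv φ' 2 0 x) - ∫ x, φ x 1 * partialDeriv φ' 0 2 x) +
      ((∫ x, φ x 2 * partialDeriv φ' 0 1 x) - ∫ x, φ x 2 * partialDeriv φ' 1 0 x) := by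
    rw [← integral_sub (h 0 1 2).1 (h 0 2 1).1, ← integral_sub (h 1 2 0).1 (h 1 0 2).1,
      ← integral_sub (h 2 0 1).1 (h 2 1 0).1, ← integral_add, ← integral_add]
    · exact integral_congr_ae (Eventually.of_forall fun x => by
        simp only [inner_curl]; ring)
    · exact ((h 0 1 2).1.sub (h 0 2 1).1).add ((h 1 2 0).1.sub (h 1 0 2).1)
    · exact (h 2 0 1).1.sub (h 2 1 0).1
    · exact (h 0 1 2).1.sub (h 0 2 1).1
    · exact (h 1 2 0).1.sub (h 1 0 2).1
  have e2 : ∫ x, ⟪curl φ x, φ' x⟫ =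
      ((∫ x, partialDeriv φ 1 2 x * φ' x 0) - ∫ x, partialDeriv φ 2 1 x * φ' x 0) +
      ((∫ x, partialDeriv φ 2 0 x * φ' x 1) - ∫ x, partialDeriv φ 0 2 x * φ' x 1) +
      ((∫ x, partialDeriv φ 0 1 x * φ' x 2) - ∫ x, partialDeriv φ 1 0 x * φ' x 2) := by
    rw [← integral_sub (h 2 1 0).2.1 (h 1 2 0).2.1, ← integral_sub (h 0 2 1).2.1 (h 2 0 1).2.1,
      ← integral_sub (h 1 0 2).2.1 (h 0 1 2).2.1, ← integral_add, ← integral_add]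
    · exact integral_congr_ae (Eventually.of_forall fun x => by
        simp only [real_inner_comm (φ' x), inner_curl]; ring)
    · exact ((h 2 1 0).2.1.sub (h 1 2 0).2.1).add ((h 0 2 1).2.1.sub (h 2 0 1).2.1)
    · exact (h 1 0 2).2.1.sub (h 0 1 2).2.1
    · exact (h 2 1 0).2.1.sub (h 1 2 0).2.1
    · exact (h 0 2 1).2.1.sub (h 2 0 1).2.1
  rw [e1, e2]
  simp only [(h _ _ _).2.2]
  ring

section Tensor

variable {Λ : Type*} [MeasurableSpace Λ] {Ω : Opens E3} {P : Measure Λ} [IsProbabilityMeasure P]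

theorem isFiniteMeasure_restrict_of_isBounded {s : Set E3} (hs : Bornology.IsBounded s) :
    IsFiniteMeasure ((volume : Measure E3).restrict s) :=
  ⟨by rw [Measure.restrict_apply_univ]; exact hs.measure_lt_top⟩

omit [IsProbabilityMeasure P] in
theorem ae_domMeasure_fst_mem : ∀ᵐ p ∂(domMeasure Ω P), p.1 ∈ Ω := by
  have h : ∀ᵐ x ∂((volume : Measure E3).restrict (Ω : Set E3)), x ∈ Ω :=
    ae_restrict_mem Ω.isOpen.measurableSet
  exact Measure.quasiMeasurePreserving_fst.ae h

theorem memLp_tensor (hΩ : Bornology.IsBounded (Ω : Set E3)) {χ : E3 → E3} (hχ : Continuous χ)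
    (g : Lp ℝ 2 P) : MemLp (fun p : E3 × Λ => g p.2 • χ p.1) 2 (domMeasure Ω P) := by
  have := isFiniteMeasure_restrict_of_isBounded hΩ
  have h1 : MemLp (fun p : E3 × Λ => g p.2) 2 (domMeasure Ω P) := (Lp.memLp g).comp_snd _
  obtain ⟨C, hC⟩ := hΩ.isCompact_closure.exists_bound_of_continuousOn hχ.continuousOn
  have h2 : MemLp (fun p : E3 × Λ => χ p.1) ⊤ (domMeasure Ω P) := by
    refine memLp_top_of_bound (hχ.comp_aestronglyMeasurable
      measurable_fst.aestronglyMeasurable) C ?_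
    filter_upwards [ae_domMeasure_fst_mem (Ω := Ω) (P := P)] with p hp
    exact hC _ (subset_closure hp)
  exact h2.smul h1

/-- The field `χ ⊗ g : (x, ω) ↦ g(ω) χ(x)`. -/
noncomputable def tensorField (hΩ : Bornology.IsBounded (Ω : Set E3)) {χ : E3 → E3}
    (hχ : Continuous χ) (g : Lp ℝ 2 P) : FieldL2 Ω P :=
  (memLp_tensor hΩ hχ g).toLp _

theorem inner_tensorField (hΩ : Bornology.IsBounded (Ω : Set E3)) {χ : E3 → E3}
    (hχ : Continuous χ) (g : Lp ℝ 2 P) (u : FieldL2 Ω P) :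
    ⟪u, tensorField hΩ hχ g⟫ = ∫ p, g p.2 * ⟪u p, χ p.1⟫ ∂(domMeasure Ω P) := by
  rw [L2.inner_def]
  refine integral_congr_ae ?_
  filter_upwards [(memLp_tensor (P := P) hΩ hχ g).coeFn_toLp] with p hp
  rw [tensorField, hp, real_inner_smul_right]

/-- The weak curl, tested with elements of the Hilbert space `L²(Ω × Λ)³`. -/
theorem hasWeakCurl_iff (hΩ : Bornology.IsBounded (Ω : Set E3)) (u c : FieldL2 Ω P) :
    HasWeakCurl u c ↔ ∀ (φ : 𝓓(Ω, E3)) (g : Lp ℝ 2 P),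
      ⟪u, tensorField hΩ (continuous_curl (testField_contDiff_one φ)) g⟫ =
        ⟪c, tensorField hΩ φ.continuous g⟫ := by
  simp only [inner_tensorField]; rfl

/-- The weak curl of `φ ⊗ g` is `curl φ ⊗ g`. -/
theorem hasWeakCurl_tensorField (hΩ : Bornology.IsBounded (Ω : Set E3)) (φ : 𝓓(Ω, E3))
    (g : Lp ℝ 2 P) : HasWeakCurl (tensorField hΩ φ.continuous g)
      (tensorField hΩ (continuous_curl (testField_contDiff_one φ)) g) := fun φ' g' => by
  have key : ∀ (χ χ' : E3 → E3) (hχ : Continuous χ),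
      ∫ p, g' p.2 * ⟪tensorField hΩ hχ g p, χ' p.1⟫ ∂(domMeasure Ω P) =
        (∫ x in (Ω : Set E3), ⟪χ x, χ' x⟫) * ∫ ω, g' ω * g ω ∂P := fun χ χ' hχ => by
    rw [← integral_prod_mul]
    refine integral_congr_ae ?_
    filter_upwards [(memLp_tensor (P := P) hΩ hχ g).coeFn_toLp] with p hp
    rw [tensorField, hp, real_inner_smul_left]
    ring
  rw [key _ _ φ.continuous, key _ _ (continuous_curl (testField_contDiff_one φ)),
    integral_inner_curl]

/-- An integrable function on a product is zero if, for almost every first variable, its integrals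
over all measurable sets in the second variable vanish; the null set may depend on the set. -/
theorem ae_eq_zero_of_forall_prod {α β : Type*} [MeasurableSpace α] [MeasurableSpace β]
    {μ : Measure α} {ν : Measure β} [SFinite μ] [SFinite ν] {f : α × β → ℝ}
    (hf : Integrable f (μ.prod ν))
    (h : ∀ S, MeasurableSet S → ∀ᵐ x ∂μ, ∫ y in S, f (x, y) ∂ν = 0) :
    f =ᵐ[μ.prod ν] 0 := by
  have hrect : ∀ (s : Set α) (t : Set β), MeasurableSet t →
      ∫ z in s ×ˢ t, f z ∂(μ.prod ν) = 0 := fun s t ht => by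
    rw [setIntegral_prod _ hf.integrableOn]
    exact integral_eq_zero_of_ae (ae_restrict_of_ae (h t ht))
  refine hf.ae_eq_zero_of_forall_setIntegral_eq_zero fun s hs _ => ?_
  refine MeasurableSpace.induction_on_inter
    (C := fun s _ => ∫ z in s, f z ∂(μ.prod ν) = 0) generateFrom_prod.symm isPiSystem_prod
    (by simp) ?_ ?_ ?_ s hs
  · rintro _ ⟨s, hs, t, ht, rfl⟩
    exact hrect s t ht
  · intro t ht h1
    have h2 := integral_add_compl ht hf
    have h3 := hrect univ univ MeasurableSet.univ
    rw [univ_prod_univ, setIntegral_univ] at h3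
    rw [h1, h3, zero_add] at h2
    exact h2
  · intro F hd hm h1
    rw [integral_iUnion hm hd hf.integrableOn]
    simp [h1]

/-- The fields `φ ⊗ g` with `φ` a test field span a dense subspace. -/
theorem eq_zero_of_inner_tensorField (hΩ : Bornology.IsBounded (Ω : Set E3)) {c : FieldL2 Ω P}
    (h : ∀ (φ : 𝓓(Ω, E3)) (g : Lp ℝ 2 P), ⟪c, tensorField hΩ φ.continuous g⟫ = 0) : c = 0 := by
  have := isFiniteMeasure_restrict_of_isBounded hΩ
  have hint : ∀ e : E3, Integrable (fun p => ⟪c p, e⟫) (domMeasure Ω P) := fun e =>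
    ((Lp.memLp c).integrable (by norm_num)).inner_const e
  have hzero : ∀ e : E3, (fun p => ⟪c p, e⟫) =ᵐ[domMeasure Ω P] 0 := fun e => by
    refine ae_eq_zero_of_forall_prod (hint e) fun S hS => ?_
    have hintS : Integrable (fun x => ∫ ω in S, ⟪c (x, ω), e⟫ ∂P)
        ((volume : Measure E3).restrict (Ω : Set E3)) := by
      have h1 : Integrable (fun p => ⟪c p, e⟫)
          (((volume : Measure E3).restrict (Ω : Set E3)).prod (P.restrict S)) :=
        (hint e).mono_measure (Measure.prod_mono le_rfl Measure.restrict_le_self)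
      exact h1.integral_prod_left
    rw [ae_restrict_iff' Ω.isOpen.measurableSet]
    refine Ω.isOpen.ae_eq_zero_of_integral_contDiff_smul_eq_zero
      (IntegrableOn.locallyIntegrableOn hintS) fun θ hθ hθc hθs => ?_
    -- test with `θ e ⊗ 1_S`
    let φ : 𝓓(Ω, E3) := ⟨fun x => θ x • e, hθ.smul contDiff_const, hθc.smul_right,
      (tsupport_smul_subset_left _ _).trans hθs⟩
    have h1 := h φ (indicatorConstLp 2 hS (measure_ne_top P S) 1)
    rw [inner_tensorField] at h1
    have h2 : ∫ p, indicatorConstLp 2 hS (measure_ne_top P S) (1 : ℝ) p.2 * ⟪c p, φ p.1⟫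
        ∂(domMeasure Ω P) =
        ∫ p, θ p.1 * S.indicator (fun ω => ⟪c (p.1, ω), e⟫) p.2 ∂(domMeasure Ω P) := by
      refine integral_congr_ae ?_
      filter_upwards [Measure.quasiMeasurePreserving_snd.ae (indicatorConstLp_coeFn
        (p := 2) (hs := hS) (hμs := measure_ne_top P S) (c := (1 : ℝ)))] with p hp
      rw [hp]
      change _ * ⟪c p, θ p.1 • e⟫ = _
      rw [real_inner_smul_right]
      by_cases hpS : p.2 ∈ S <;> simp [hpS]
    rw [h2, integral_prod] at h1
    · rw [← h1]
      rw [← setIntegral_eq_integral_of_forall_compl_eq_zero (s := (Ω : Set E3))]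
      · refine integral_congr_ae (Eventually.of_forall fun x => ?_)
        simp only [smul_eq_mul]
        rw [integral_const_mul, integral_indicator hS]
      · intro x hx
        rw [image_eq_zero_of_notMem_tsupport fun h => hx (hθs h), zero_smul]
    · obtain ⟨C, hC⟩ := hθ.continuous.bounded_above_of_compact_support hθc
      have h3 : Integrable (fun p : E3 × Λ => S.indicator (fun ω => ⟪c (p.1, ω), e⟫) p.2)
          (domMeasure Ω P) := by
        have := (hint e).indicator (measurable_snd hS)
        exact this
      exact h3.bdd_mul (c := C) (hθ.continuous.comp_aestronglyMeasurable
        measurable_fst.aestronglyMeasurable) (Eventually.of_forall fun p => hC p.1)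
  refine Lp.ext ?_
  have hall : ∀ᵐ p ∂(domMeasure Ω P), ∀ i : Fin 3, ⟪c p, EuclideanSpace.single i (1 : ℝ)⟫ = 0 :=
    ae_all_iff.2 fun i => hzero _
  filter_upwards [hall, Lp.coeFn_zero E3 2 (domMeasure Ω P)] with p hp h0
  rw [h0]
  ext i
  simpa [EuclideanSpace.inner_single_right] using hp i

theorem HasWeakCurl.unique (hΩ : Bornology.IsBounded (Ω : Set E3)) {u c c' : FieldL2 Ω P}
    (h : HasWeakCurl u c) (h' : HasWeakCurl u c') : c = c' := by
  rw [← sub_eq_zero]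
  refine eq_zero_of_inner_tensorField hΩ fun φ g => ?_
  rw [inner_sub_left, ← (hasWeakCurl_iff hΩ u c).1 h, ← (hasWeakCurl_iff hΩ u c').1 h', sub_self]

end Tensor

end StochMaxwell

/-! ### The divergence of `L²(Λ)`-valued distributions -/

namespace StochMaxwell

/-- The vector that represents a linear form on `ℝ³`. -/
noncomputable def rieszVector : (E3 →L[ℝ] ℝ) →L[ℝ] E3 :=
  ∑ i : Fin 3, (ContinuousLinearMap.apply ℝ ℝ (EuclideanSpace.single i (1 : ℝ))).smulRight
    (EuclideanSpace.single i (1 : ℝ))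

theorem rieszVector_apply (l : E3 →L[ℝ] ℝ) (j : Fin 3) :
    rieszVector l j = l (EuclideanSpace.single j 1) := by
  simp [rieszVector, Finset.sum_apply, Pi.single_apply]

theorem inner_rieszVector (v : E3) (l : E3 →L[ℝ] ℝ) : ⟪v, rieszVector l⟫ = l v := by
  have hv : v = ∑ i : Fin 3, v i • EuclideanSpace.single i (1 : ℝ) := by
    ext j
    simp [Finset.sum_apply, Pi.single_apply]
  rw [PiLp.inner_apply]
  conv_rhs => rw [hv]
  rw [map_sum]
  refine Finset.sum_congr rfl fun i _ => ?_
  rw [rieszVector_apply, map_smul]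
  simp [mul_comm]

/-- The gradient of a test function, as a test field. -/
noncomputable def gradField {Ω : Opens E3} (φ : 𝓓(Ω, ℝ)) : 𝓓(Ω, E3) :=
  TestFunction.postcompCLM rieszVector (TestFunction.fderivCLM ℝ ⊤ ⊤ φ)

theorem gradField_apply {Ω : Opens E3} (φ : 𝓓(Ω, ℝ)) (x : E3) :
    gradField φ x = rieszVector (fderiv ℝ φ x) := by
  simp [gradField]

theorem curl_gradField {Ω : Opens E3} (φ : 𝓓(Ω, ℝ)) : curl (gradField φ) = fun _ => 0 := by
  funext x
  have hcd : ContDiff ℝ 2 φ := φ.contDiff.of_le (WithTop.coe_le_coe.2 (le_top : (2 : ℕ∞) ≤ ⊤))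
  have h1 : ∀ i j, partialDeriv (gradField φ) i j x =
      fderiv ℝ (fderiv ℝ φ) x (EuclideanSpace.single i 1) (EuclideanSpace.single j 1) := by
    intro i j
    have h2 : DifferentiableAt ℝ (fderiv ℝ φ) x :=
      (hcd.fderiv_right (m := 1) (by norm_num)).differentiable one_ne_zero x
    have h3 : HasFDerivAt (gradField φ) (rieszVector.comp (fderiv ℝ (fderiv ℝ φ) x)) x := by
      have : (gradField φ : E3 → E3) = fun x => rieszVector (fderiv ℝ φ x) :=
        funext (gradField_apply φ)
      rw [this]
      exact rieszVector.hasFDerivAt.comp x h2.hasFDerivAt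
    rw [partialDeriv, h3.fderiv]
    exact rieszVector_apply _ _
  have hs : ∀ i j, partialDeriv (gradField φ) i j x = partialDeriv (gradField φ) j i x := by
    intro i j
    rw [h1, h1]
    exact (hcd.contDiffAt.isSymmSndFDerivAt (by simp)).eq _ _
  ext j
  fin_cases j
  · simp [curl, hs 1 2]
  · simp [curl, hs 2 0]
  · simp [curl, hs 0 1]

section Div

variable {Λ : Type*} [MeasurableSpace Λ] {Ω : Opens E3} {P : Measure Λ} [IsProbabilityMeasure P]

theorem divPairing_eq (hΩ : Bornology.IsBounded (Ω : Set E3)) (u : FieldL2 Ω P) (φ : 𝓓(Ω, ℝ))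
    (g : Lp ℝ 2 P) :
    divPairing u φ g = -⟪u, tensorField hΩ (gradField φ).continuous g⟫ := by
  rw [inner_tensorField, divPairing]
  simp only [gradField_apply, inner_rieszVector]

/-- The divergence of a weak curl vanishes. -/
theorem HasWeakCurl.divPairing_eq_zero (hΩ : Bornology.IsBounded (Ω : Set E3))
    {u c : FieldL2 Ω P} (h : HasWeakCurl u c) (φ : 𝓓(Ω, ℝ)) (g : Lp ℝ 2 P) :
    divPairing c φ g = 0 := by
  have h1 := h (gradField φ) g
  rw [divPairing_eq hΩ, inner_tensorField, ← h1, curl_gradField]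
  simp

theorem norm_tensorField_le (hΩ : Bornology.IsBounded (Ω : Set E3)) {χ : E3 → E3}
    (hχ : Continuous χ) {C : ℝ} (hC : ∀ x, ‖χ x‖ ≤ C) (g : Lp ℝ 2 P) :
    ‖tensorField hΩ hχ g‖ ≤
      Real.sqrt (volume.real (Ω : Set E3)) * C * ‖g‖ := by
  have := isFiniteMeasure_restrict_of_isBounded hΩ
  have hC0 : 0 ≤ C := (norm_nonneg _).trans (hC 0)
  have h1 : ‖tensorField hΩ hχ g‖ ^ 2 =
      (∫ x in (Ω : Set E3), ‖χ x‖ ^ 2) * ‖g‖ ^ 2 := by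
    rw [← real_inner_self_eq_norm_sq, ← real_inner_self_eq_norm_sq, inner_tensorField,
      L2.inner_def, ← integral_prod_mul]
    refine integral_congr_ae ?_
    filter_upwards [(memLp_tensor (P := P) hΩ hχ g).coeFn_toLp] with p hp
    rw [tensorField, hp, real_inner_smul_left, real_inner_self_eq_norm_sq,
      real_inner_self_eq_norm_sq, Real.norm_eq_abs, sq_abs]
    ring
  have h2 : ∫ x in (Ω : Set E3), ‖χ x‖ ^ 2 ≤ volume.real (Ω : Set E3) * C ^ 2 := by
    have h3 : ∫ x in (Ω : Set E3), ‖χ x‖ ^ 2 ≤ ∫ _ in (Ω : Set E3), C ^ 2 := by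
      refine integral_mono_of_nonneg (Eventually.of_forall fun _ => by positivity)
        (integrable_const _) (Eventually.of_forall fun x => ?_)
      have := hC x
      dsimp only
      gcongr
    rwa [setIntegral_const, smul_eq_mul] at h3
  refine le_of_sq_le_sq ?_ (by positivity)
  rw [h1, mul_pow, mul_pow, Real.sq_sqrt measureReal_nonneg]
  gcongr

theorem tensorField_add_left (hΩ : Bornology.IsBounded (Ω : Set E3)) {χ χ' χ'' : E3 → E3}
    (hχ : Continuous χ) (hχ' : Continuous χ') (hχ'' : Continuous χ'')
    (h : ∀ x, χ'' x = χ x + χ' x) (g : Lp ℝ 2 P) :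
    tensorField hΩ hχ'' g = tensorField hΩ hχ g + tensorField hΩ hχ' g := by
  rw [tensorField, tensorField, tensorField, ← MemLp.toLp_add]
  congr 1
  funext p
  simp [h]

theorem tensorField_smul_left (hΩ : Bornology.IsBounded (Ω : Set E3)) {χ χ' : E3 → E3}
    (hχ : Continuous χ) (hχ' : Continuous χ') (r : ℝ)
    (h : ∀ x, χ' x = r • χ x) (g : Lp ℝ 2 P) :
    tensorField hΩ hχ' g = r • tensorField hΩ hχ g := by
  rw [tensorField, tensorField, ← MemLp.toLp_const_smul]
  congr 1
  funext p
  simp [h, smul_comm r]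

theorem tensorField_add_right (hΩ : Bornology.IsBounded (Ω : Set E3)) {χ : E3 → E3}
    (hχ : Continuous χ) (g g' : Lp ℝ 2 P) :
    tensorField hΩ hχ (g + g') = tensorField hΩ hχ g + tensorField hΩ hχ g' := by
  rw [tensorField, tensorField, tensorField, ← MemLp.toLp_add]
  refine MemLp.toLp_congr _ _ ?_
  filter_upwards [Measure.quasiMeasurePreserving_snd.ae (Lp.coeFn_add g g')] with p hp
  rw [hp, Pi.add_apply, add_smul]; rfl

theorem tensorField_smul_right (hΩ : Bornology.IsBounded (Ω : Set E3)) {χ : E3 → E3}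
    (hχ : Continuous χ) (r : ℝ) (g : Lp ℝ 2 P) :
    tensorField hΩ hχ (r • g) = r • tensorField hΩ hχ g := by
  rw [tensorField, tensorField, ← MemLp.toLp_const_smul]
  refine MemLp.toLp_congr _ _ ?_
  filter_upwards [Measure.quasiMeasurePreserving_snd.ae (Lp.coeFn_smul r g)] with p hp
  rw [hp, Pi.smul_apply, smul_eq_mul, mul_smul]; rfl

/-- For a bounded continuous field `l` of linear forms, the functional
`g ↦ -∫∫ g(ω) l(x)(u(x, ω)) dx dP`, and its bound that is uniform in `l`. -/
noncomputable def divFunctional (hΩ : Bornology.IsBounded (Ω : Set E3)) (u : FieldL2 Ω P)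
    (l : BoundedContinuousFunction E3 (E3 →L[ℝ] ℝ)) : Lp ℝ 2 P →L[ℝ] ℝ :=
  LinearMap.mkContinuous
    { toFun := fun g => -⟪u, tensorField hΩ (rieszVector.continuous.comp l.continuous) g⟫
      map_add' := fun g g' => by rw [tensorField_add_right, inner_add_right]; ring
      map_smul' := fun r g => by
        rw [tensorField_smul_right, real_inner_smul_right, RingHom.id_apply, smul_eq_mul]; ring }
    (‖u‖ * (Real.sqrt (volume.real (Ω : Set E3)) * (‖rieszVector‖ * ‖l‖)))
    fun g => by
      change ‖-⟪u, tensorField hΩ (rieszVector.continuous.comp l.continuous) g⟫‖ ≤ _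
      rw [norm_neg, mul_assoc]
      refine (norm_inner_le_norm _ _).trans ?_
      gcongr
      refine norm_tensorField_le hΩ _ (fun x => ?_) g
      exact (rieszVector.le_opNorm _).trans (by gcongr; exact l.norm_coe_le_norm x)

/-- Every field in `L²(Ω × Λ)³` has a divergence in the sense of `L²(Λ)`-valued distributions. -/
theorem exists_hasDistribDiv (hΩ : Bornology.IsBounded (Ω : Set E3)) (u : FieldL2 Ω P) :
    ∃ q : 𝓓'(Ω, Lp ℝ 2 P), HasDistribDiv u q := by
  let B : BoundedContinuousFunction E3 (E3 →L[ℝ] ℝ) →L[ℝ] Lp ℝ 2 P :=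
    LinearMap.mkContinuous
      { toFun := fun l => (InnerProductSpace.toDual ℝ (Lp ℝ 2 P)).symm (divFunctional hΩ u l)
        map_add' := fun l l' => by
          rw [← map_add]
          congr 1
          ext g
          change -⟪u, tensorField hΩ _ g⟫ = -⟪u, tensorField hΩ _ g⟫ + -⟪u, tensorField hΩ _ g⟫
          rw [tensorField_add_left hΩ (rieszVector.continuous.comp l.continuous)
            (rieszVector.continuous.comp l'.continuous) _ (fun x => by simp), inner_add_right]
          ring
        map_smul' := fun r l => by
          rw [RingHom.id_apply]
          refine ext_inner_right ℝ fun g => ?_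
          rw [real_inner_smul_left, InnerProductSpace.toDual_symm_apply,
            InnerProductSpace.toDual_symm_apply]
          change -⟪u, tensorField hΩ _ g⟫ = r * -⟪u, tensorField hΩ _ g⟫
          rw [tensorField_smul_left hΩ (rieszVector.continuous.comp l.continuous) _ r
            (fun x => by simp), real_inner_smul_right]
          ring }
      (‖u‖ * (Real.sqrt (volume.real (Ω : Set E3)) * ‖rieszVector‖)) fun l => by
        change ‖(InnerProductSpace.toDual ℝ (Lp ℝ 2 P)).symm (divFunctional hΩ u l)‖ ≤ _
        rw [LinearIsometryEquiv.norm_map, mul_assoc, mul_assoc]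
        exact LinearMap.mkContinuous_norm_le _ (by positivity) _
  let q : 𝓓(Ω, ℝ) →L[ℝ] Lp ℝ 2 P := B.comp
    ((TestFunction.toBoundedContinuousFunctionCLM ℝ).comp
      (TestFunction.fderivCLM ℝ ⊤ ⊤ : 𝓓(Ω, ℝ) →L[ℝ] 𝓓(Ω, E3 →L[ℝ] ℝ)))
  refine ⟨⟨q.toLinearMap, q.continuous⟩, fun φ g => ?_⟩
  change ⟪(InnerProductSpace.toDual ℝ (Lp ℝ 2 P)).symm (divFunctional hΩ u _), g⟫ = _
  rw [InnerProductSpace.toDual_symm_apply, divPairing_eq hΩ]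
  rfl

end Div

/-! ### The Maxwell relation -/

section Maxwell

variable {Λ : Type*} [MeasurableSpace Λ]

/-- Pairs of fields `(E, H)`. -/
abbrev FieldPair (Ω : Opens E3) (P : Measure Λ) : Type _ := WithLp 2 (FieldL2 Ω P × FieldL2 Ω P)

/-- `c = curl u`, where `u` has zero tangential trace: the adjoint of the maximal curl. -/
def HasCurlZero {Ω : Opens E3} {P : Measure Λ} (u c : FieldL2 Ω P) : Prop :=
  ∀ w cw : FieldL2 Ω P, HasWeakCurl w cw → ⟪c, w⟫ = ⟪u, cw⟫

/-- The graph of the Maxwell operator `(E, H) ↦ (curl H, -curl E)`, with `γ ∧ E = 0`. -/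
def maxwellRel (Ω : Opens E3) (P : Measure Λ) : Set (FieldPair Ω P × FieldPair Ω P) :=
  {p | HasWeakCurl p.1.snd p.2.fst ∧ HasCurlZero p.1.fst (-p.2.snd)}

variable {Ω : Opens E3} {P : Measure Λ} [IsProbabilityMeasure P]

theorem HasCurlZero.hasWeakCurl (hΩ : Bornology.IsBounded (Ω : Set E3)) {u c : FieldL2 Ω P}
    (h : HasCurlZero u c) : HasWeakCurl u c :=
  (hasWeakCurl_iff hΩ u c).2 fun φ g => (h _ _ (hasWeakCurl_tensorField hΩ φ g)).symm

theorem hasZeroTangentialTrace_iff (hΩ : Bornology.IsBounded (Ω : Set E3)) {u : FieldL2 Ω P} :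
    HasZeroTangentialTrace u ↔ ∃ c, HasCurlZero u c := by
  constructor
  · rintro ⟨c, -, h⟩
    exact ⟨c, fun w cw hw => sub_eq_zero.1 (h w cw hw)⟩
  · rintro ⟨c, h⟩
    exact ⟨c, h.hasWeakCurl hΩ, fun w cw hw => sub_eq_zero.2 (h w cw hw)⟩

theorem isSkewAdjointRel_maxwellRel (hΩ : Bornology.IsBounded (Ω : Set E3)) :
    IsSkewAdjointRel (maxwellRel Ω P) := by
  have hzero : HasWeakCurl (0 : FieldL2 Ω P) 0 := by
    rw [hasWeakCurl_iff hΩ]; simp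
  have hzero' : HasCurlZero (0 : FieldL2 Ω P) 0 := fun w cw _ => by simp
  have hinner : ∀ a b : FieldPair Ω P, ⟪a, b⟫ = ⟪a.fst, b.fst⟫ + ⟪a.snd, b.snd⟫ := fun a b =>
    WithLp.prod_inner_apply a b
  intro x y
  constructor
  · rintro ⟨h1, h2⟩ ⟨x', y'⟩ ⟨h1', h2'⟩
    have h3 := h2' _ _ h1
    have h4 := h2 _ _ h1'
    dsimp only at h3 h4 ⊢
    rw [hinner, hinner]
    rw [inner_neg_left] at h3 h4
    rw [real_inner_comm] at h3
    rw [real_inner_comm (y.fst)] at h3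
    linarith
  · intro h
    constructor
    · rw [hasWeakCurl_iff hΩ]
      intro φ g
      have hmem : ((WithLp.toLp 2 (tensorField hΩ φ.continuous g, 0) : FieldPair Ω P),
          (WithLp.toLp 2 (0, -tensorField hΩ (continuous_curl (testField_contDiff_one φ)) g) :
            FieldPair Ω P)) ∈ maxwellRel Ω P := by
        refine ⟨hzero, fun w cw hw => ?_⟩
        have := (hasWeakCurl_iff hΩ w cw).1 hw φ g
        dsimp only [WithLp.toLp_snd, WithLp.toLp_fst]
        rw [neg_neg, real_inner_comm, this, real_inner_comm]
      have h1 := h _ hmem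
      simp only [hinner, WithLp.toLp_snd, WithLp.toLp_fst, inner_zero_right, inner_neg_right,
        add_zero, zero_add] at h1
      dsimp only
      linarith
    · intro w cw hw
      have hmem : ((WithLp.toLp 2 (0, w) : FieldPair Ω P),
          (WithLp.toLp 2 (cw, 0) : FieldPair Ω P)) ∈ maxwellRel Ω P := by
        refine ⟨hw, ?_⟩
        simpa using hzero'
      have h1 := h _ hmem
      simp only [hinner, WithLp.toLp_snd, WithLp.toLp_fst, inner_zero_right,
        add_zero, zero_add] at h1
      dsimp only
      rw [inner_neg_left]
      linarith

end Maxwell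

end StochMaxwell

/-! ### Oscillating coefficients -/

namespace StochMaxwell

/-- A property that is closed in the parameter and holds, for each parameter, almost everywhere
holds almost everywhere for all parameters. -/
theorem ae_forall_of_isClosed {K W : Type*} [TopologicalSpace K] [SeparableSpace K]
    [MeasurableSpace W] {ν : Measure W} {p : K → W → Prop}
    (hcl : ∀ᵐ w ∂ν, IsClosed {k | p k w}) (h : ∀ k, ∀ᵐ w ∂ν, p k w) : ∀ᵐ w ∂ν, ∀ k, p k w := by
  obtain ⟨D, hD, hD'⟩ := exists_countable_dense K
  have h1 : ∀ᵐ w ∂ν, ∀ k ∈ D, p k w := (ae_ball_iff hD).2 fun k _ => h k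
  filter_upwards [hcl, h1] with w hw1 hw2 k
  have h2 : closure D ⊆ {k | p k w} := closure_minimal hw2 hw1
  exact h2 (hD' k)

theorem nullMeasurable_prodMk {S α β : Type*} [MeasurableSpace S]
    [MeasurableSpace α] [MeasurableSpace β] {m : Measure S} {f : S → α} {g : S → β}
    (hf : NullMeasurable f m) (hg : NullMeasurable g m) :
    NullMeasurable (fun s => (f s, g s)) m :=
  Measurable.prodMk (α := NullMeasurableSpace S m) hf.measurable' hg.measurable'

/-- A Carathéodory function, composed with a null-measurable map that pulls null sets back to null
sets, is almost everywhere measurable. -/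
theorem aemeasurable_caratheodory_comp {Y W S β : Type*} [TopologicalSpace Y] [MetrizableSpace Y]
    [SecondCountableTopology Y] [MeasurableSpace Y] [BorelSpace Y] [MeasurableSpace W]
    [MeasurableSpace S] [NormedAddCommGroup β] [SecondCountableTopology β] [MeasurableSpace β]
    [BorelSpace β] {ν : Measure W} {m : Measure S} {K : Set Y} (hK : IsClosed K)
    (hKne : K.Nonempty) {h : Y → W → β} (hm : ∀ y ∈ K, AEMeasurable (h y) ν)
    (hc : ∀ᵐ w ∂ν, ContinuousOn (fun y => h y w) K) {κ : S → W} (hκ : NullMeasurable κ m)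
    (hκ' : ∀ R : W → Prop, (∀ᵐ w ∂ν, R w) → ∀ᵐ s ∂m, R (κ s)) {y : S → Y}
    (hy : AEMeasurable y m) (hyK : ∀ᵐ s ∂m, y s ∈ K) :
    AEMeasurable (fun s => h (y s) (κ s)) m := by
  classical
  obtain ⟨k₀, hk₀⟩ := hKne
  have : Nonempty K := ⟨⟨k₀, hk₀⟩⟩
  set d : ℕ → K := denseSeq K
  -- outside of a measurable null set `h` agrees with measurable functions on a dense sequence
  have hgood : ∀ᵐ w ∂ν, ContinuousOn (fun y => h y w) K ∧
      ∀ n, h (d n) w = (hm (d n) (d n).2).mk _ w := by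
    filter_upwards [hc, ae_all_iff.2 fun n => (hm (d n) (d n).2).ae_eq_mk] with w h1 h2
    exact ⟨h1, h2⟩
  set N : Set W := toMeasurable ν {w | ¬ (ContinuousOn (fun y => h y w) K ∧
      ∀ n, h (d n) w = (hm (d n) (d n).2).mk _ w)} with hN
  have hNm : MeasurableSet N := measurableSet_toMeasurable _ _
  have hN0 : ν N = 0 := by rw [hN, measure_toMeasurable]; exact hgood
  have hNgood : ∀ w, w ∉ N → ContinuousOn (fun y => h y w) K ∧
      ∀ n, h (d n) w = (hm (d n) (d n).2).mk _ w := fun w hw =>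
    by_contra fun hcon => hw (subset_toMeasurable _ _ hcon)
  let H : K → W → β := fun k w => if w ∈ N then 0 else h k w
  have hHc : ∀ w, Continuous fun k => H k w := fun w => by
    by_cases hw : w ∈ N
    · simp only [H, hw, if_true]; exact continuous_const
    · simp only [H, hw, if_false]
      exact continuousOn_iff_continuous_domRestrict.1 (hNgood w hw).1
  have hHd : ∀ n, Measurable (H (d n)) := fun n => by
    have : H (d n) = fun w => if w ∈ N then 0 else (hm (d n) (d n).2).mk _ w := by
      funext w
      by_cases hw : w ∈ N
      · simp [H, hw]
      · simp only [H, hw, if_false]; exact (hNgood w hw).2 n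
    rw [this]
    exact Measurable.ite hNm measurable_const (hm (d n) (d n).2).measurable_mk
  have hHm : ∀ k, Measurable (H k) := fun k => by
    obtain ⟨x, hx, hxk⟩ := mem_closure_iff_seq_limit.1 (denseRange_denseSeq K k)
    refine measurable_of_tendsto_metrizable (f := fun n => H (x n)) (fun n => ?_)
      (tendsto_pi_nhds.2 fun w => ((hHc w).tendsto k).comp hxk)
    obtain ⟨j, hj⟩ := hx n
    rw [← hj]
    exact hHd j
  have hH : Measurable (Function.uncurry H) := measurable_uncurry_of_continuous_of_measurable hHc hHm
  let y' : S → Y := fun s => if hy.mk y s ∈ K then hy.mk y s else k₀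
  have hy'm : Measurable y' :=
    Measurable.ite (hy.measurable_mk hK.measurableSet) hy.measurable_mk measurable_const
  have hy'K : ∀ s, y' s ∈ K := fun s => by
    by_cases hs : hy.mk y s ∈ K <;> simp [y', hs, hk₀]
  have hyy' : ∀ᵐ s ∂m, y' s = y s := by
    filter_upwards [hy.ae_eq_mk, hyK] with s h1 h2
    rw [h1] at h2
    simp only [y', h2, if_true, h1]
  have hnull : NullMeasurable (fun s => H ⟨y' s, hy'K s⟩ (κ s)) m := by
    have h1 : NullMeasurable (fun s => (⟨y' s, hy'K s⟩ : K)) m :=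
      (hy'm.subtype_mk).nullMeasurable
    exact hH.comp (nullMeasurable_prodMk h1 hκ).measurable'
  refine hnull.aemeasurable.congr ?_
  have h3 : ∀ᵐ w ∂ν, w ∉ N := measure_eq_zero_iff_ae_notMem.1 hN0
  filter_upwards [hκ' _ h3, hyy'] with s h4 h5
  simp only [H, h4, if_false, h5]

/-- Joint measurability for the completed `σ`-algebra in the first variable suffices for a
composition with a quasi-measure-preserving map in that variable. -/
theorem nullMeasurable_comp₂ {S α β γ : Type*} [MeasurableSpace S] [MeasurableSpace α]
    [MeasurableSpace β] [MeasurableSpace γ] {m : Measure S} {ν : Measure α} {F : α → β → γ}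
    (hF : Measurable fun p : NullMeasurableSpace α ν × β => F p.1 p.2) {f : S → α} {g : S → β}
    (hf : Measure.QuasiMeasurePreserving f m ν) (hg : NullMeasurable g m) :
    NullMeasurable (fun s => F (f s) (g s)) m := by
  have h1 : @Measurable (NullMeasurableSpace S m) (NullMeasurableSpace α ν) _ _ f :=
    fun s hs => NullMeasurableSet.preimage (μb := ν) hs hf
  have h2 : @Measurable (NullMeasurableSpace S m) (NullMeasurableSpace α ν × β) _ _
      fun s => (f s, g s) := Measurable.prodMk (α := NullMeasurableSpace S m) h1 hg.measurable'
  exact hF.comp h2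

section Trajectory

variable {Λ : Type*} [MeasurableSpace Λ] {P : Measure Λ} [IsProbabilityMeasure P]
  {τ : E3 → Λ → Λ}

theorem quasiMeasurePreserving_smul {r : ℝ} (hr : r ≠ 0) :
    Measure.QuasiMeasurePreserving (fun x : E3 => r • x) volume volume :=
  ⟨measurable_const_smul r, Measure.AbsolutelyContinuous.mk fun s hs h0 => by
    rw [Measure.map_apply (measurable_const_smul r) hs, Measure.addHaar_preimage_smul _ hr, h0,
      mul_zero]⟩

omit [IsProbabilityMeasure P] in
theorem quasiMeasurePreserving_smul_fst (Ω : Opens E3) {r : ℝ} (hr : r ≠ 0) :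
    Measure.QuasiMeasurePreserving (fun p : E3 × Λ => r • p.1) (domMeasure Ω P) volume :=
  ((quasiMeasurePreserving_smul hr).mono_left Measure.restrict_le_self.absolutelyContinuous).comp
    Measure.quasiMeasurePreserving_fst

/-- The map `(x, ω) ↦ (τ(x/ε)ω, x/ε²)` along which the coefficients are evaluated. -/
noncomputable def fastPoint (τ : E3 → Λ → Λ) (ε : ℝ) (p : E3 × Λ) : Λ × E3 :=
  (τ (ε⁻¹ • p.1) p.2, (ε ^ 2)⁻¹ • p.1)

omit [IsProbabilityMeasure P] in
theorem nullMeasurable_fastPoint (hτ : IsDynamicalSystem P τ) (Ω : Opens E3) {ε : ℝ} (hε : 0 < ε) :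
    NullMeasurable (fastPoint τ ε) (domMeasure Ω P) := by
  have h1 : Measurable fun p : E3 × Λ => (ε ^ 2)⁻¹ • p.1 :=
    (measurable_const_smul _).comp measurable_fst
  have h2 : NullMeasurable (fun p : E3 × Λ => p.2) (domMeasure Ω P) := measurable_snd.nullMeasurable
  exact nullMeasurable_prodMk (nullMeasurable_comp₂ (F := τ) hτ.measurable
    (quasiMeasurePreserving_smul_fst (P := P) Ω (inv_ne_zero hε.ne')) h2) h1.nullMeasurable

/-- Since `τ` preserves the probability, null sets of `Λ × ℝ³` are pulled back to null sets. -/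
theorem ae_fastPoint (hτ : IsDynamicalSystem P τ) (Ω : Opens E3) {ε : ℝ} (hε : 0 < ε)
    (R : Λ × E3 → Prop) (hR : ∀ᵐ q ∂(P.prod (volume : Measure E3)), R q) :
    ∀ᵐ p ∂(domMeasure Ω P), R (fastPoint τ ε p) := by
  set N := toMeasurable (P.prod (volume : Measure E3)) {q | ¬ R q} with hN
  have hNm : MeasurableSet N := measurableSet_toMeasurable _ _
  have hN0 : P.prod (volume : Measure E3) N = 0 := by rw [hN, measure_toMeasurable]; exact hR
  obtain ⟨Z, hZsub, hZm, hZeq⟩ :=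
    (nullMeasurable_fastPoint hτ Ω hε hNm).exists_measurable_subset_ae_eq
  have hsec : ∀ᵐ z : E3, P {ω | (ω, z) ∈ N} = 0 := by
    have h1 : (volume : Measure E3).prod P (Prod.swap ⁻¹' N) = 0 := by
      rw [(Measure.measurePreserving_swap (μ := (volume : Measure E3)) (ν := P)).measure_preimage
        hNm.nullMeasurableSet, hN0]
    exact (Measure.measure_prod_null (measurable_swap hNm)).1 h1
  have hZ0 : domMeasure Ω P Z = 0 := by
    rw [Measure.measure_prod_null hZm]
    have h1 : ∀ᵐ x : E3, P {ω | (ω, (ε ^ 2)⁻¹ • x) ∈ N} = 0 :=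
      (quasiMeasurePreserving_smul (inv_ne_zero (pow_ne_zero 2 hε.ne'))).ae hsec
    filter_upwards [ae_restrict_of_ae h1] with x hx
    have h2 : Prod.mk x ⁻¹' Z ⊆ τ (ε⁻¹ • x) ⁻¹' {ω | (ω, (ε ^ 2)⁻¹ • x) ∈ N} := fun ω hω =>
      hZsub hω
    have h3 : MeasurableSet {ω | (ω, (ε ^ 2)⁻¹ • x) ∈ N} := measurable_prodMk_right hNm
    refine measure_mono_null h2 ?_
    rw [(hτ.measurePreserving _).measure_preimage h3.nullMeasurableSet]
    exact hx
  have h1 : domMeasure Ω P (fastPoint τ ε ⁻¹' N) = 0 := by rw [← measure_congr hZeq, hZ0]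
  refine measure_mono_null (fun p hp => ?_) h1
  exact subset_toMeasurable _ _ hp

variable {Ω : Opens E3} {ε : ℝ}

/-- A property of the coefficients that is closed in `x` and in further parameters, and holds almost
everywhere in `(ω, z)` at each value of these, holds along `(x, τ(x/ε)ω, x/ε²)`. -/
theorem ae_fastPoint_of_isClosed (hτ : IsDynamicalSystem P τ) (hε : 0 < ε) {Y : Type*}
    [TopologicalSpace Y] [SeparableSpace Y] (R : E3 → Y → Λ → E3 → Prop)
    (hcl : ∀ᵐ q ∂(P.prod (volume : Measure E3)),
      IsClosed {k : closure (Ω : Set E3) × Y | R k.1 k.2 q.1 q.2})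
    (h : ∀ x ∈ closure (Ω : Set E3), ∀ y, ∀ᵐ q ∂(P.prod (volume : Measure E3)), R x y q.1 q.2) :
    ∀ᵐ p ∂(domMeasure Ω P), ∀ y, R p.1 y (τ (ε⁻¹ • p.1) p.2) ((ε ^ 2)⁻¹ • p.1) := by
  have h1 : ∀ᵐ q ∂(P.prod (volume : Measure E3)), ∀ k : closure (Ω : Set E3) × Y,
      R k.1 k.2 q.1 q.2 := ae_forall_of_isClosed hcl fun k => h k.1 k.1.2 k.2
  filter_upwards [ae_fastPoint hτ Ω hε (fun q => ∀ k : closure (Ω : Set E3) × Y,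
    R k.1 k.2 q.1 q.2) h1, ae_domMeasure_fst_mem (Ω := Ω) (P := P)] with p h2 h3 y
  exact h2 (⟨p.1, subset_closure h3⟩, y)

/-- The operator of multiplication by an oscillating material tensor. -/
theorem IsMaterialTensor.exists_mulOperator {a : E3 → Λ → E3 → Matrix (Fin 3) (Fin 3) ℝ}
    (ha : IsMaterialTensor Ω P a) (hτ : IsDynamicalSystem P τ) (hΩ : (Ω : Set E3).Nonempty)
    (hε : 0 < ε) : ∃ (L : FieldL2 Ω P →L[ℝ] FieldL2 Ω P) (c : ℝ),
      (∀ u, ∀ᵐ p ∂(domMeasure Ω P), L u p = Matrix.toEuclideanLin (osc τ ε a p) (u p)) ∧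
      (∀ u v, ⟪L u, v⟫ = ⟪u, L v⟫) ∧ 0 < c ∧ ∀ u, c * ‖u‖ ^ 2 ≤ ⟪L u, u⟫ := by
  obtain ⟨C, hC, hCb⟩ := ha.bounded
  obtain ⟨c, hc, hcb⟩ := ha.coercive
  have hmem : ∀ᵐ p ∂(domMeasure Ω P), p.1 ∈ closure (Ω : Set E3) := by
    filter_upwards [ae_domMeasure_fst_mem (Ω := Ω) (P := P)] with p hp
    exact subset_closure hp
  have hcont : ∀ᵐ q ∂(P.prod (volume : Measure E3)), ∀ i j,
      Continuous fun x : closure (Ω : Set E3) => a x q.1 q.2 i j := by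
    filter_upwards [ha.continuous_repr] with q hq i j
    exact continuousOn_iff_continuous_domRestrict.1 (hq i j)
  have hcontLin : ∀ᵐ q ∂(P.prod (volume : Measure E3)),
      Continuous fun k : closure (Ω : Set E3) × E3 =>
        Matrix.toEuclideanLin (a k.1 q.1 q.2) k.2 := by
    filter_upwards [hcont] with q hq
    refine (PiLp.continuous_toLp 2 _).comp (continuous_pi fun i => ?_)
    change Continuous fun k : closure (Ω : Set E3) × E3 => ∑ j, a k.1 q.1 q.2 i j * k.2 j
    refine continuous_finsetSum _ fun j _ => ?_
    have e1 : Continuous fun k : closure (Ω : Set E3) × E3 => a k.1 q.1 q.2 i j :=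
      (hq i j).comp (f := fun k : closure (Ω : Set E3) × E3 => k.1) continuous_fst
    have e2 : Continuous fun k : closure (Ω : Set E3) × E3 => k.2 j := by fun_prop
    exact e1.mul e2
  have hbound : ∀ᵐ p ∂(domMeasure Ω P), ∀ l : E3,
      ‖Matrix.toEuclideanLin (osc τ ε a p) l‖ ≤ C * ‖l‖ := by
    have h1 := ae_fastPoint_of_isClosed (Ω := Ω) hτ hε
      (fun x l ω z => ‖Matrix.toEuclideanLin (a x ω z) l‖ ≤ C * ‖l‖) ?_ fun x hx l => ?_
    · exact h1
    · filter_upwards [hcontLin] with q hq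
      exact isClosed_le hq.norm (continuous_const.mul continuous_snd.norm)
    · filter_upwards [hCb x hx] with q hq using hq l
  have hcoer : ∀ᵐ p ∂(domMeasure Ω P), ∀ l : E3,
      c * ‖l‖ ^ 2 ≤ ⟪Matrix.toEuclideanLin (osc τ ε a p) l, l⟫ := by
    have h1 := ae_fastPoint_of_isClosed (Ω := Ω) hτ hε
      (fun x l ω z => c * ‖l‖ ^ 2 ≤ ⟪Matrix.toEuclideanLin (a x ω z) l, l⟫) ?_ fun x hx l => ?_
    · exact h1
    · filter_upwards [hcontLin] with q hq
      exact isClosed_le (continuous_const.mul (continuous_snd.norm.pow 2))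
        (hq.inner continuous_snd)
    · filter_upwards [hcb x hx] with q hq using hq l
  have hsymm : ∀ᵐ p ∂(domMeasure Ω P), ∀ i j, osc τ ε a p i j = osc τ ε a p j i := by
    refine ae_all_iff.2 fun i => ae_all_iff.2 fun j => ?_
    have h1 := ae_fastPoint_of_isClosed (Ω := Ω) hτ hε (Y := Unit)
      (fun x _ ω z => a x ω z i j = a x ω z j i) ?_ fun x hx _ => ?_
    · filter_upwards [h1] with p hp using hp ()
    · filter_upwards [hcont] with q hq
      exact isClosed_eq ((hq i j).comp continuous_fst) ((hq j i).comp continuous_fst)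
    · filter_upwards [ha.symm x hx] with q hq using hq i j
  have hmeas : ∀ i j, AEMeasurable (fun p => osc τ ε a p i j) (domMeasure Ω P) := fun i j =>
    aemeasurable_caratheodory_comp (K := closure (Ω : Set E3)) isClosed_closure hΩ.closure
      (ν := P.prod volume) (κ := fastPoint τ ε) (h := fun x (q : Λ × E3) => a x q.1 q.2 i j) (fun x hx => ha.aemeasurable x hx i j)
      (by filter_upwards [ha.continuous_repr] with q hq using hq i j)
      (nullMeasurable_fastPoint hτ Ω hε) (ae_fastPoint hτ Ω hε) (y := fun p => p.1)
      measurable_fst.aemeasurable hmem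
  have hmemLp : ∀ u : FieldL2 Ω P,
      MemLp (fun p => Matrix.toEuclideanLin (osc τ ε a p) (u p)) 2 (domMeasure Ω P) := fun u => by
    refine MemLp.of_le_mul (Lp.memLp u) (c := C) (AEMeasurable.aestronglyMeasurable ?_) ?_
    · have h1 : AEMeasurable (fun p => (osc τ ε a p).mulVec (u p)) (domMeasure Ω P) := by
        refine aemeasurable_pi_lambda _ fun i => ?_
        simp only [Matrix.mulVec, dotProduct]
        refine Finset.aemeasurable_fun_sum _ fun j _ => (hmeas i j).mul ?_
        exact (EuclideanSpace.proj (𝕜 := ℝ) j).continuous.measurable.comp_aemeasurable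
          (Lp.aestronglyMeasurable u).aemeasurable
      exact (PiLp.continuous_toLp 2 _).measurable.comp_aemeasurable h1
    · filter_upwards [hbound] with p hp using hp _
  let L : FieldL2 Ω P →L[ℝ] FieldL2 Ω P := LinearMap.mkContinuous
    { toFun := fun u => (hmemLp u).toLp _
      map_add' := fun u v => by
        rw [← MemLp.toLp_add]
        refine MemLp.toLp_congr _ _ ?_
        filter_upwards [Lp.coeFn_add u v] with p hp
        rw [hp, Pi.add_apply, map_add]; rfl
      map_smul' := fun r u => by
        rw [RingHom.id_apply, ← MemLp.toLp_const_smul]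
        refine MemLp.toLp_congr _ _ ?_
        filter_upwards [Lp.coeFn_smul r u] with p hp
        rw [hp, Pi.smul_apply, map_smul]; rfl }
    C fun u => by
      refine Lp.norm_le_mul_norm_of_ae_le_mul ?_
      filter_upwards [(hmemLp u).coeFn_toLp, hbound] with p h1 h2
      change ‖(hmemLp u).toLp _ p‖ ≤ _
      rw [h1]
      exact h2 _
  have hL : ∀ u, ∀ᵐ p ∂(domMeasure Ω P), L u p = Matrix.toEuclideanLin (osc τ ε a p) (u p) :=
    fun u => (hmemLp u).coeFn_toLp
  refine ⟨L, c, hL, fun u v => ?_, hc, fun u => ?_⟩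
  · rw [L2.inner_def, L2.inner_def]
    refine integral_congr_ae ?_
    filter_upwards [hL u, hL v, hsymm] with p h1 h2 h3
    have hH : (osc τ ε a p).IsHermitian := by
      ext i j
      simp [Matrix.conjTranspose_apply, h3 i j]
    rw [h1, h2]
    exact (Matrix.isSymmetric_toEuclideanLin_iff.2 hH) (u p) (v p)
  · rw [← real_inner_self_eq_norm_sq, L2.inner_def, L2.inner_def, ← integral_const_mul]
    refine integral_mono_ae ((L2.integrable_inner u u).const_mul c) (L2.integrable_inner _ _) ?_
    filter_upwards [hL u, hcoer] with p h1 h2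
    rw [h1, real_inner_self_eq_norm_sq]
    exact h2 _

/-- The superposition operator of an oscillating conductivity. -/
theorem IsConductivity.exists_superposition {σ : E3 → Λ → E3 → E3 → E3}
    (hσ : IsConductivity Ω P σ) (hτ : IsDynamicalSystem P τ) (hΩ : (Ω : Set E3).Nonempty)
    (hε : 0 < ε) : ∃ (S : FieldL2 Ω P → FieldL2 Ω P) (K : NNReal), LipschitzWith K S ∧ S 0 = 0 ∧
      (∀ u v, 0 ≤ ⟪S u - S v, u - v⟫) ∧
      ∀ u, ∀ᵐ p ∂(domMeasure Ω P), S u p = osc τ ε σ p (u p) := by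
  obtain ⟨C, hC, hCb⟩ := hσ.lipschitz
  obtain ⟨δ, hδ, hδb⟩ := hσ.monotone
  have hmem : ∀ᵐ p ∂(domMeasure Ω P), p.1 ∈ closure (Ω : Set E3) := by
    filter_upwards [ae_domMeasure_fst_mem (Ω := Ω) (P := P)] with p hp
    exact subset_closure hp
  have hcont : ∀ᵐ q ∂(P.prod (volume : Measure E3)),
      Continuous fun k : closure (Ω : Set E3) × E3 => σ k.1 q.1 q.2 k.2 := by
    filter_upwards [hσ.continuous] with q hq
    exact hq.comp_continuous (f := fun k : closure (Ω : Set E3) × E3 => ((k.1 : E3), k.2))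
      (by fun_prop) fun k => ⟨k.1.2, mem_univ _⟩
  have hcont₂ : ∀ᵐ q ∂(P.prod (volume : Measure E3)),
      Continuous fun k : closure (Ω : Set E3) × E3 × E3 =>
        σ k.1 q.1 q.2 k.2.1 - σ k.1 q.1 q.2 k.2.2 := by
    filter_upwards [hcont] with q hq
    have e1 : Continuous fun k : closure (Ω : Set E3) × E3 × E3 => σ k.1 q.1 q.2 k.2.1 :=
      hq.comp (f := fun k : closure (Ω : Set E3) × E3 × E3 => (k.1, k.2.1)) (by fun_prop)
    have e2 : Continuous fun k : closure (Ω : Set E3) × E3 × E3 => σ k.1 q.1 q.2 k.2.2 :=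
      hq.comp (f := fun k : closure (Ω : Set E3) × E3 × E3 => (k.1, k.2.2)) (by fun_prop)
    exact e1.sub e2
  have hlip : ∀ᵐ p ∂(domMeasure Ω P), ∀ k : E3 × E3,
      ‖osc τ ε σ p k.1 - osc τ ε σ p k.2‖ ≤ C * ‖k.1 - k.2‖ := by
    have h1 := ae_fastPoint_of_isClosed (Ω := Ω) hτ hε (Y := E3 × E3)
      (fun x k ω z => ‖σ x ω z k.1 - σ x ω z k.2‖ ≤ C * ‖k.1 - k.2‖) ?_
      fun x hx k => hCb x hx k.1 k.2
    · exact h1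
    · filter_upwards [hcont₂] with q hq
      have e : Continuous fun k : closure (Ω : Set E3) × E3 × E3 => C * ‖k.2.1 - k.2.2‖ := by
        fun_prop
      exact isClosed_le hq.norm e
  have hmono : ∀ᵐ p ∂(domMeasure Ω P), ∀ k : E3 × E3,
      δ * ‖k.1 - k.2‖ ^ 2 ≤ ⟪osc τ ε σ p k.1 - osc τ ε σ p k.2, k.1 - k.2⟫ := by
    have h1 := ae_fastPoint_of_isClosed (Ω := Ω) hτ hε (Y := E3 × E3)
      (fun x k ω z => δ * ‖k.1 - k.2‖ ^ 2 ≤ ⟪σ x ω z k.1 - σ x ω z k.2, k.1 - k.2⟫) ?_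
      fun x hx k => hδb x hx k.1 k.2
    · exact h1
    · filter_upwards [hcont₂] with q hq
      have e : Continuous fun k : closure (Ω : Set E3) × E3 × E3 => k.2.1 - k.2.2 := by fun_prop
      exact isClosed_le (continuous_const.mul (e.norm.pow 2)) (hq.inner e)
  have hzero : ∀ᵐ p ∂(domMeasure Ω P), osc τ ε σ p 0 = 0 := by
    have h1 := ae_fastPoint_of_isClosed (Ω := Ω) hτ hε (Y := Unit)
      (fun x _ ω z => σ x ω z 0 = 0) ?_ fun x hx _ => hσ.zero x hx
    · filter_upwards [h1] with p hp using hp ()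
    · filter_upwards [hcont] with q hq
      have e1 : Continuous fun k : closure (Ω : Set E3) × Unit => σ k.1 q.1 q.2 0 :=
        hq.comp (f := fun k : closure (Ω : Set E3) × Unit => (k.1, (0 : E3))) (by fun_prop)
      exact isClosed_eq e1 continuous_const
  have hmeas : ∀ u : FieldL2 Ω P,
      AEMeasurable (fun p => osc τ ε σ p (u p)) (domMeasure Ω P) := fun u =>
    aemeasurable_caratheodory_comp (K := closure (Ω : Set E3) ×ˢ (univ : Set E3))
      (isClosed_closure.prod isClosed_univ) (hΩ.closure.prod univ_nonempty)
      (ν := P.prod volume) (κ := fastPoint τ ε)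
      (h := fun k (q : Λ × E3) => σ k.1 q.1 q.2 k.2) (fun k hk => hσ.aemeasurable k.1 hk.1 k.2)
      hσ.continuous (nullMeasurable_fastPoint hτ Ω hε) (ae_fastPoint hτ Ω hε)
      (y := fun p => (p.1, u p))
      (measurable_fst.aemeasurable.prodMk (Lp.aestronglyMeasurable u).aemeasurable)
      (by filter_upwards [hmem] with p hp using ⟨hp, mem_univ _⟩)
  have hmemLp : ∀ u : FieldL2 Ω P, MemLp (fun p => osc τ ε σ p (u p)) 2 (domMeasure Ω P) :=
    fun u => by
      refine MemLp.of_le_mul (Lp.memLp u) (c := C) (hmeas u).aestronglyMeasurable ?_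
      filter_upwards [hlip, hzero] with p h1 h2
      simpa [h2] using h1 (u p, 0)
  have hS : ∀ u, ∀ᵐ p ∂(domMeasure Ω P), (hmemLp u).toLp _ p = osc τ ε σ p (u p) :=
    fun u => (hmemLp u).coeFn_toLp
  refine ⟨fun u => (hmemLp u).toLp _, ⟨C, hC.le⟩, LipschitzWith.of_dist_le_mul fun u v => ?_,
    ?_, fun u v => ?_, hS⟩
  · rw [dist_eq_norm, dist_eq_norm]
    refine Lp.norm_le_mul_norm_of_ae_le_mul ?_
    filter_upwards [hS u, hS v, hlip, Lp.coeFn_sub u v,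
      Lp.coeFn_sub ((hmemLp u).toLp _) ((hmemLp v).toLp _)] with p h1 h2 h3 h4 h5
    rw [h4, h5, Pi.sub_apply, Pi.sub_apply, h1, h2]
    exact h3 (u p, v p)
  · refine Lp.ext ?_
    filter_upwards [hS 0, hzero, Lp.coeFn_zero E3 2 (domMeasure Ω P)] with p h1 h2 h3
    rw [h1, h3]
    exact h2
  · rw [L2.inner_def]
    refine integral_nonneg_of_ae ?_
    filter_upwards [hS u, hS v, hmono, Lp.coeFn_sub u v,
      Lp.coeFn_sub ((hmemLp u).toLp _) ((hmemLp v).toLp _)] with p h1 h2 h3 h4 h5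
    rw [h4, h5, Pi.sub_apply, Pi.sub_apply, h1, h2]
    exact le_trans (by positivity) (h3 (u p, v p))

end Trajectory

end StochMaxwell

/-! ### Uniqueness and sources for evolution equations -/

namespace StochMaxwell

theorem intervalIntegral_congr_timeMeasure {V : Type*} [NormedAddCommGroup V] [NormedSpace ℝ V]
    {T t : ℝ} (ht : t ∈ Icc 0 T) {f g : ℝ → V} (h : ∀ᵐ s ∂(timeMeasure T), f s = g s) :
    ∫ s in (0 : ℝ)..t, f s = ∫ s in (0 : ℝ)..t, g s := by
  rw [intervalIntegral.integral_of_le ht.1, intervalIntegral.integral_of_le ht.1,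
    integral_Ioc_eq_integral_Ioo, integral_Ioc_eq_integral_Ioo]
  exact integral_congr_ae (ae_mono (Measure.restrict_mono (Ioo_subset_Ioo_right ht.2) le_rfl) h)

theorem ae_mem_Icc_timeMeasure (T : ℝ) : ∀ᵐ t ∂(timeMeasure T), t ∈ Icc 0 T :=
  ae_timeMeasure_of_Icc fun _ ht => ht

/-- Solutions of `M u' = A u + S u + f` with the same initial value agree: the energy of the
difference does not increase. -/
theorem IsEvolutionData.ae_eq_of_primitive {X : Type*} [NormedAddCommGroup X]
    [InnerProductSpace ℝ X] [CompleteSpace X] {A : Set (X × X)} {M : X →L[ℝ] X} {S : X → X}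
    {f : ℝ → X} {c : ℝ} {K L : NNReal} (h : IsEvolutionData A M S f c K L) {T : ℝ} (hT : 0 ≤ T)
    {u₁ u₂ Y₁ Y₂ : ℝ → X} {u₀ : X} {V₁ V₂ : TimeL2 T X}
    (hu₁ : ∀ᵐ t ∂(timeMeasure T), u₁ t = u₀ + ∫ s in (0 : ℝ)..t, V₁ s)
    (hu₂ : ∀ᵐ t ∂(timeMeasure T), u₂ t = u₀ + ∫ s in (0 : ℝ)..t, V₂ s)
    (hA₁ : ∀ᵐ t ∂(timeMeasure T), (u₁ t, Y₁ t) ∈ A)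
    (hA₂ : ∀ᵐ t ∂(timeMeasure T), (u₂ t, Y₂ t) ∈ A)
    (he₁ : ∀ᵐ t ∂(timeMeasure T), M (V₁ t) = Y₁ t + S (u₁ t) + f t)
    (he₂ : ∀ᵐ t ∂(timeMeasure T), M (V₂ t) = Y₂ t + S (u₂ t) + f t) :
    ∀ᵐ t ∂(timeMeasure T), u₁ t = u₂ t := by
  have hint : ∀ t ∈ Icc 0 T, ∫ s in (0 : ℝ)..t, (V₁ - V₂) s =
      (∫ s in (0 : ℝ)..t, V₁ s) - ∫ s in (0 : ℝ)..t, V₂ s := fun t ht => by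
    have h0 : (0 : ℝ) ∈ Icc 0 T := ⟨le_rfl, hT⟩
    rw [← intervalIntegral.integral_sub (timeL2_intervalIntegrable_of_mem V₁ h0 ht)
      (timeL2_intervalIntegrable_of_mem V₂ h0 ht)]
    exact intervalIntegral_congr_timeMeasure ht (Lp.coeFn_sub V₁ V₂)
  have hdiff : ∀ᵐ t ∂(timeMeasure T), ∫ s in (0 : ℝ)..t, (V₁ - V₂) s = u₁ t - u₂ t := by
    filter_upwards [hu₁, hu₂, ae_mem_Icc_timeMeasure T] with t h1 h2 h3
    rw [hint t h3, h1, h2]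
    abel
  have hpow : ∀ᵐ t ∂(timeMeasure T),
      ⟪M ((V₁ - V₂) t), ∫ s in (0 : ℝ)..t, (V₁ - V₂) s⟫ ≤ 0 := by
    filter_upwards [hdiff, hA₁, hA₂, he₁, he₂, Lp.coeFn_sub V₁ V₂] with t h1 h2 h3 h4 h5 h6
    have h7 := h.skew.inner_eq_zero (h.skew.sub_mem h2 h3)
    have h8 := h.dissipative (u₁ t) (u₂ t)
    have h9 : M (V₁ t) - M (V₂ t) = (Y₁ t - Y₂ t) + (S (u₁ t) - S (u₂ t)) := by
      rw [h4, h5]; abel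
    rw [h1, h6, Pi.sub_apply, map_sub, h9, inner_add_left, h7, zero_add]
    exact h8
  filter_upwards [hdiff, ae_mem_Icc_timeMeasure T] with t h1 h2
  have h3 := inner_primitive_nonpos hT h.symm (V₁ - V₂) hpow h2
  rw [h1] at h3
  have h4 : c * ‖u₁ t - u₂ t‖ ^ 2 ≤ 0 := (h.coercive _).trans h3
  have h5 : ‖u₁ t - u₂ t‖ ^ 2 ≤ 0 := nonpos_of_mul_nonpos_right h4 h.pos
  exact sub_eq_zero.1 (norm_eq_zero.1 (pow_eq_zero_iff two_ne_zero |>.1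
    (le_antisymm h5 (sq_nonneg _))))

/-- A function of time whose weak derivative is bounded is Lipschitz. -/
theorem HasWeakTimeDeriv.exists_lipschitzWith {X : Type*} [NormedAddCommGroup X]
    [InnerProductSpace ℝ X] [CompleteSpace X] {T : ℝ} (hT : 0 < T) {u v : TimeL2 T X}
    (h : HasWeakTimeDeriv u v) (hv : MemLp v ⊤ (timeMeasure T)) :
    ∃ (w : ℝ → X) (K : NNReal), LipschitzWith K w ∧ ∀ᵐ t ∂(timeMeasure T), u t = w t := by
  obtain ⟨x₀, hx₀⟩ := h.exists_ae_eq_primitive hT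
  set C : NNReal := (eLpNorm v ⊤ (timeMeasure T)).toNNReal with hC
  have hbound : ∀ᵐ t, t ∈ Ioo 0 T → ‖v t‖ ≤ C := by
    refine (ae_restrict_iff' measurableSet_Ioo).1 ?_
    have h1 := ae_le_eLpNormEssSup (f := v) (μ := timeMeasure T)
    filter_upwards [h1] with t ht
    rw [← eLpNorm_exponent_top, ← ENNReal.coe_toNNReal hv.2.ne, ← hC] at ht
    exact_mod_cast ht
  let w : ℝ → X := fun t => x₀ + ∫ s in (0 : ℝ)..t, v s
  have hw : LipschitzOnWith C w (Icc 0 T) := LipschitzOnWith.of_dist_le_mul fun t ht s hs => by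
    have h0 : (0 : ℝ) ∈ Icc 0 T := ⟨le_rfl, hT.le⟩
    rw [dist_add_left, dist_eq_norm, intervalIntegral.integral_interval_sub_left
      (timeL2_intervalIntegrable_of_mem v h0 ht) (timeL2_intervalIntegrable_of_mem v h0 hs),
      Real.dist_eq]
    refine intervalIntegral.norm_integral_le_of_norm_le_const_ae ?_
    have hT' : ∀ᵐ r : ℝ, r ≠ T := by simp [ae_iff, measure_singleton]
    filter_upwards [hbound, hT'] with r hr hrT hmem
    rw [uIoc, mem_Ioc] at hmem
    refine hr ⟨(le_min hs.1 ht.1).trans_lt hmem.1, ?_⟩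
    exact lt_of_le_of_ne (hmem.2.trans (max_le hs.2 ht.2)) hrT
  refine ⟨fun t => w (projIcc 0 T hT.le t), C, ?_, ?_⟩
  · refine LipschitzWith.of_dist_le_mul fun s t => ?_
    refine (hw.dist_le_mul _ (projIcc 0 T hT.le s).2 _ (projIcc 0 T hT.le t).2).trans ?_
    gcongr
    have h1 := (LipschitzWith.projIcc hT.le).dist_le_mul s t
    rwa [NNReal.coe_one, one_mul] at h1
  · filter_upwards [hx₀, ae_mem_Icc_timeMeasure T] with t h1 h2
    rw [projIcc_of_mem hT.le h2, h1]

/-! ### The Maxwell evolution equation -/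

section Pairs

variable {V : Type*} [NormedAddCommGroup V] [InnerProductSpace ℝ V]

/-- The block diagonal operator `(x, y) ↦ (L x, L' y)` on a Hilbert sum. -/
noncomputable def blockDiag (L L' : V →L[ℝ] V) : WithLp 2 (V × V) →L[ℝ] WithLp 2 (V × V) :=
  (WithLp.prodContinuousLinearEquiv 2 ℝ V V).symm.toContinuousLinearMap ∘L
    (L.prodMap L') ∘L (WithLp.prodContinuousLinearEquiv 2 ℝ V V).toContinuousLinearMap

theorem blockDiag_apply (L L' : V →L[ℝ] V) (x : WithLp 2 (V × V)) :
    blockDiag L L' x = WithLp.toLp 2 (L x.fst, L' x.snd) := rfl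

/-- A pair of functions of time, as a function of time with values in pairs. -/
theorem exists_timeL2_pair {T : ℝ} (v v' : TimeL2 T V) : ∃ w : TimeL2 T (WithLp 2 (V × V)),
    ∀ᵐ t ∂(timeMeasure T), w t = WithLp.toLp 2 (v t, v' t) := by
  let e := (WithLp.prodContinuousLinearEquiv 2 ℝ V V).symm.toContinuousLinearMap
  let i := e ∘L ContinuousLinearMap.inl ℝ V V
  let j := e ∘L ContinuousLinearMap.inr ℝ V V
  refine ⟨i.compLp v + j.compLp v', ?_⟩
  filter_upwards [i.coeFn_compLp v, j.coeFn_compLp v', Lp.coeFn_add (i.compLp v) (j.compLp v')]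
    with t h1 h2 h3
  rw [h3, Pi.add_apply, h1, h2]
  change WithLp.toLp 2 (v t, 0) + WithLp.toLp 2 (0, v' t) = _
  rw [← WithLp.toLp_add, Prod.mk_add_mk, add_zero, zero_add]

theorem primitive_pair [CompleteSpace V] {T : ℝ} (hT : 0 ≤ T) {v v' : TimeL2 T V}
    {w : TimeL2 T (WithLp 2 (V × V))}
    (hw : ∀ᵐ t ∂(timeMeasure T), w t = WithLp.toLp 2 (v t, v' t)) {t : ℝ} (ht : t ∈ Icc 0 T) :
    ∫ s in (0 : ℝ)..t, w s =
      WithLp.toLp 2 (∫ s in (0 : ℝ)..t, v s, ∫ s in (0 : ℝ)..t, v' s) := by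
  have hint := timeL2_intervalIntegrable_of_mem w ⟨le_rfl, hT⟩ ht
  have h1 := (WithLp.fstL 2 ℝ V V).intervalIntegral_comp_comm hint
  have h2 := (WithLp.sndL 2 ℝ V V).intervalIntegral_comp_comm hint
  have h3 : ∫ s in (0 : ℝ)..t, v s = (∫ s in (0 : ℝ)..t, w s).fst := by
    refine Eq.trans (intervalIntegral_congr_timeMeasure ht ?_) h1
    filter_upwards [hw] with s hs
    rw [hs]; rfl
  have h4 : ∫ s in (0 : ℝ)..t, v' s = (∫ s in (0 : ℝ)..t, w s).snd := by
    refine Eq.trans (intervalIntegral_congr_timeMeasure ht ?_) h2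
    filter_upwards [hw] with s hs
    rw [hs]; rfl
  rw [h3, h4]
  rfl

end Pairs

section MaxwellEvolution

variable {Λ : Type*} [MeasurableSpace Λ] {Ω : Opens E3} {P : Measure Λ} [IsProbabilityMeasure P]

/-- The Maxwell system with permittivity `Lη`, permeability `Lμ`, conductivity `S` and source `w`
as an evolution equation for `(E, H)`. -/
theorem isEvolutionData_maxwell (hΩ : Bornology.IsBounded (Ω : Set E3))
    {Lη Lμ : FieldL2 Ω P →L[ℝ] FieldL2 Ω P} {cη cμ : ℝ}
    (hη : ∀ u v, ⟪Lη u, v⟫ = ⟪u, Lη v⟫) (hcη : 0 < cη) (hη' : ∀ u, cη * ‖u‖ ^ 2 ≤ ⟪Lη u, u⟫)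
    (hμ : ∀ u v, ⟪Lμ u, v⟫ = ⟪u, Lμ v⟫) (hcμ : 0 < cμ) (hμ' : ∀ u, cμ * ‖u‖ ^ 2 ≤ ⟪Lμ u, u⟫)
    {S : FieldL2 Ω P → FieldL2 Ω P} {K : NNReal} (hS : LipschitzWith K S) (hS0 : S 0 = 0)
    (hSm : ∀ u v, 0 ≤ ⟪S u - S v, u - v⟫) {w : ℝ → FieldL2 Ω P} {L : NNReal}
    (hw : LipschitzWith L w) :
    IsEvolutionData (maxwellRel Ω P) (blockDiag Lη Lμ)
      (fun u => (WithLp.toLp 2 (-S u.fst, 0) : FieldPair Ω P))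
      (fun t => (WithLp.toLp 2 (w t, 0) : FieldPair Ω P)) (min cη cμ) K L where
  skew := isSkewAdjointRel_maxwellRel hΩ
  symm x y := by
    rw [blockDiag_apply, blockDiag_apply, WithLp.prod_inner_apply, WithLp.prod_inner_apply]
    exact congrArg₂ (· + ·) (hη _ _) (hμ _ _)
  pos := lt_min hcη hcμ
  coercive x := by
    rw [blockDiag_apply, WithLp.prod_inner_apply, WithLp.prod_norm_sq_eq_of_L2, mul_add]
    refine add_le_add (le_trans ?_ (hη' x.fst)) (le_trans ?_ (hμ' x.snd))
    · gcongr; exact min_le_left _ _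
    · gcongr; exact min_le_right _ _
  lipschitz := LipschitzWith.of_dist_le_mul fun x y => by
    have h1 : dist x.fst y.fst ≤ dist x y := by
      rw [dist_eq_norm, dist_eq_norm]
      exact WithLp.norm_fst_le _ (x - y)
    have h2 : dist (WithLp.toLp 2 (-S x.fst, 0) : FieldPair Ω P) (WithLp.toLp 2 (-S y.fst, 0)) =
        dist (S x.fst) (S y.fst) := by
      rw [dist_eq_norm, ← WithLp.toLp_sub, Prod.mk_sub_mk, sub_zero, WithLp.norm_toLp_fst,
        ← dist_eq_norm, dist_neg_neg]
    rw [h2]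
    exact (hS.dist_le_mul _ _).trans (by gcongr)
  map_zero := by simp [hS0]
  dissipative x y := by
    have h1 := hSm x.fst y.fst
    rw [WithLp.prod_inner_apply]
    change ⟪-S x.fst - -S y.fst, x.fst - y.fst⟫ + ⟪(0 : FieldL2 Ω P) - 0, x.snd - y.snd⟫ ≤ 0
    rw [sub_self, inner_zero_left, add_zero, ← neg_sub', inner_neg_left]
    linarith
  source := LipschitzWith.of_dist_le_mul fun s t => by
    rw [dist_eq_norm, ← WithLp.toLp_sub, Prod.mk_sub_mk, sub_zero, WithLp.norm_toLp_fst,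
      ← dist_eq_norm]
    exact hw.dist_le_mul s t

/-- If the time derivative of `B` is a curl, a divergence-free `B` stays divergence-free. -/
theorem HasInitialValue.ae_hasDistribDiv_zero (hΩ : Bornology.IsBounded (Ω : Set E3)) {T : ℝ}
    (hT : 0 < T) {B B' : TimeL2 T (FieldL2 Ω P)} {B₀ : FieldL2 Ω P} (h0 : HasInitialValue B B₀)
    (hB₀ : HasDistribDiv B₀ 0) (h : HasWeakTimeDeriv B B')
    (hcurl : ∀ᵐ t ∂(timeMeasure T), ∃ u, HasWeakCurl u (B' t)) :
    ∀ᵐ t ∂(timeMeasure T), HasDistribDiv (B t) 0 := by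
  filter_upwards [h.ae_eq_primitive_of_initial hT h0, ae_mem_Icc_timeMeasure T] with t h1 ht φ g
  set G := tensorField hΩ (gradField φ).continuous g with hG
  have h2 : ⟪G, B₀⟫ = 0 := by
    have := hB₀ φ g
    rw [divPairing_eq hΩ, ← hG, real_inner_comm G B₀] at this
    simpa using this.symm
  have h3 : ⟪G, ∫ s in (0 : ℝ)..t, B' s⟫ = 0 := by
    have h4 := (innerSL ℝ G).intervalIntegral_comp_comm
      (timeL2_intervalIntegrable_of_mem B' ⟨le_rfl, hT.le⟩ ht)
    have h5 : ∫ s in (0 : ℝ)..t, innerSL ℝ G (B' s) = ∫ s in (0 : ℝ)..t, (0 : ℝ) := by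
      refine intervalIntegral_congr_timeMeasure ht ?_
      filter_upwards [hcurl] with s ⟨u, hs⟩
      have := hs.divPairing_eq_zero hΩ φ g
      rw [divPairing_eq hΩ, neg_eq_zero, ← hG, real_inner_comm G] at this
      exact this
    rw [h5, intervalIntegral.integral_zero] at h4
    exact h4.symm
  rw [divPairing_eq hΩ, h1, ← hG, real_inner_comm G, inner_add_right, h2, h3]
  simp

end MaxwellEvolution

end StochMaxwell

/-! ### Solutions of the Maxwell problem -/

namespace StochMaxwell

variable {Λ : Type*} [MeasurableSpace Λ] {Ω : Opens E3} {P : Measure Λ} [IsProbabilityMeasure P]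
  {T : ℝ} {τ : E3 → Λ → Λ} {ε : ℝ} {η μ : E3 → Λ → E3 → Matrix (Fin 3) (Fin 3) ℝ}
  {σ : E3 → Λ → E3 → E3 → E3} {F : TimeL2 T (FieldL2 Ω P)} {E₀ H₀ : FieldL2 Ω P}
  {E H : TimeL2 T (FieldL2 Ω P)}
  {Lη Lμ : FieldL2 Ω P →L[ℝ] FieldL2 Ω P} {S : FieldL2 Ω P → FieldL2 Ω P}

omit [IsProbabilityMeasure P] in
theorem eq_compLp_of_ae {a : E3 → Λ → E3 → Matrix (Fin 3) (Fin 3) ℝ}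
    {L : FieldL2 Ω P →L[ℝ] FieldL2 Ω P}
    (hL : ∀ u, ∀ᵐ p ∂(domMeasure Ω P), L u p = Matrix.toEuclideanLin (osc τ ε a p) (u p))
    {u v : TimeL2 T (FieldL2 Ω P)} (h : ∀ᵐ t ∂(timeMeasure T), ∀ᵐ p ∂(domMeasure Ω P),
      v t p = Matrix.toEuclideanLin (osc τ ε a p) (u t p)) : v = L.compLp u := by
  refine Lp.ext ?_
  filter_upwards [h, L.coeFn_compLp u] with t h1 h2
  rw [h2]
  refine Lp.ext ?_
  filter_upwards [h1, hL (u t)] with p h3 h4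
  rw [h3, h4]

/-- A solution of the Maxwell problem solves the evolution equation of the Maxwell relation. -/
theorem IsSolution.exists_evolution (hΩ : Bornology.IsBounded (Ω : Set E3)) (hT : 0 < T)
    (hη : ∀ u, ∀ᵐ p ∂(domMeasure Ω P), Lη u p = Matrix.toEuclideanLin (osc τ ε η p) (u p))
    (hμ : ∀ u, ∀ᵐ p ∂(domMeasure Ω P), Lμ u p = Matrix.toEuclideanLin (osc τ ε μ p) (u p))
    (hS : ∀ u, ∀ᵐ p ∂(domMeasure Ω P), S u p = osc τ ε σ p (u p))
    (h : IsSolution τ ε η μ σ F E₀ H₀ E H) :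
    ∃ (V : TimeL2 T (FieldPair Ω P)) (Y : ℝ → FieldPair Ω P),
      (∀ᵐ t ∂(timeMeasure T), (WithLp.toLp 2 (E t, H t) : FieldPair Ω P) =
        WithLp.toLp 2 (E₀, H₀) + ∫ s in (0 : ℝ)..t, V s) ∧
      (∀ᵐ t ∂(timeMeasure T),
        ((WithLp.toLp 2 (E t, H t) : FieldPair Ω P), Y t) ∈ maxwellRel Ω P) ∧
      ∀ᵐ t ∂(timeMeasure T), blockDiag Lη Lμ (V t) =
        Y t + WithLp.toLp 2 (-S (E t), 0) + WithLp.toLp 2 (F t, 0) := by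
  obtain ⟨curlE, curlH, E', H', D, B, J, D', B', hcE, hcH, hE, hH, hD, hB, hJ, hD', hB', e1, e2,
    -, -, hE0, hH0, htr⟩ := h
  obtain ⟨V, hV⟩ := exists_timeL2_pair E' H'
  have hDE : D' = Lη.compLp E' := by
    rw [eq_compLp_of_ae hη hD] at hD'
    exact hD'.unique (hE.map Lη)
  have hBH : B' = Lμ.compLp H' := by
    rw [eq_compLp_of_ae hμ hB] at hB'
    exact hB'.unique (hH.map Lμ)
  refine ⟨V, fun t => WithLp.toLp 2 (curlH t, -curlE t), ?_, ?_, ?_⟩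
  · filter_upwards [hE.ae_eq_primitive_of_initial hT hE0, hH.ae_eq_primitive_of_initial hT hH0,
      ae_mem_Icc_timeMeasure T] with t h1 h2 h3
    rw [primitive_pair hT.le hV h3, h1, h2, ← WithLp.toLp_add, Prod.mk_add_mk]
  · filter_upwards [hcE, hcH, htr] with t h1 h2 ⟨c, h3, h4⟩
    refine ⟨h2, fun w cw hw => ?_⟩
    change ⟪- -curlE t, w⟫ = ⟪E t, cw⟫
    rw [neg_neg, h1.unique hΩ h3]
    exact sub_eq_zero.1 (h4 w cw hw)
  · have e1' : ∀ᵐ t ∂(timeMeasure T), D' t + J t = curlH t + F t := by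
      filter_upwards [Lp.coeFn_add D' J, Lp.coeFn_add curlH F] with t h1 h2
      rw [← Pi.add_apply, ← h1, e1, h2, Pi.add_apply]
    have e2' : ∀ᵐ t ∂(timeMeasure T), B' t = -curlE t := by
      filter_upwards [Lp.coeFn_neg curlE] with t h1
      rw [e2, h1, Pi.neg_apply]
    filter_upwards [hV, e1', e2', hJ, Lη.coeFn_compLp E', Lμ.coeFn_compLp H']
      with t h1 h2 h3 h4 h5 h6
    have h7 : J t = S (E t) := by
      refine Lp.ext ?_
      filter_upwards [h4, hS (E t)] with p h8 h9
      rw [h8, h9]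
    rw [hDE, h5, h7] at h2
    rw [hBH, h6] at h3
    rw [blockDiag_apply, h1]
    change WithLp.toLp 2 (Lη (E' t), Lμ (H' t)) = _
    rw [h3, ← WithLp.toLp_add, ← WithLp.toLp_add, Prod.mk_add_mk, Prod.mk_add_mk, add_zero,
      add_zero, eq_sub_of_add_eq h2, sub_eq_add_neg, add_right_comm]

/-- A pair of fields that solves the Maxwell evolution equation is a solution of the Maxwell
problem: the divergence equations follow from the initial condition. -/
theorem IsSolution.of_evolution (hΩ : Bornology.IsBounded (Ω : Set E3)) (hT : 0 < T)
    (hη : ∀ u, ∀ᵐ p ∂(domMeasure Ω P), Lη u p = Matrix.toEuclideanLin (osc τ ε η p) (u p))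
    (hμ : ∀ u, ∀ᵐ p ∂(domMeasure Ω P), Lμ u p = Matrix.toEuclideanLin (osc τ ε μ p) (u p))
    {K : NNReal} (hSK : LipschitzWith K S) (hS0 : S 0 = 0)
    (hS : ∀ u, ∀ᵐ p ∂(domMeasure Ω P), S u p = osc τ ε σ p (u p))
    (hB₀ : InitialInductionSolenoidal τ ε μ H₀) {E' H' cE cH : TimeL2 T (FieldL2 Ω P)}
    (hE : HasWeakTimeDeriv E E') (hH : HasWeakTimeDeriv H H') (hE0 : HasInitialValue E E₀)
    (hH0 : HasInitialValue H H₀) (hcH : ∀ᵐ t ∂(timeMeasure T), HasWeakCurl (H t) (cH t))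
    (hcE : ∀ᵐ t ∂(timeMeasure T), HasCurlZero (E t) (cE t))
    (e1 : ∀ᵐ t ∂(timeMeasure T), Lη (E' t) + S (E t) = cH t + F t)
    (e2 : ∀ᵐ t ∂(timeMeasure T), Lμ (H' t) = -cE t) :
    IsSolution τ ε η μ σ F E₀ H₀ E H := by
  have hcE' : ∀ᵐ t ∂(timeMeasure T), HasWeakCurl (E t) (cE t) := by
    filter_upwards [hcE] with t ht using ht.hasWeakCurl hΩ
  obtain ⟨B₀, hB₀', hB₀div⟩ := hB₀
  have hB₀eq : B₀ = Lμ H₀ := Lp.ext (by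
    filter_upwards [hB₀', hμ H₀] with p h1 h2
    rw [h1, h2])
  have hB0 : HasInitialValue (Lμ.compLp H) B₀ := by
    obtain ⟨v, hv, hvH, hv0⟩ := hH0
    refine ⟨fun t => Lμ (v t), Lμ.continuous.comp_continuousOn hv, ?_, ?_⟩
    · filter_upwards [hvH, Lμ.coeFn_compLp H] with t h1 h2
      rw [h2, h1]
    · rw [hB₀eq, ← hv0]
  refine ⟨cE, cH, E', H', Lη.compLp E, Lμ.compLp H, hSK.compLp hS0 E, Lη.compLp E', Lμ.compLp H',
    hcE', hcH, hE, hH, ?_, ?_, ?_, hE.map Lη, hH.map Lμ, ?_, ?_, ?_, ?_, hE0, hH0, ?_⟩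
  · filter_upwards [Lη.coeFn_compLp E] with t ht
    rw [ht]; exact hη _
  · filter_upwards [Lμ.coeFn_compLp H] with t ht
    rw [ht]; exact hμ _
  · filter_upwards [hSK.coeFn_compLp hS0 E] with t ht
    rw [ht]; exact hS _
  · refine Lp.ext ?_
    filter_upwards [e1, Lη.coeFn_compLp E', hSK.coeFn_compLp hS0 E,
      Lp.coeFn_add (Lη.compLp E') (hSK.compLp hS0 E), Lp.coeFn_add cH F] with t h1 h2 h3 h4 h5
    rw [h4, h5, Pi.add_apply, Pi.add_apply, h2, h3]
    exact h1
  · refine Lp.ext ?_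
    filter_upwards [e2, Lμ.coeFn_compLp H', Lp.coeFn_neg cE] with t h1 h2 h3
    rw [h2, h3, h1, Pi.neg_apply]
  · refine hB0.ae_hasDistribDiv_zero hΩ hT hB₀div (hH.map Lμ) ?_
    filter_upwards [e2, Lμ.coeFn_compLp H', hcE'] with t h1 h2 h3
    refine ⟨-E t, ?_⟩
    rw [h2, h1, hasWeakCurl_iff hΩ]
    intro φ g
    rw [inner_neg_left, inner_neg_left, (hasWeakCurl_iff hΩ _ _).1 h3 φ g]
  · choose Q hQ using fun t => exists_hasDistribDiv hΩ (Lη.compLp E t)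
    exact ⟨Q, ae_of_all _ hQ⟩
  · filter_upwards [hcE] with t ht using (hasZeroTangentialTrace_iff hΩ).2 ⟨_, ht⟩

end StochMaxwell

theorem theorem3p1 {Λ : Type*} [MeasurableSpace Λ] (P : Measure Λ) [IsProbabilityMeasure P]
    [SeparableSpace (Lp ℝ 2 P)]
    (τ : E3 → Λ → Λ) (hτ : IsDynamicalSystem P τ)
    (Ω : Opens E3) (hΩc : IsConnected (Ω : Set E3)) (hΩb : Bornology.IsBounded (Ω : Set E3))
    (T : ℝ) (hT : 0 < T)
    (η μ : E3 → Λ → E3 → Matrix (Fin 3) (Fin 3) ℝ)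
    (hη : IsMaterialTensor Ω P η) (hμ : IsMaterialTensor Ω P μ)
    (σ : E3 → Λ → E3 → E3 → E3) (hσ : IsConductivity Ω P σ)
    (ε : ℝ) (hε : 0 < ε)
    (F : TimeL2 T (FieldL2 Ω P)) (hF : IsSource F)
    (E₀ H₀ : FieldL2 Ω P) (hE₀ : HasZeroTangentialTrace E₀) (hH₀ : MemHcurl H₀)
    (hB₀ : InitialInductionSolenoidal τ ε μ H₀) :
    ∃! U : TimeL2 T (FieldL2 Ω P) × TimeL2 T (FieldL2 Ω P),
      IsSolution τ ε η μ σ F E₀ H₀ U.1 U.2 := by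
  obtain ⟨Lη, cη, hLη, hηs, hcη, hηc⟩ := hη.exists_mulOperator hτ hΩc.nonempty hε
  obtain ⟨Lμ, cμ, hLμ, hμs, hcμ, hμc⟩ := hμ.exists_mulOperator hτ hΩc.nonempty hε
  obtain ⟨S, K, hSK, hS0, hSm, hS⟩ := hσ.exists_superposition hτ hΩc.nonempty hε
  -- the source is replaced by a Lipschitz representative, defined for all times
  obtain ⟨-, F', -, hFF', hF', -⟩ := hF
  obtain ⟨w, L, hw, hFw⟩ := hFF'.exists_lipschitzWith hT hF'
  have hdata := isEvolutionData_maxwell hΩb hηs hcη hηc hμs hcμ hμc hSK hS0 hSm hw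
  obtain ⟨c₀, hc₀⟩ := (hasZeroTangentialTrace_iff hΩb).1 hE₀
  obtain ⟨d₀, hd₀⟩ := hH₀
  have hinit : ((WithLp.toLp 2 (E₀, H₀) : FieldPair Ω P),
      (WithLp.toLp 2 (d₀, -c₀) : FieldPair Ω P)) ∈ maxwellRel Ω P := by
    refine ⟨hd₀, ?_⟩
    change HasCurlZero E₀ (- -c₀)
    rwa [neg_neg]
  obtain ⟨u, hu, V, Y, hu0, hV, hA, heq⟩ := hdata.exists_solution hT.le hinit
  let p₁ := WithLp.fstL 2 ℝ (FieldL2 Ω P) (FieldL2 Ω P)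
  let p₂ := WithLp.sndL 2 ℝ (FieldL2 Ω P) (FieldL2 Ω P)
  have hE : ∀ᵐ t ∂(timeMeasure T), p₁.compLp (timeL2OfContinuous T hu) t = (u t).fst := by
    filter_upwards [p₁.coeFn_compLp (timeL2OfContinuous T hu), coeFn_timeL2OfContinuous hu]
      with t h1 h2
    rw [h1, h2]; rfl
  have hH : ∀ᵐ t ∂(timeMeasure T), p₂.compLp (timeL2OfContinuous T hu) t = (u t).snd := by
    filter_upwards [p₂.coeFn_compLp (timeL2OfContinuous T hu), coeFn_timeL2OfContinuous hu]
      with t h1 h2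
    rw [h1, h2]; rfl
  refine ⟨(p₁.compLp (timeL2OfContinuous T hu), p₂.compLp (timeL2OfContinuous T hu)), ?_, ?_⟩
  · refine IsSolution.of_evolution (E' := p₁.compLp V) (H' := p₂.compLp V) (cH := p₁.compLp Y)
      (cE := -p₂.compLp Y) hΩb hT hLη hLμ hSK hS0 hS hB₀ (hV.map p₁) (hV.map p₂)
      ⟨fun t => (u t).fst, (p₁.continuous.comp hu).continuousOn, hE,
        congrArg WithLp.fst hu0⟩
      ⟨fun t => (u t).snd, (p₂.continuous.comp hu).continuousOn, hH,
        congrArg WithLp.snd hu0⟩ ?_ ?_ ?_ ?_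
    · filter_upwards [hA, hH, p₁.coeFn_compLp Y] with t h1 h2 h3
      rw [h2, h3]
      exact h1.1
    · filter_upwards [hA, hE, p₂.coeFn_compLp Y, Lp.coeFn_neg (p₂.compLp Y)] with t h1 h2 h3 h4
      rw [h2, h4, Pi.neg_apply, h3]
      exact h1.2
    · filter_upwards [heq, hE, hFw, p₁.coeFn_compLp V, p₁.coeFn_compLp Y] with t h1 h2 h3 h4 h5
      have h6 : Lη (V t).fst = (Y t).fst + -S (u t).fst + w t := congrArg (fun x => x.fst) h1
      rw [h2, h3, h4, h5]
      change Lη (V t).fst + S (u t).fst = (Y t).fst + w t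
      rw [h6]
      abel
    · filter_upwards [heq, p₂.coeFn_compLp V, p₂.coeFn_compLp Y, Lp.coeFn_neg (p₂.compLp Y)]
        with t h1 h2 h3 h4
      have h5 : Lμ (V t).snd = (Y t).snd + 0 + 0 := congrArg (fun x => x.snd) h1
      rw [h2, h4, Pi.neg_apply, h3, neg_neg]
      change Lμ (V t).snd = (Y t).snd
      rw [h5, add_zero, add_zero]
  · rintro ⟨E, H⟩ hEH
    obtain ⟨V', Y', hV', hA', heq'⟩ := hEH.exists_evolution hΩb hT hLη hLμ hS
    have hprim := hV.ae_eq_primitive_of_initial hT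
      (⟨u, hu.continuousOn, coeFn_timeL2OfContinuous hu, hu0⟩ : HasInitialValue _ _)
    have hprim' : ∀ᵐ t ∂(timeMeasure T),
        u t = WithLp.toLp 2 (E₀, H₀) + ∫ s in (0 : ℝ)..t, V s := by
      filter_upwards [hprim, coeFn_timeL2OfContinuous hu] with t h1 h2
      rw [← h2, h1]
    have heq'' : ∀ᵐ t ∂(timeMeasure T), blockDiag Lη Lμ (V' t) =
        Y' t + WithLp.toLp 2 (-S (E t), 0) + WithLp.toLp 2 (w t, 0) := by
      filter_upwards [heq', hFw] with t h1 h2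
      rw [h1, h2]
    have huniq := hdata.ae_eq_of_primitive hT.le
      (u₁ := fun t => (WithLp.toLp 2 (E t, H t) : FieldPair Ω P)) (Y₁ := Y')
      hV' hprim' hA' hA heq'' heq
    refine Prod.ext (Lp.ext ?_) (Lp.ext ?_)
    · filter_upwards [huniq, hE] with t h1 h2 using (congrArg WithLp.fst h1).trans h2.symm
    · filter_upwards [huniq, hH] with t h1 h2 using (congrArg WithLp.snd h1).trans h2.symm
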